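/- All algebras are unital and complex; $\overline{M}=(\overline{m_{ij}})$ denotes the entrywise complex conjugate of a complex matrix $M=(m_{ij})$ and $\overline{M}=(m_{ij}^*)$ the entrywise adjoint of a matrix over a $*$-algebra. For a compact (Hausdorff) abelian group $T$ with dual group $\hat T$, let $\mathbb C[T]=\mathbb C\hat T$ be the Hopf $*$-algebra of polynomial functions on $T$. A bicharacter is a map $\beta\colon\hat T\times\hat T\to\mathbb T$ that is multiplicative in each variable; we write $\beta$ also for its bilinear extension to $\mathbb C[T]$. For right $\mathbb C[T]$-comodule $*$-algebras $B,B'$, with coactions written $b\mapsto b^{(1)}\otimes b^{(2)}$, let $B\otimes_\beta B'$ be $B\otimes B'$ with $$(a\otimes b)(a'\otimes b')=\beta(b^{(2)},a'^{(2)})\,aa'^{(1)}\otimes b^{(1)}b',\qquad (a\otimes b)^*=(1\otimes b^*)(a^*\otimes1).$$ A braided Hopf $*$-algebra over $(T,\beta)$, that is, an object of $\mathrm{Hopf}^*(\mathbb C[T],\beta)$, is a right $\mathbb C[T]$-comodule $*$-algebra $B$ with $\mathbb C[T]$-comodule maps $\Delta\colon B\to B\otimes_\beta B$, $\varepsilon\colon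 B\to\mathbb C$ (both unital $*$-homomorphisms) and $S\colon B\to B$, which satisfy the coalgebra and antipode axioms and $S(S(x^*)^*)=x$. Let $Z=(z_{ij})\in\mathrm{Mat}_m(\mathbb C[T])$ and $U=(u_{ij})\in \mathrm{Mat}_m(B)$. The pair $(Z,U)$ defines a $B$-comodule if both matrices are corepresentation matrices ($\Delta(u_{ij})=\sum_ku_{ik}\otimes u_{kj}$, $\varepsilon(u_{ij})=\delta_{ij}$, and the same for $Z$) and $e_j\mapsto\sum_ie_i\otimes u_{ij}$ is a map of $\mathbb C[T]$-comodules $\mathbb C^m\to\mathbb C^m\otimes B$, where $\mathbb C^m$ has the coaction $e_j\mapsto\sum_i e_i\otimes z_{ij}$. This comodule is unitary if the matrix $(\sum_kz_{ik}\otimes u_{kj})_{i,j}$ over $\mathbb C[T]\otimes_\beta B$ is unitary ($\mathbb C[T]$ coacting on itself by its comultiplication), and unitarizable if $(FZF^{-1},FUF^{-1})$ defines a unitary $B$-comodule for some $F\in\mathrm{GL}_m(\mathbb C)$. Put $$\bar U_Z=(\bar u^Z_{ij}),\qquad \bar u_{ij}^Z=\sum_{s,l,t}\beta(z_{tj}^*z_{sl},z_{il}^*)\,u_{st}^*.$$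 For a unitary corepresentation matrix $Z$, a braided compact matrix quantum group over $(T,Z,\beta)$ with fundamental unitary $U$ is a braided Hopf $*$-algebra $B$ over $(T,\beta)$, generated as a $*$-algebra by the entries of $U\in\mathrm{Mat}_m(B)$, such that $(Z,U)$ defines a unitary $B$-comodule and $(\bar Z,\bar U_Z)$ defines a unitarizable $B$-comodule. For a Hopf $*$-algebra $H$ and a Hopf $*$-algebra map $\pi\colon H\to\mathbb C[T]$, let $H_{a,b}$ ($a,b\in\hat T$) be the space of all $x\in H$ with $(\pi\otimes\iota)\Delta(x)=a\otimes x$ and $(\iota\otimes\pi)\Delta(x)=x\otimes b$. The transmutation $H_\beta$ is the braided Hopf $*$-algebra over $(T,\beta)$ that has the unit, comultiplication and counit of $H$, the coaction $x\mapsto x_{(2)}\otimes\pi(S(x_{(1)})x_{(3)})$, and the product, antipode and involution determined by $$x\cdot_\beta y=\beta(a^{-1}b,c^{-1})xy,\quad S_\beta(x)=\beta(a^{-1}b,b)S(x),\quad x^{*_\beta}=\beta(a^{-1}b,a^{-1})x^*\qquad(x\in H_{a,b},\ y\in H_{c,d}).$$ For $F\in\mathrm{GL}_m(\mathbb C)$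 with $F\bar F=\pm1$, let $\mathbb C[O_F^+]$ be the universal unital $*$-algebra with generators $v_{ij}$, $1\le i,j\le m$, subject to the relations that $V=(v_{ij})$ is unitary and $V=F\bar VF^{-1}$, with the Hopf $*$-algebra structure $\Delta(v_{ij})=\sum_kv_{ik}\otimes v_{kj}$, $\varepsilon(v_{ij})=\delta_{ij}$, $S(v_{ij})=v_{ji}^*$. **Proposition.** Let $m\ge2$, let $A\in\mathrm{GL}_m(\mathbb C)$ be such that $A\bar A$ is unitary, and let $\tau=\pm1$, with $\tau=1$ if $m$ is odd. (1) There exist a compact abelian group $T$, a unitary corepresentation matrix $X=(x_{ij})\in\mathrm{Mat}_m(\mathbb C[T])$, a character $w\in\hat T$ and a bicharacter $\beta\colon\hat T\times\hat T\to\mathbb T$ such that $$A(w^2\bar X)A^{-1}=X\quad\text{and}\quad AC\,\overline{AC}=\tau1,\qquad\text{where } C=(\beta(x_{ij}^*,w))_{i,j}.$$ (2) For every such quadruple $(T,X,w,\beta)$, let $\mathbb C[O_A^{X,\beta}]$ be the universal unital $*$-algebra with generators $u_{ij}$, $1\le i,j\le m$, subject to the relations that $U=(u_{ij})$ is unitary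 and $U=A\bar U_XA^{-1}$. Then $\mathbb C[O_A^{X,\beta}]$, with the coaction $\delta(u_{ij})=\sum_{s,t}u_{st}\otimes x_{si}^*x_{tj}$ and with $\Delta(u_{ij})=\sum_ku_{ik}\otimes u_{kj}$, $\varepsilon(u_{ij})=\delta_{ij}$, $S(u_{ij})=u_{ji}^*$, is a braided compact matrix quantum group over $(T,X,\beta)$ with fundamental unitary $U$. (3) In the situation of (2), put $F=AC$. Then there is a Hopf $*$-algebra map $\pi\colon\mathbb C[O_F^+]\to\mathbb C[T]$ with $\pi(v_{ij})=w^{-1}x_{ij}$, and the braided Hopf $*$-algebra $\mathbb C[O_A^{X,\beta}]$ is isomorphic to the transmutation $\mathbb C[O_F^+]_\beta$ with respect to $\pi$, by an isomorphism with $u_{ij}\mapsto v_{ij}$. -/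

import Mathlib

open scoped TensorProduct

noncomputable section

namespace BraidedQG

/-! ## The Hopf `*`-algebra of a discrete abelian group

For a compact abelian group `T` with dual group `Γ = PontryaginDual T`, the Hopf `*`-algebra
`ℂ[T]` of polynomial functions is identified with the group algebra of `Γ`.  Mathlib provides its
Hopf algebra structure; the involution is `γ* = γ⁻¹` for `γ ∈ Γ`, extended conjugate linearly. -/

section GroupAlgebra

variable {Γ : Type*} [CommGroup Γ]

/-- The conjugate linear ring endomorphism of `ℂΓ` with `γ ↦ γ⁻¹`. -/
def groupAlgStarHom (Γ : Type*) [CommGroup Γ] : MonoidAlgebra ℂ Γ →+* MonoidAlgebra ℂ Γ :=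
  (MonoidAlgebra.mapDomainRingHom ℂ (invMonoidHom : Γ →* Γ)).comp
    (MonoidAlgebra.mapRingHom Γ (starRingEnd ℂ))

theorem groupAlgStarHom_single (g : Γ) (c : ℂ) :
    groupAlgStarHom Γ (MonoidAlgebra.single g c) = MonoidAlgebra.single g⁻¹ (star c) := by
  simp [groupAlgStarHom]

theorem groupAlgStarHom_involutive (x : MonoidAlgebra ℂ Γ) :
    groupAlgStarHom Γ (groupAlgStarHom Γ x) = x := by
  have h : (groupAlgStarHom Γ).comp (groupAlgStarHom Γ) = RingHom.id _ := by
    refine MonoidAlgebra.ringHom_ext (fun c => ?_) (fun g => ?_) <;>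
      simp [groupAlgStarHom_single]
  exact congrArg (fun f => f x) h

instance instStarRingGroupAlg : StarRing (MonoidAlgebra ℂ Γ) where
  star := groupAlgStarHom Γ
  star_involutive := groupAlgStarHom_involutive
  star_mul a b := by
    change groupAlgStarHom Γ (a * b) = groupAlgStarHom Γ b * groupAlgStarHom Γ a
    rw [map_mul, mul_comm]
  star_add a b := map_add (groupAlgStarHom Γ) a b

theorem star_single (g : Γ) (c : ℂ) :
    star (MonoidAlgebra.single g c) = MonoidAlgebra.single g⁻¹ (star c) :=
  groupAlgStarHom_single g c

instance instStarModuleGroupAlg : StarModule ℂ (MonoidAlgebra ℂ Γ) where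
  star_smul c a := by
    have h1 : ∀ (d : ℂ) (b : MonoidAlgebra ℂ Γ), d • b = MonoidAlgebra.single 1 d * b := by
      intro d b
      rw [Algebra.smul_def]
      rfl
    rw [h1, h1, star_mul, star_single, mul_comm, inv_one]

/-- Bicharacters `Γ × Γ → 𝕋`. -/
abbrev Bichar (Γ : Type*) [CommGroup Γ] := Γ →* Γ →* Circle

/-- The bilinear extension of a bicharacter to `ℂΓ`. -/
def Bichar.lin (β : Bichar Γ) :
    MonoidAlgebra ℂ Γ →ₗ[ℂ] MonoidAlgebra ℂ Γ →ₗ[ℂ] ℂ :=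
  (Finsupp.linearCombination ℂ fun a : Γ =>
    (Finsupp.linearCombination ℂ fun b : Γ => ((β a b : Circle) : ℂ)) ∘ₗ
      (MonoidAlgebra.coeffLinearEquiv ℂ).toLinearMap) ∘ₗ
    (MonoidAlgebra.coeffLinearEquiv ℂ).toLinearMap

theorem Bichar.lin_single (β : Bichar Γ) (a b : Γ) (c d : ℂ) :
    β.lin (MonoidAlgebra.single a c) (MonoidAlgebra.single b d) = c * d * (β a b : ℂ) := by
  simp [Bichar.lin, mul_assoc]

end GroupAlgebra

/-! ## Braided tensor products -/

section Braided

variable {Γ : Type*} [CommGroup Γ] (β : Bichar Γ)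
variable {M N : Type*} [AddCommGroup M] [Module ℂ M] [AddCommGroup N] [Module ℂ N]

/-- The tensor product of two right `ℂΓ`-comodules,
`m ⊗ n ↦ m⁽¹⁾ ⊗ n⁽¹⁾ ⊗ m⁽²⁾n⁽²⁾`. -/
def tensorCoact (δM : M →ₗ[ℂ] M ⊗[ℂ] MonoidAlgebra ℂ Γ) (δN : N →ₗ[ℂ] N ⊗[ℂ] MonoidAlgebra ℂ Γ) :
    M ⊗[ℂ] N →ₗ[ℂ] (M ⊗[ℂ] N) ⊗[ℂ] MonoidAlgebra ℂ Γ :=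
  (LinearMap.mul' ℂ (MonoidAlgebra ℂ Γ)).lTensor (M ⊗[ℂ] N) ∘ₗ
    (TensorProduct.tensorTensorTensorComm ℂ M (MonoidAlgebra ℂ Γ) N
      (MonoidAlgebra ℂ Γ)).toLinearMap ∘ₗ
    TensorProduct.map δM δN

/-- The braiding `m ⊗ n ↦ β(m⁽²⁾, n⁽²⁾) n⁽¹⁾ ⊗ m⁽¹⁾` of right `ℂΓ`-comodules. -/
def braiding (δM : M →ₗ[ℂ] M ⊗[ℂ] MonoidAlgebra ℂ Γ) (δN : N →ₗ[ℂ] N ⊗[ℂ] MonoidAlgebra ℂ Γ) :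
    M ⊗[ℂ] N →ₗ[ℂ] N ⊗[ℂ] M :=
  (TensorProduct.comm ℂ M N).toLinearMap ∘ₗ
    (TensorProduct.rid ℂ (M ⊗[ℂ] N)).toLinearMap ∘ₗ
    (TensorProduct.lift β.lin).lTensor (M ⊗[ℂ] N) ∘ₗ
    (TensorProduct.tensorTensorTensorComm ℂ M (MonoidAlgebra ℂ Γ) N
      (MonoidAlgebra ℂ Γ)).toLinearMap ∘ₗ
    TensorProduct.map δM δN

variable {A B : Type*} [Ring A] [Algebra ℂ A] [Ring B] [Algebra ℂ B]

/-- The product of the braided tensor product `A ⊗_β B`,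
`(a ⊗ b)(a' ⊗ b') = β(b⁽²⁾, a'⁽²⁾) aa'⁽¹⁾ ⊗ b⁽¹⁾b'`. -/
def braidedMul (δA : A →ₗ[ℂ] A ⊗[ℂ] MonoidAlgebra ℂ Γ) (δB : B →ₗ[ℂ] B ⊗[ℂ] MonoidAlgebra ℂ Γ)
    (x y : A ⊗[ℂ] B) : A ⊗[ℂ] B :=
  TensorProduct.map (LinearMap.mul' ℂ A) (LinearMap.mul' ℂ B)
    ((TensorProduct.assoc ℂ A A (B ⊗[ℂ] B)).symm
      ((TensorProduct.assoc ℂ A B B).toLinearMap.lTensor A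
        (((braiding β δB δA).rTensor B).lTensor A
          ((TensorProduct.assoc ℂ B A B).symm.toLinearMap.lTensor A
            (TensorProduct.assoc ℂ A B (A ⊗[ℂ] B) (x ⊗ₜ[ℂ] y))))))

/-- The involution of the braided tensor product `A ⊗_β B`,
`(a ⊗ b)* = β((b*)⁽²⁾, (a*)⁽²⁾) (a*)⁽¹⁾ ⊗ (b*)⁽¹⁾`. -/
def braidedStar [StarRing A] [StarModule ℂ A] [StarRing B] [StarModule ℂ B]
    (δA : A →ₗ[ℂ] A ⊗[ℂ] MonoidAlgebra ℂ Γ) (δB : B →ₗ[ℂ] B ⊗[ℂ] MonoidAlgebra ℂ Γ)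
    (x : A ⊗[ℂ] B) : A ⊗[ℂ] B :=
  braiding β δB δA (TensorProduct.comm ℂ A B (star x))

theorem braiding_tmul_of_homogeneous {δM : M →ₗ[ℂ] M ⊗[ℂ] MonoidAlgebra ℂ Γ}
    {δN : N →ₗ[ℂ] N ⊗[ℂ] MonoidAlgebra ℂ Γ} {m : M} {n : N} {g h : Γ}
    (hm : δM m = m ⊗ₜ MonoidAlgebra.single g 1) (hn : δN n = n ⊗ₜ MonoidAlgebra.single h 1) :
    braiding β δM δN (m ⊗ₜ n) = (β g h : ℂ) • (n ⊗ₜ[ℂ] m) := by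
  simp [braiding, hm, hn, Bichar.lin_single]

theorem braidedMul_tmul_of_homogeneous {δA : A →ₗ[ℂ] A ⊗[ℂ] MonoidAlgebra ℂ Γ}
    {δB : B →ₗ[ℂ] B ⊗[ℂ] MonoidAlgebra ℂ Γ} {a a' : A} {b b' : B} {g h : Γ}
    (hb : δB b = b ⊗ₜ MonoidAlgebra.single g 1) (ha' : δA a' = a' ⊗ₜ MonoidAlgebra.single h 1) :
    braidedMul β δA δB (a ⊗ₜ b) (a' ⊗ₜ b') = (β g h : ℂ) • ((a * a') ⊗ₜ[ℂ] (b * b')) := by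
  simp [braidedMul, braiding_tmul_of_homogeneous β hb ha', TensorProduct.smul_tmul',
    TensorProduct.tmul_smul]

end Braided

/-! ## Hopf `*`-algebras and braided Hopf `*`-algebras -/

/-- The structure of a Hopf `*`-algebra on a given unital `*`-algebra `H`. -/
structure HopfStar (H : Type*) [Ring H] [Algebra ℂ H] [StarRing H] [StarModule ℂ H] where
  comul : H →⋆ₐ[ℂ] H ⊗[ℂ] H
  counit : H →⋆ₐ[ℂ] ℂ
  antipode : H →ₗ[ℂ] H
  coassoc : (TensorProduct.assoc ℂ H H H).toLinearMap ∘ₗ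
      comul.toAlgHom.toLinearMap.rTensor H ∘ₗ comul.toAlgHom.toLinearMap =
    comul.toAlgHom.toLinearMap.lTensor H ∘ₗ comul.toAlgHom.toLinearMap
  counit_left : (TensorProduct.lid ℂ H).toLinearMap ∘ₗ
      counit.toAlgHom.toLinearMap.rTensor H ∘ₗ comul.toAlgHom.toLinearMap = LinearMap.id
  counit_right : (TensorProduct.rid ℂ H).toLinearMap ∘ₗ
      counit.toAlgHom.toLinearMap.lTensor H ∘ₗ comul.toAlgHom.toLinearMap = LinearMap.id
  antipode_left : LinearMap.mul' ℂ H ∘ₗ antipode.rTensor H ∘ₗ comul.toAlgHom.toLinearMap =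
    Algebra.linearMap ℂ H ∘ₗ counit.toAlgHom.toLinearMap
  antipode_right : LinearMap.mul' ℂ H ∘ₗ antipode.lTensor H ∘ₗ comul.toAlgHom.toLinearMap =
    Algebra.linearMap ℂ H ∘ₗ counit.toAlgHom.toLinearMap
  antipode_star : ∀ x : H, antipode (star (antipode (star x))) = x

/-- The structure of a braided Hopf `*`-algebra, i.e. of an object of `Hopf*(ℂΓ, β)`, on a given
unital `*`-algebra `A`: a right `ℂΓ`-comodule `*`-algebra with a comultiplication
`A → A ⊗_β A`, a counit and an antipode, all of which are morphisms of `ℂΓ`-comodules. -/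
structure BraidedHopfStar {Γ : Type*} [CommGroup Γ] (β : Bichar Γ)
    (A : Type*) [Ring A] [Algebra ℂ A] [StarRing A] [StarModule ℂ A] where
  coact : A →⋆ₐ[ℂ] A ⊗[ℂ] MonoidAlgebra ℂ Γ
  comul : A →ₗ[ℂ] A ⊗[ℂ] A
  counit : A →⋆ₐ[ℂ] ℂ
  antipode : A →ₗ[ℂ] A
  -- `A` is a right `ℂΓ`-comodule
  coact_coassoc : (TensorProduct.assoc ℂ A (MonoidAlgebra ℂ Γ) (MonoidAlgebra ℂ Γ)).toLinearMap ∘ₗ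
      coact.toAlgHom.toLinearMap.rTensor (MonoidAlgebra ℂ Γ) ∘ₗ coact.toAlgHom.toLinearMap =
    (Coalgebra.comul (R := ℂ) (A := MonoidAlgebra ℂ Γ)).lTensor A ∘ₗ coact.toAlgHom.toLinearMap
  coact_counit : (TensorProduct.rid ℂ A).toLinearMap ∘ₗ
      (Coalgebra.counit (R := ℂ) (A := MonoidAlgebra ℂ Γ)).lTensor A ∘ₗ
        coact.toAlgHom.toLinearMap = LinearMap.id
  -- the structure maps are morphisms of comodules
  comul_equivariant :
    tensorCoact coact.toAlgHom.toLinearMap coact.toAlgHom.toLinearMap ∘ₗ comul =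
      comul.rTensor (MonoidAlgebra ℂ Γ) ∘ₗ coact.toAlgHom.toLinearMap
  counit_equivariant : ∀ x : A,
    counit.toAlgHom.toLinearMap.rTensor (MonoidAlgebra ℂ Γ) (coact x) =
      counit x ⊗ₜ[ℂ] (1 : MonoidAlgebra ℂ Γ)
  antipode_equivariant :
    antipode.rTensor (MonoidAlgebra ℂ Γ) ∘ₗ coact.toAlgHom.toLinearMap =
      coact.toAlgHom.toLinearMap ∘ₗ antipode
  -- `comul` is a unital `*`-homomorphism into the braided tensor product
  comul_one : comul 1 = 1 ⊗ₜ[ℂ] 1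
  comul_mul : ∀ x y : A, comul (x * y) =
    braidedMul β coact.toAlgHom.toLinearMap coact.toAlgHom.toLinearMap (comul x) (comul y)
  comul_star : ∀ x : A, comul (star x) =
    braidedStar β coact.toAlgHom.toLinearMap coact.toAlgHom.toLinearMap (comul x)
  -- coalgebra and antipode axioms
  coassoc : (TensorProduct.assoc ℂ A A A).toLinearMap ∘ₗ comul.rTensor A ∘ₗ comul =
    comul.lTensor A ∘ₗ comul
  counit_left : (TensorProduct.lid ℂ A).toLinearMap ∘ₗ
      counit.toAlgHom.toLinearMap.rTensor A ∘ₗ comul = LinearMap.id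
  counit_right : (TensorProduct.rid ℂ A).toLinearMap ∘ₗ
      counit.toAlgHom.toLinearMap.lTensor A ∘ₗ comul = LinearMap.id
  antipode_left : LinearMap.mul' ℂ A ∘ₗ antipode.rTensor A ∘ₗ comul =
    Algebra.linearMap ℂ A ∘ₗ counit.toAlgHom.toLinearMap
  antipode_right : LinearMap.mul' ℂ A ∘ₗ antipode.lTensor A ∘ₗ comul =
    Algebra.linearMap ℂ A ∘ₗ counit.toAlgHom.toLinearMap
  antipode_star : ∀ x : A, antipode (star (antipode (star x))) = x

/-! ## Comodules given by matrices, braided compact matrix quantum groups -/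

section Corep

variable {Γ : Type*} [CommGroup Γ] {β : Bichar Γ} {m : ℕ}
variable {A : Type*} [Ring A] [Algebra ℂ A] [StarRing A] [StarModule ℂ A]

/-- Corepresentation matrices for the Hopf algebra `ℂΓ`. -/
def IsCorepMatrix (Z : Matrix (Fin m) (Fin m) (MonoidAlgebra ℂ Γ)) : Prop :=
  (∀ i j, Coalgebra.comul (R := ℂ) (Z i j) = ∑ k, Z i k ⊗ₜ[ℂ] Z k j) ∧
    ∀ i j, Coalgebra.counit (R := ℂ) (Z i j) = (1 : Matrix (Fin m) (Fin m) ℂ) i j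

/-- The linear map `ℂᵐ → ℂᵐ ⊗ V`, `e_j ↦ ∑ i, e_i ⊗ v_ij`. -/
def coactOfMatrix {V : Type*} [AddCommGroup V] [Module ℂ V] (v : Matrix (Fin m) (Fin m) V) :
    (Fin m → ℂ) →ₗ[ℂ] (Fin m → ℂ) ⊗[ℂ] V :=
  (Pi.basisFun ℂ (Fin m)).constr ℂ fun j => ∑ i, Pi.basisFun ℂ (Fin m) i ⊗ₜ[ℂ] v i j

/-- The pair `(Z, U)` defines a comodule over the braided Hopf `*`-algebra: `Z` is a
corepresentation matrix for `ℂΓ`, `U` is one for the coalgebra `A`, and `δ_U` is a morphism of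
`ℂΓ`-comodules. -/
def IsComodulePair (𝒜 : BraidedHopfStar β A) (Z : Matrix (Fin m) (Fin m) (MonoidAlgebra ℂ Γ))
    (U : Matrix (Fin m) (Fin m) A) : Prop :=
  IsCorepMatrix Z ∧
  (∀ i j, 𝒜.comul (U i j) = ∑ k, U i k ⊗ₜ[ℂ] U k j) ∧
  (∀ i j, 𝒜.counit (U i j) = (1 : Matrix (Fin m) (Fin m) ℂ) i j) ∧
  (coactOfMatrix U).rTensor (MonoidAlgebra ℂ Γ) ∘ₗ coactOfMatrix Z =
    tensorCoact (coactOfMatrix Z) 𝒜.coact.toAlgHom.toLinearMap ∘ₗ coactOfMatrix U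

/-- The corepresentation matrix `Z # U = (∑ k, z_ik # u_kj)` of the bosonization `ℂΓ # A`. -/
def smashMatrix (Z : Matrix (Fin m) (Fin m) (MonoidAlgebra ℂ Γ)) (U : Matrix (Fin m) (Fin m) A) :
    Matrix (Fin m) (Fin m) (MonoidAlgebra ℂ Γ ⊗[ℂ] A) :=
  Matrix.of fun i j => ∑ k, Z i k ⊗ₜ[ℂ] U k j

/-- Unitarity of a matrix over the bosonization `ℂΓ # A = ℂΓ ⊗_β A`, where `ℂΓ` is a comodule over
itself by its comultiplication. -/
def IsSmashUnitary (𝒜 : BraidedHopfStar β A)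
    (W : Matrix (Fin m) (Fin m) (MonoidAlgebra ℂ Γ ⊗[ℂ] A)) : Prop :=
  (∀ i j, ∑ k, braidedMul β (Coalgebra.comul (R := ℂ) (A := MonoidAlgebra ℂ Γ))
      𝒜.coact.toAlgHom.toLinearMap (W i k)
      (braidedStar β (Coalgebra.comul (R := ℂ) (A := MonoidAlgebra ℂ Γ))
        𝒜.coact.toAlgHom.toLinearMap (W j k)) = if i = j then 1 ⊗ₜ[ℂ] 1 else 0) ∧
  ∀ i j, ∑ k, braidedMul β (Coalgebra.comul (R := ℂ) (A := MonoidAlgebra ℂ Γ))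
      𝒜.coact.toAlgHom.toLinearMap
      (braidedStar β (Coalgebra.comul (R := ℂ) (A := MonoidAlgebra ℂ Γ))
        𝒜.coact.toAlgHom.toLinearMap (W k i)) (W k j) = if i = j then 1 ⊗ₜ[ℂ] 1 else 0

/-- `(Z, U)` defines a unitary comodule: the associated comodule over the bosonization is
unitary. -/
def IsUnitaryComodulePair (𝒜 : BraidedHopfStar β A)
    (Z : Matrix (Fin m) (Fin m) (MonoidAlgebra ℂ Γ)) (U : Matrix (Fin m) (Fin m) A) : Prop :=
  IsComodulePair 𝒜 Z U ∧ IsSmashUnitary 𝒜 (smashMatrix Z U)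

/-- `F V F⁻¹` for a complex matrix `F` and a matrix `V` over a complex algebra. -/
def conjBy {R : Type*} [Ring R] [Algebra ℂ R] (F : Matrix (Fin m) (Fin m) ℂ)
    (V : Matrix (Fin m) (Fin m) R) : Matrix (Fin m) (Fin m) R :=
  F.map (algebraMap ℂ R) * V * F⁻¹.map (algebraMap ℂ R)

/-- `(Z, U)` defines a unitarizable comodule: it becomes unitary after a change of basis. -/
def IsUnitarizableComodulePair (𝒜 : BraidedHopfStar β A)
    (Z : Matrix (Fin m) (Fin m) (MonoidAlgebra ℂ Γ)) (U : Matrix (Fin m) (Fin m) A) : Prop :=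
  IsComodulePair 𝒜 Z U ∧ ∃ F : Matrix (Fin m) (Fin m) ℂ, IsUnit F.det ∧
    IsUnitaryComodulePair 𝒜 (conjBy F Z) (conjBy F U)

/-- The matrix `Ū_Z`, with entries `∑ s l t, β(z_tj* z_sl, z_il*) u_st*`. -/
def conjMatrix (β : Bichar Γ) (Z : Matrix (Fin m) (Fin m) (MonoidAlgebra ℂ Γ))
    {R : Type*} [Ring R] [Algebra ℂ R] [StarRing R]
    (U : Matrix (Fin m) (Fin m) R) : Matrix (Fin m) (Fin m) R :=
  Matrix.of fun i j => ∑ s, ∑ l, ∑ t,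
    β.lin (star (Z t j) * Z s l) (star (Z i l)) • star (U s t)

/-- The braided Hopf `*`-algebra `A` is a braided compact matrix quantum group over `(T, Z, β)`,
`Γ` being the dual of `T`, with fundamental unitary `U`. -/
structure IsBraidedCMQG (𝒜 : BraidedHopfStar β A)
    (Z : Matrix (Fin m) (Fin m) (MonoidAlgebra ℂ Γ)) (U : Matrix (Fin m) (Fin m) A) : Prop where
  unitary_corep : IsCorepMatrix Z ∧ Z ∈ unitary (Matrix (Fin m) (Fin m) (MonoidAlgebra ℂ Γ))
  generated : StarAlgebra.adjoin ℂ {x : A | ∃ i j, U i j = x} = ⊤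
  fundamental_unitary : IsUnitaryComodulePair 𝒜 Z U
  conjugate_unitarizable : IsUnitarizableComodulePair 𝒜 (Z.map star) (conjMatrix β Z U)

end Corep

/-! ## Universal `*`-algebras -/

section Universal

/-- The free unital complex `*`-algebra on `ι`: the free algebra on the symbols
`x_i = Sum.inl i` and `x_i* = Sum.inr i`. -/
def FreeStarAlg (ι : Type) : Type := FreeAlgebra ℂ (ι ⊕ ι)

instance (ι : Type) : Ring (FreeStarAlg ι) := inferInstanceAs (Ring (FreeAlgebra ℂ (ι ⊕ ι)))
instance (ι : Type) : Algebra ℂ (FreeStarAlg ι) :=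
  inferInstanceAs (Algebra ℂ (FreeAlgebra ℂ (ι ⊕ ι)))

/-- The opposite ring of a complex algebra, with the conjugate scalar multiplication. -/
def ConjOp (R : Type*) : Type _ := Rᵐᵒᵖ

instance (R : Type*) [Ring R] : Ring (ConjOp R) := inferInstanceAs (Ring Rᵐᵒᵖ)
instance (R : Type*) [Ring R] [Algebra ℂ R] : Algebra ℂ (ConjOp R) :=
  RingHom.toAlgebra' ((algebraMap ℂ Rᵐᵒᵖ).comp (starRingEnd ℂ))
    fun c x => Algebra.commutes (R := ℂ) (A := Rᵐᵒᵖ) (starRingEnd ℂ c) x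

variable {ι : Type}

namespace FreeStarAlg

/-- The generators of the free `*`-algebra. -/
def gen (i : ι) : FreeStarAlg ι := FreeAlgebra.ι ℂ (Sum.inl i)

/-- The conjugate linear antiautomorphism interchanging `x_i` and `x_i*`. -/
def starHom (ι : Type) : FreeStarAlg ι →ₐ[ℂ] ConjOp (FreeStarAlg ι) :=
  FreeAlgebra.lift ℂ fun s =>
    (MulOpposite.op (FreeAlgebra.ι ℂ s.swap : FreeAlgebra ℂ (ι ⊕ ι)) : ConjOp (FreeStarAlg ι))

/-- The underlying map of `starHom`. -/
def starFun (x : FreeStarAlg ι) : FreeStarAlg ι := MulOpposite.unop (starHom ι x)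

theorem starFun_ι (s : ι ⊕ ι) :
    starFun (FreeAlgebra.ι ℂ s : FreeAlgebra ℂ (ι ⊕ ι)) =
      (FreeAlgebra.ι ℂ s.swap : FreeAlgebra ℂ (ι ⊕ ι)) := by
  unfold starFun starHom
  erw [FreeAlgebra.lift_ι_apply]
  rfl

theorem starFun_algebraMap (c : ℂ) :
    starFun (algebraMap ℂ (FreeStarAlg ι) c) = algebraMap ℂ (FreeStarAlg ι) (star c) := by
  unfold starFun
  rw [AlgHom.commutes]
  rfl

theorem starFun_mul (x y : FreeStarAlg ι) : starFun (x * y) = starFun y * starFun x := by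
  unfold starFun
  rw [map_mul]
  rfl

theorem starFun_add (x y : FreeStarAlg ι) : starFun (x + y) = starFun x + starFun y := by
  unfold starFun
  rw [map_add]
  rfl

theorem starFun_starFun (x : FreeStarAlg ι) : starFun (starFun x) = x := by
  refine FreeAlgebra.induction (R := ℂ) (X := ι ⊕ ι)
    (motive := fun x => starFun (starFun (x : FreeStarAlg ι)) = x) ?_ ?_ ?_ ?_ x
  · intro c
    erw [starFun_algebraMap, starFun_algebraMap]
    rw [star_star]
    rfl
  · intro s
    erw [starFun_ι, starFun_ι]
    rw [Sum.swap_swap]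
  · intro a b ha hb
    erw [starFun_mul, starFun_mul, ha, hb]
    rfl
  · intro a b ha hb
    erw [starFun_add, starFun_add, ha, hb]
    rfl

instance : StarRing (FreeStarAlg ι) where
  star := starFun
  star_involutive := starFun_starFun
  star_mul := starFun_mul
  star_add := starFun_add

instance : StarModule ℂ (FreeStarAlg ι) where
  star_smul c x := by
    change starFun (c • x) = star c • starFun x
    rw [Algebra.smul_def, Algebra.smul_def, starFun_mul, starFun_algebraMap, Algebra.commutes]

/-- The universal property of the free `*`-algebra. -/
theorem existsUnique_lift {B : Type*} [Ring B] [Algebra ℂ B] [StarRing B] [StarModule ℂ B]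
    (v : ι → B) : ∃! φ : FreeStarAlg ι →⋆ₐ[ℂ] B, ∀ i, φ (gen i) = v i := by
  let φ₀ : FreeStarAlg ι →ₐ[ℂ] B := FreeAlgebra.lift ℂ (Sum.elim v fun i => star (v i))
  have hι : ∀ s : ι ⊕ ι, φ₀ (FreeAlgebra.ι ℂ s : FreeAlgebra ℂ (ι ⊕ ι)) =
      Sum.elim v (fun i => star (v i)) s := fun s =>
    FreeAlgebra.lift_ι_apply (Sum.elim v fun i => star (v i)) s
  have hstar : ∀ x : FreeStarAlg ι, φ₀ (starFun x) = star (φ₀ x) := by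
    intro x
    refine FreeAlgebra.induction (R := ℂ) (X := ι ⊕ ι)
      (motive := fun x => φ₀ (starFun (x : FreeStarAlg ι)) = star (φ₀ (x : FreeStarAlg ι)))
      ?_ ?_ ?_ ?_ x
    · intro c
      have h := φ₀.commutes c
      have h' := φ₀.commutes (star c)
      erw [starFun_algebraMap]
      refine h'.trans ?_
      refine (algebraMap_star_comm c).trans ?_
      exact congrArg star h.symm
    · intro s
      erw [starFun_ι]
      rw [hι, hι]
      cases s <;> simp
    · intro a b ha hb
      erw [starFun_mul, map_mul, map_mul, ha, hb]
      rw [star_mul]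
    · intro a b ha hb
      erw [starFun_add, map_add, map_add, ha, hb]
      rw [star_add]
  refine ⟨{ φ₀ with map_star' := hstar }, fun i => hι (Sum.inl i), ?_⟩
  intro ψ hψ
  have key : (ψ : FreeStarAlg ι →ₐ[ℂ] B) = φ₀ := by
    refine FreeAlgebra.hom_ext (funext fun s => ?_)
    rcases s with i | i
    · exact (hψ i).trans (hι (Sum.inl i)).symm
    · have e : (FreeAlgebra.ι ℂ (Sum.inr i) : FreeAlgebra ℂ (ι ⊕ ι)) =
          (star (gen i) : FreeStarAlg ι) := (starFun_ι (Sum.inl i)).symm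
      change ψ (FreeAlgebra.ι ℂ (Sum.inr i) : FreeAlgebra ℂ (ι ⊕ ι)) = φ₀ _
      rw [hι]
      have h2 : ψ (star (gen i)) = star (v i) := by rw [map_star, hψ]
      exact (congrArg ψ e).trans h2
  ext x
  exact congrArg (fun f : FreeStarAlg ι →ₐ[ℂ] B => f x) key

end FreeStarAlg

/-- The smallest relation containing `r` and closed under the involution. -/
def starClosure (r : FreeStarAlg ι → FreeStarAlg ι → Prop) (a b : FreeStarAlg ι) : Prop :=
  r a b ∨ r (star a) (star b)

theorem starClosure_star (r : FreeStarAlg ι → FreeStarAlg ι → Prop) (a b : FreeStarAlg ι)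
    (h : starClosure r a b) : starClosure r (star a) (star b) := by
  rcases h with h | h
  · exact Or.inr (by simpa using h)
  · exact Or.inl h

/-- The universal unital complex `*`-algebra with generators indexed by `ι` and relations `r`. -/
def UnivStarAlg (r : FreeStarAlg ι → FreeStarAlg ι → Prop) : Type :=
  RingQuot (starClosure r)

namespace UnivStarAlg

variable (r : FreeStarAlg ι → FreeStarAlg ι → Prop)

instance : Ring (UnivStarAlg r) := inferInstanceAs (Ring (RingQuot (starClosure r)))
instance : Algebra ℂ (UnivStarAlg r) := inferInstanceAs (Algebra ℂ (RingQuot (starClosure r)))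
instance : StarRing (UnivStarAlg r) := RingQuot.starRing (starClosure r) (starClosure_star r)

/-- The quotient map. -/
def mk : FreeStarAlg ι →ₐ[ℂ] UnivStarAlg r := RingQuot.mkAlgHom ℂ (starClosure r)

theorem mk_surjective : Function.Surjective (mk r) :=
  RingQuot.mkAlgHom_surjective ℂ (starClosure r)

theorem mk_star (x : FreeStarAlg ι) : mk r (star x) = star (mk r x) := by
  change RingQuot.mkAlgHom ℂ (starClosure r) (star x) =
    (RingQuot.starRing (starClosure r) (starClosure_star r)).star
      (RingQuot.mkAlgHom ℂ (starClosure r) x)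
  simp only [RingQuot.mkAlgHom_def, RingQuot.mkRingHom_def]
  rfl

instance : StarModule ℂ (UnivStarAlg r) where
  star_smul c x := by
    obtain ⟨y, rfl⟩ := mk_surjective r x
    rw [← map_smul, ← mk_star, star_smul, map_smul, mk_star]

/-- The generators of the universal `*`-algebra. -/
def gen (i : ι) : UnivStarAlg r := mk r (FreeStarAlg.gen i)

/-- The universal property: a family `v` in a `*`-algebra that satisfies the relations `r`, i.e.
such that the `*`-homomorphism `φ` on the free `*`-algebra defined by `v` respects `r`, extends
uniquely to a `*`-homomorphism on the universal `*`-algebra. -/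
theorem existsUnique_lift {B : Type*} [Ring B] [Algebra ℂ B] [StarRing B] [StarModule ℂ B]
    (v : ι → B) (φ : FreeStarAlg ι →⋆ₐ[ℂ] B) (hφ : ∀ i, φ (FreeStarAlg.gen i) = v i)
    (hr : ∀ a b, r a b → φ a = φ b) :
    ∃! ψ : UnivStarAlg r →⋆ₐ[ℂ] B, ∀ i, ψ (gen r i) = v i := by
  have hr' : ∀ ⦃a b⦄, starClosure r a b → φ.toAlgHom a = φ.toAlgHom b := by
    rintro a b (h | h)
    · exact hr a b h
    · have := hr _ _ h
      rw [map_star, map_star] at this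
      exact star_injective this
  let ψ₀ : UnivStarAlg r →ₐ[ℂ] B := RingQuot.liftAlgHom ℂ ⟨φ.toAlgHom, hr'⟩
  have hψ₀ : ∀ x, ψ₀ (mk r x) = φ x := fun x =>
    RingQuot.liftAlgHom_mkAlgHom_apply ℂ φ.toAlgHom hr' x
  refine ⟨{ ψ₀ with map_star' := fun x => ?_ }, fun i => ?_, ?_⟩
  · obtain ⟨y, rfl⟩ := mk_surjective r x
    change ψ₀ (star (mk r y)) = star (ψ₀ (mk r y))
    rw [← mk_star, hψ₀, hψ₀, map_star]
  · exact (hψ₀ _).trans (hφ i)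
  · intro χ hχ
    let mkS : FreeStarAlg ι →⋆ₐ[ℂ] UnivStarAlg r := { mk r with map_star' := mk_star r }
    have e : χ.comp mkS = φ :=
      (FreeStarAlg.existsUnique_lift v).unique (fun i => hχ i) hφ
    ext x
    obtain ⟨y, rfl⟩ := mk_surjective r x
    exact (congrArg (fun f : FreeStarAlg ι →⋆ₐ[ℂ] B => f y) e).trans (hψ₀ y).symm

end UnivStarAlg

end Universal

/-! ## Free orthogonal quantum groups and their braided analogues -/

section Orthogonal

variable {m : ℕ}

/-- The matrix of generators of the free `*`-algebra on `m²` generators. -/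
def freeMatrix (m : ℕ) : Matrix (Fin m) (Fin m) (FreeStarAlg (Fin m × Fin m)) :=
  Matrix.of fun i j => FreeStarAlg.gen (i, j)

/-- The relations, entry by entry: `U` is unitary, and `U = F V F⁻¹`. -/
inductive OrthRel (F : Matrix (Fin m) (Fin m) ℂ)
    (V : Matrix (Fin m) (Fin m) (FreeStarAlg (Fin m × Fin m))) :
    FreeStarAlg (Fin m × Fin m) → FreeStarAlg (Fin m × Fin m) → Prop
  | mul_star (i j) : OrthRel F V ((freeMatrix m * star (freeMatrix m)) i j)
      ((1 : Matrix (Fin m) (Fin m) (FreeStarAlg (Fin m × Fin m))) i j)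
  | star_mul (i j) : OrthRel F V ((star (freeMatrix m) * freeMatrix m) i j)
      ((1 : Matrix (Fin m) (Fin m) (FreeStarAlg (Fin m × Fin m))) i j)
  | orth (i j) : OrthRel F V (freeMatrix m i j) (conjBy F V i j)

/-- `ℂ[O_F^+]`: the universal unital `*`-algebra with generators `u_ij` and relations
`U` unitary, `U = F Ū F⁻¹`. -/
abbrev FreeOrth (F : Matrix (Fin m) (Fin m) ℂ) : Type :=
  UnivStarAlg (OrthRel F ((freeMatrix m).map star))

/-- `ℂ[O_A^{X,β}]`: the universal unital `*`-algebra with generators `u_ij` and relations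
`U` unitary, `U = A Ū_X A⁻¹`. -/
abbrev BraidedFreeOrth {Γ : Type*} [CommGroup Γ] (A : Matrix (Fin m) (Fin m) ℂ)
    (X : Matrix (Fin m) (Fin m) (MonoidAlgebra ℂ Γ)) (β : Bichar Γ) : Type :=
  UnivStarAlg (OrthRel A (conjMatrix β X (freeMatrix m)))

/-- The matrix `U` of generators of `ℂ[O_F^+]`. -/
def FreeOrth.fund (F : Matrix (Fin m) (Fin m) ℂ) : Matrix (Fin m) (Fin m) (FreeOrth F) :=
  Matrix.of fun i j => UnivStarAlg.gen _ (i, j)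

/-- The matrix `U` of generators of `ℂ[O_A^{X,β}]`. -/
def BraidedFreeOrth.fund {Γ : Type*} [CommGroup Γ] (A : Matrix (Fin m) (Fin m) ℂ)
    (X : Matrix (Fin m) (Fin m) (MonoidAlgebra ℂ Γ)) (β : Bichar Γ) :
    Matrix (Fin m) (Fin m) (BraidedFreeOrth A X β) :=
  Matrix.of fun i j => UnivStarAlg.gen _ (i, j)

/-- The matrix `C = (β(x_ij*, w))`. -/
def charMatrix {Γ : Type*} [CommGroup Γ] (X : Matrix (Fin m) (Fin m) (MonoidAlgebra ℂ Γ)) (w : Γ)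
    (β : Bichar Γ) : Matrix (Fin m) (Fin m) ℂ :=
  Matrix.of fun i j => β.lin (star (X i j)) (MonoidAlgebra.single w 1)

/-- The conditions on `(X, w, β)`: `X` is a unitary corepresentation matrix,
`A (w² X̄) A⁻¹ = X`, and `AC` times its entrywise complex conjugate is `τ 1`. -/
structure IsAdmissible {Γ : Type*} [CommGroup Γ] (A : Matrix (Fin m) (Fin m) ℂ) (τ : ℂ)
    (X : Matrix (Fin m) (Fin m) (MonoidAlgebra ℂ Γ)) (w : Γ) (β : Bichar Γ) : Prop where
  corep : IsCorepMatrix X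
  unitary : X ∈ unitary (Matrix (Fin m) (Fin m) (MonoidAlgebra ℂ Γ))
  conj_eq : conjBy A (MonoidAlgebra.single (w ^ 2) (1 : ℂ) • X.map star) = X
  sign_eq : (A * charMatrix X w β) * (A * charMatrix X w β).map star = τ • 1

end Orthogonal

/-! ## Transmutation -/

section Transmutation

variable {Γ : Type*} [CommGroup Γ]
variable {H : Type*} [Ring H] [Algebra ℂ H] [StarRing H] [StarModule ℂ H]

/-- The `*`-homomorphism `π : H → ℂΓ` is a Hopf `*`-algebra map. -/
def IsHopfMap (ℋ : HopfStar H) (π : H →⋆ₐ[ℂ] MonoidAlgebra ℂ Γ) : Prop :=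
  (∀ x, TensorProduct.map π.toAlgHom.toLinearMap π.toAlgHom.toLinearMap (ℋ.comul x) =
    Coalgebra.comul (R := ℂ) (π x)) ∧
  ∀ x, Coalgebra.counit (R := ℂ) (π x) = ℋ.counit x

/-- The bigrading `H_{a,b}`: the elements `x` with `(π ⊗ ι)Δ(x) = a ⊗ x` and
`(ι ⊗ π)Δ(x) = x ⊗ b`. -/
def bihomogeneous (ℋ : HopfStar H) (π : H →⋆ₐ[ℂ] MonoidAlgebra ℂ Γ) (a b : Γ) : Set H :=
  {x | π.toAlgHom.toLinearMap.rTensor H (ℋ.comul x) = MonoidAlgebra.single a (1 : ℂ) ⊗ₜ[ℂ] x ∧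
    π.toAlgHom.toLinearMap.lTensor H (ℋ.comul x) = x ⊗ₜ[ℂ] MonoidAlgebra.single b (1 : ℂ)}

/-- The restricted adjoint coaction `ad_π(x) = x₍₂₎ ⊗ π(S(x₍₁₎)x₍₃₎)`. -/
def adCoact (ℋ : HopfStar H) (π : H →⋆ₐ[ℂ] MonoidAlgebra ℂ Γ) :
    H →ₗ[ℂ] H ⊗[ℂ] MonoidAlgebra ℂ Γ :=
  (π.toAlgHom.toLinearMap ∘ₗ LinearMap.mul' ℂ H ∘ₗ ℋ.antipode.rTensor H).lTensor H ∘ₗ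
    (TensorProduct.leftComm ℂ H H H).toLinearMap ∘ₗ
    ℋ.comul.toAlgHom.toLinearMap.lTensor H ∘ₗ ℋ.comul.toAlgHom.toLinearMap

/-- The linear isomorphism `Φ` identifies the braided Hopf `*`-algebra `𝒜` with the transmutation
`H_β` of the Hopf `*`-algebra `H` with respect to `π : H → ℂΓ`.  The latter is `H` with its
unit, comultiplication and counit, with the coaction `ad_π`, and with the product, antipode and
involution that are determined, for `x ∈ H_{a,b}` and `y ∈ H_{c,d}`, by
`x ·_β y = β(a⁻¹b, c⁻¹) xy`, `S_β(x) = β(a⁻¹b, b) S(x)` and `x^{*_β} = β(a⁻¹b, a⁻¹) x*`. -/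
structure IsTransmutation {β : Bichar Γ} {A : Type*} [Ring A] [Algebra ℂ A] [StarRing A]
    [StarModule ℂ A] (ℋ : HopfStar H) (π : H →⋆ₐ[ℂ] MonoidAlgebra ℂ Γ)
    (𝒜 : BraidedHopfStar β A) (Φ : A ≃ₗ[ℂ] H) : Prop where
  coact : ∀ x, Φ.toLinearMap.rTensor (MonoidAlgebra ℂ Γ) (𝒜.coact x) = adCoact ℋ π (Φ x)
  comul : ∀ x, TensorProduct.map Φ.toLinearMap Φ.toLinearMap (𝒜.comul x) = ℋ.comul (Φ x)
  counit : ∀ x, 𝒜.counit x = ℋ.counit (Φ x)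
  map_one : Φ 1 = 1
  map_mul : ∀ (a b c d : Γ) (x y : A), Φ x ∈ bihomogeneous ℋ π a b →
    Φ y ∈ bihomogeneous ℋ π c d →
      Φ (x * y) = (β (a⁻¹ * b) c⁻¹ : ℂ) • (Φ x * Φ y)
  map_antipode : ∀ (a b : Γ) (x : A), Φ x ∈ bihomogeneous ℋ π a b →
    Φ (𝒜.antipode x) = (β (a⁻¹ * b) b : ℂ) • ℋ.antipode (Φ x)
  map_star : ∀ (a b : Γ) (x : A), Φ x ∈ bihomogeneous ℋ π a b →
    Φ (star x) = (β (a⁻¹ * b) a⁻¹ : ℂ) • star (Φ x)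

end Transmutation

end BraidedQG

end

open scoped TensorProduct

noncomputable section

namespace BraidedQG

/-! ### Conjugate linear operators with unitary square -/

section NormalForm

open Module
open scoped InnerProductSpace

variable {E : Type*} [NormedAddCommGroup E] [InnerProductSpace ℂ E] [FiniteDimensional ℂ E]

/-! Existence of a quadruple. The map J x = A x̄ is conjugate linear and J² = AĀ is unitary. Hence
ℂᵐ is an orthogonal sum of planes with orthonormal bases e, f that J interchanges up to scalars,
where J² acts as l on e and as l̄ on f, and of lines spanned by vectors fixed by J. The vectors e, f
get labels z = s, s⁻¹ with s²l = τ. A fixed vector gets the label 1 if τ = 1. If τ = -1, fixed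
vectors are combined two at a time into planes, and this is where the parity of m enters. The result
is `exists_unitary_normal_form`: a unitary W such that W*AW̄ vanishes at (k, i) unless z_k z_i = 1,
and AĀ W diag(z²) = τW. In `exists_isAdmissible`, T is the product of the Bohr compactification of ℤ
and the circle, w is the projection to the circle, X = W diag(w χ_{z_i}) W* with χ_z the character
taking the value z at 1 ∈ ℤ, and β satisfies β(w χ_z, w) = z.

The relations. A unitary corepresentation matrix over ℂΓ is given by orthogonal projections, so X =
w ∑ P_a a, and A(w²X̄)A⁻¹ = X means A P̄_a = P_{a⁻¹} A (`IsAdmissible.exists_spectralFamily`). With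
u_{ab} = P_a u P_b, both presentations say that u is unitary and u_{a⁻¹b⁻¹} = θ(a,b) A ū_{ab} A⁻¹.
Here θ(a,b) = β(a⁻¹b, aw) for O_A^{X,β} and θ(a,b) = β(a⁻¹b, w) for O_F^+
(`isTwistedOrth_iff_braided`, `isTwistedOrth_iff_orth`).

The comparison. Let σ((a,b),(c,d)) = β(a⁻¹b, c⁻¹) on Γ × Γ, the scalar that deforms the product in
the transmutation. In the σ-twisted group algebra e_g* = σ(g,g) e_{g⁻¹}, and σ((a,b),(a,b)) is
precisely the ratio of the two functions θ. By universality, u_{ab} ↦ v_{ab} ⊗ e_{(a,b)} defines a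
*-homomorphism from ℂ[O_A^{X,β}] to ℂ[O_F^+] ⊗ ℂ_σ[Γ × Γ], and σ⁻¹ gives one in the other direction
(`IsTwistedOrth.twist`). Forgetting the twisted group algebra turns them into mutually inverse
linear maps Φ and Φ⁻¹. The formulas for product and involution in the transmutation are read off
from those of the twisted group algebra, so the transmuted *-algebra need not be constructed
separately.

The braided Hopf structure. The comultiplication and the antipode are transported along Φ. In
Δ(v_{ab}) = ∑ v_{ae} ⊗ v_{eb} the inner degrees match, so the scalars from the braiding and from the
deformed product combine to one that depends on outer degrees only. Each axiom thus reduces to the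
axiom of the Hopf *-algebra ℂ[O_F^+] and an identity between values of β.

The matrix quantum group. The unitarity of u makes (gX, u) a unitary comodule for every g ∈ Γ. Since
Ū_X = A⁻¹uA and X̄ = A⁻¹(w⁻²X)A, the conjugate comodule is similar to (w⁻²X, u), hence unitarizable.
-/

theorem exists_eigenvector_mem (f : E →ₗ[ℂ] E) (W : Submodule ℂ E) (hf : ∀ x ∈ W, f x ∈ W)
    (hW : W ≠ ⊥) : ∃ c : ℂ, ∃ x ∈ W, x ≠ 0 ∧ f x = c • x := by
  have : Nontrivial W := Submodule.nontrivial_iff_ne_bot.2 hW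
  obtain ⟨c, hc⟩ := Module.End.exists_eigenvalue (f.restrict hf)
  obtain ⟨x, hx, hx0⟩ := hc.exists_hasEigenvector
  refine ⟨c, x, x.2, fun h => hx0 (Subtype.ext h), ?_⟩
  have := Module.End.mem_eigenspace_iff.1 hx
  simpa using congrArg Subtype.val this

/-- A conjugate linear operator with a conjugate linear adjoint, such that `J²` is unitary. -/
structure IsAdjointPair (J J' : E →ₗ⋆[ℂ] E) : Prop where
  adj : ∀ x y, ⟪J x, y⟫_ℂ = ⟪J' y, x⟫_ℂ
  left : ∀ x, J (J (J' (J' x))) = x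
  right : ∀ x, J' (J' (J (J x))) = x

/-- An orthonormal family of `n` vectors in `W` on which `J` has monomial block form. -/
def HasFamily (J : E →ₗ⋆[ℂ] E) (τ : ℂ) (W : Submodule ℂ E) (n : ℕ) : Prop :=
  ∃ (ι : Type) (_ : Fintype ι) (v : ι → E) (z : ι → Circle), Orthonormal ℂ v ∧ (∀ i, v i ∈ W) ∧
    Fintype.card ι = n ∧ (∀ k i, z k * z i ≠ 1 → ⟪v k, J (v i)⟫_ℂ = 0) ∧
    ∀ i, ((z i : ℂ) ^ 2) • J (J (v i)) = τ • v i

variable {J J' : E →ₗ⋆[ℂ] E} {τ : ℂ}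

theorem HasFamily.zero (W : Submodule ℂ E) : HasFamily J τ W 0 :=
  ⟨Empty, inferInstance, fun i => i.elim, fun i => i.elim, ⟨fun i => i.elim, fun i => i.elim⟩,
    fun i => i.elim, rfl, fun i => i.elim, fun i => i.elim⟩

/-- Adjoining an orthonormal pair of vectors interchanged by `J` up to scalars. -/
theorem HasFamily.add_pair (hJ : IsAdjointPair J J') {W' W : Submodule ℂ E} {n : ℕ} {e f : E}
    (hW : W' ≤ W) (he : e ∈ W) (hf : f ∈ W) (he1 : ‖e‖ = 1) (hf1 : ‖f‖ = 1) (hef : ⟪e, f⟫_ℂ = 0)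
    (hWe : ∀ v ∈ W', ⟪e, v⟫_ℂ = 0) (hWf : ∀ v ∈ W', ⟪f, v⟫_ℂ = 0)
    (hJe : ∃ c : ℂ, J e = c • f) (hJf : ∃ c : ℂ, J f = c • e) (hJ'e : ∃ c : ℂ, J' e = c • f)
    (hJ'f : ∃ c : ℂ, J' f = c • e) {l : ℂ} (hl : ‖l‖ = 1) (hτ : τ = 1 ∨ τ = -1)
    (hle : J (J e) = l • e) (hlf : J (J f) = star l • f) (h : HasFamily J τ W' n) :
    HasFamily J τ W (n + 2) := by
  obtain ⟨ι, _, v, z, hv, hvW, hc, hz, hv2⟩ := h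
  obtain ⟨c1, hc1⟩ := hJe
  obtain ⟨c2, hc2⟩ := hJf
  obtain ⟨c3, hc3⟩ := hJ'e
  obtain ⟨c4, hc4⟩ := hJ'f
  -- The labels of e and f will be s and s⁻¹, so that their product is 1, as the interchange of e
  -- and f by J demands.
  obtain ⟨s, hs⟩ : ∃ s : Circle, (s : ℂ) ^ 2 * l = τ := by
    have hτ1 : ‖τ * star l‖ = 1 := by rcases hτ with rfl | rfl <;> simp [hl]
    let c : Circle := ⟨τ * star l, mem_sphere_zero_iff_norm.2 hτ1⟩
    refine ⟨Circle.exp (Complex.arg c / 2), ?_⟩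
    have h1 : (Circle.exp (Complex.arg c / 2)) ^ 2 = c := by
      rw [sq, ← Circle.exp_add, add_halves, Circle.exp_arg]
    have h2 := congrArg (fun x : Circle => (x : ℂ)) h1
    simp only [Circle.coe_pow] at h2
    rw [h2]
    change τ * star l * l = τ
    rw [mul_assoc, Complex.star_def, Complex.conj_mul', hl]
    simp
  -- This is the conjugate of the equation for s; τ is real.
  have hs' : (((s⁻¹ : Circle) : ℂ)) ^ 2 * star l = τ := by
    have := congrArg star hs
    rw [star_mul', star_pow, Complex.star_def, ← Circle.coe_inv_eq_conj] at this
    refine this.trans ?_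
    rcases hτ with rfl | rfl <;> simp
  have hfe : ⟪f, e⟫_ℂ = 0 := inner_eq_zero_symm.1 hef
  have hve : ∀ i, ⟪e, v i⟫_ℂ = 0 := fun i => hWe _ (hvW i)
  have hvf : ∀ i, ⟪f, v i⟫_ℂ = 0 := fun i => hWf _ (hvW i)
  have hve' : ∀ i, ⟪v i, e⟫_ℂ = 0 := fun i => inner_eq_zero_symm.1 (hve i)
  have hvf' : ∀ i, ⟪v i, f⟫_ℂ = 0 := fun i => inner_eq_zero_symm.1 (hvf i)
  -- J' preserves the span of e and f, so J preserves its orthogonal complement.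
  have hJv : ∀ i, ⟪e, J (v i)⟫_ℂ = 0 := fun i => by
    rw [inner_eq_zero_symm, hJ.adj, hc3, inner_smul_left, hvf, mul_zero]
  have hJv' : ∀ i, ⟪f, J (v i)⟫_ℂ = 0 := fun i => by
    rw [inner_eq_zero_symm, hJ.adj, hc4, inner_smul_left, hve, mul_zero]
  refine ⟨ι ⊕ Bool, inferInstance, Sum.elim v (fun b => if b then e else f),
    Sum.elim z (fun b => if b then s else s⁻¹), ?_, ?_, ?_, ?_, ?_⟩
  · classical
    rw [orthonormal_iff_ite] at hv ⊢
    rintro (i | (_ | _)) (j | (_ | _)) <;>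
      simp [hv, hve, hvf, hve', hvf', hef, hfe, inner_self_eq_norm_sq_to_K, he1, hf1]
  · rintro (i | (_ | _)) <;> simp [he, hf, hW (hvW _)]
  · simp [hc]
  · rintro (i | (_ | _)) (j | (_ | _)) <;>
      simp [hc1, hc2, inner_smul_right, hve', hvf', hJv, hJv', hef, hfe, -ne_eq]
    exact hz i j
  · rintro (i | (_ | _))
    · exact hv2 i
    · simp only [Sum.elim_inr, Bool.false_eq_true, if_false]
      rw [hlf, smul_smul, hs']
    · simp only [Sum.elim_inr, if_true]
      rw [hle, smul_smul, hs]

theorem HasFamily.add_fixed (hJ : IsAdjointPair J J') {W' W : Submodule ℂ E} {n : ℕ} {g : E}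
    (hW : W' ≤ W) (hg : g ∈ W) (hg1 : ‖g‖ = 1) (hWg : ∀ v ∈ W', ⟪g, v⟫_ℂ = 0)
    (hJg : J g = g) (hJ'g : J' g = g) (h : HasFamily J 1 W' n) : HasFamily J 1 W (n + 1) := by
  obtain ⟨ι, _, v, z, hv, hvW, hc, hz, hv2⟩ := h
  have hvg : ∀ i, ⟪g, v i⟫_ℂ = 0 := fun i => hWg _ (hvW i)
  have hvg' : ∀ i, ⟪v i, g⟫_ℂ = 0 := fun i => inner_eq_zero_symm.1 (hvg i)
  have hJv : ∀ i, ⟪g, J (v i)⟫_ℂ = 0 := fun i => by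
    rw [inner_eq_zero_symm, hJ.adj, hJ'g, hvg]
  -- The label of a fixed vector is 1: it pairs with itself, and J²g = g requires z² = 1.
  refine ⟨ι ⊕ Unit, inferInstance, Sum.elim v (fun _ => g), Sum.elim z (fun _ => 1), ?_, ?_, ?_, ?_,
    ?_⟩
  · classical
    rw [orthonormal_iff_ite] at hv ⊢
    rintro (i | _) (j | _) <;> simp [hv, hvg, hvg', inner_self_eq_norm_sq_to_K, hg1]
  · rintro (i | _) <;> simp [hg, hW (hvW _)]
  · simp [hc]
  · rintro (i | _) (j | _) <;> simp [hJg, hvg', hJv, -ne_eq]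
    exact hz i j
  · rintro (i | _)
    · exact hv2 i
    · simp [hJg]

/-- A common eigenvector either gives an orthogonal pair, or a vector fixed by `J` and `J'`. -/
theorem IsAdjointPair.exists_pair_or_fixed (hJ : IsAdjointPair J J') {W : Submodule ℂ E}
    (hJW : ∀ x ∈ W, J x ∈ W) (hJ'W : ∀ x ∈ W, J' x ∈ W) (hW : W ≠ ⊥) :
    (∃ e ∈ W, ∃ f ∈ W, ‖e‖ = 1 ∧ ‖f‖ = 1 ∧ ⟪e, f⟫_ℂ = 0 ∧ (∃ c : ℂ, J e = c • f) ∧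
      (∃ c : ℂ, J f = c • e) ∧ (∃ c : ℂ, J' e = c • f) ∧ (∃ c : ℂ, J' f = c • e) ∧
      ∃ l : ℂ, ‖l‖ = 1 ∧ J (J e) = l • e ∧ J (J f) = star l • f) ∨
    ∃ g ∈ W, ‖g‖ = 1 ∧ J g = g ∧ J' g = g := by
  have hJ0 : ∀ x, J x = 0 → x = 0 := fun x hx => by rw [← hJ.right x, hx]; simp
  have hJ'0 : ∀ x, J' x = 0 → x = 0 := fun x hx => by rw [← hJ.left x, hx]; simp
  have hJ'i : ∀ x y, J' x = J' y → x = y := fun x y h =>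
    sub_eq_zero.1 (hJ'0 _ (by rw [map_sub, h, sub_self]))
  have h1 : ∀ x, J' (J (J (J' x))) = x := fun x => hJ'i _ _ (hJ.right _)
  -- The linear maps J² and J'J commute; J' is injective, and after applying it both sides become J
  -- x.
  have hcomm : ∀ x, J (J (J' (J x))) = J' (J (J (J x))) := fun x => by
    apply hJ'i
    rw [h1, hJ.right]
  obtain ⟨p, e0, he0W, he0, hp0⟩ := exists_eigenvector_mem (J'.comp J : E →ₗ[ℂ] E) W
    (fun x hx => hJ'W _ (hJW _ hx)) hW
  -- By commutation J² preserves the p-eigenspace of J'J in W, so it has an eigenvector there.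
  obtain ⟨l, e, heW1, he, hle⟩ := exists_eigenvector_mem (J.comp J : E →ₗ[ℂ] E)
    (W ⊓ LinearMap.ker ((J'.comp J : E →ₗ[ℂ] E) - p • LinearMap.id))
    (fun x hx => by
      refine ⟨hJW _ (hJW _ hx.1), ?_⟩
      have hx2 : J' (J x) = p • x := by simpa [sub_eq_zero] using hx.2
      have : J' (J (J (J x))) = p • J (J x) := by
        rw [← hcomm, hx2]; simp
      simpa [sub_eq_zero] using this)
    (fun hbot => he0 (by
      have : e0 ∈ W ⊓ LinearMap.ker ((J'.comp J : E →ₗ[ℂ] E) - p • LinearMap.id) :=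
        ⟨he0W, by simpa [sub_eq_zero] using hp0⟩
      rw [hbot] at this
      simpa using this))
  have heW : e ∈ W := heW1.1
  have hpe : J' (J e) = p • e := by simpa [sub_eq_zero] using heW1.2
  replace hle : J (J e) = l • e := hle
  clear hp0 he0 he0W heW1 e0
  -- normalization
  obtain ⟨e, heW, he1, hpe, hle⟩ : ∃ e ∈ W, ‖e‖ = 1 ∧ J' (J e) = p • e ∧ J (J e) = l • e := by
    refine ⟨((‖e‖⁻¹ : ℝ) : ℂ) • e, W.smul_mem _ heW, ?_, ?_, ?_⟩
    · rw [norm_smul]; simp [he]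
    · simp [map_smulₛₗ, hpe, smul_comm p]
    · simp [map_smulₛₗ, hle, smul_comm l]
  have he : e ≠ 0 := fun h => by simp [h] at he1
  have hee : ⟪e, e⟫_ℂ = 1 := by rw [inner_self_eq_norm_sq_to_K, he1]; simp
  -- The eigenvalue of J'J is ⟨Je, Je⟩ up to conjugation, hence real and positive.
  have hnorm : ((‖J e‖ ^ 2 : ℝ) : ℂ) = star p := by
    have := hJ.adj e (J e)
    rw [hpe, inner_smul_left, hee, inner_self_eq_norm_sq_to_K] at this
    simpa using this
  have hp : p = ((‖J e‖ ^ 2 : ℝ) : ℂ) := by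
    rw [← star_star p, ← hnorm]; simp
  have hpr : star p = p := by rw [hp]; simp
  have hJe0 : J e ≠ 0 := fun h => he (hJ0 _ h)
  have hr0 : (‖J e‖ : ℂ) ≠ 0 := by simpa using hJe0
  have hp0 : p ≠ 0 := by rw [hp]; simpa using hJe0
  have hJi : ∀ x y, J x = J y → x = y := fun x y h =>
    sub_eq_zero.1 (hJ0 _ (by rw [map_sub, h, sub_self]))
  -- J² is an isometry: move both copies of J across the inner product and use `right`.
  have hll : l * star l = 1 := by
    have h2 : ⟪J (J e), J (J e)⟫_ℂ = 1 := by
      rw [hJ.adj, ← inner_conj_symm, hJ.adj, hJ.right, hee]; simp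
    rw [hle, inner_smul_left, inner_smul_right, hee, mul_one] at h2
    rw [mul_comm]; exact h2
  have hl1 : ‖l‖ = 1 := by
    have : ((‖l‖ ^ 2 : ℝ) : ℂ) = 1 := by
      rw [← hll, Complex.star_def, Complex.mul_conj']; simp
    have : ‖l‖ ^ 2 = 1 := by exact_mod_cast this
    exact (pow_eq_one_iff_of_nonneg (norm_nonneg l) two_ne_zero).1 this
  -- J J' J' J = 1 gives J J'e = p⁻¹e; the right hand side has the same image under the injective
  -- map J because |l| = 1.
  have hJ'e : J' e = (p⁻¹ * l) • J e := by
    apply hJi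
    have h2 : J (J' (J' (J e))) = e := hJi _ _ (hJ.left _)
    rw [hpe, map_smulₛₗ, map_smulₛₗ] at h2
    simp only [starRingEnd_self_apply] at h2
    rw [map_smulₛₗ, hle, smul_smul, map_mul, map_inv₀]
    have h3 : J (J' e) = p⁻¹ • e := by rw [← h2, smul_smul, inv_mul_cancel₀ hp0, one_smul, h2]
    rw [h3, ← Complex.star_def, hpr, mul_assoc, mul_comm (star l), hll, mul_one]
  by_cases hortho : ⟪e, J e⟫_ℂ = 0
  · left
    refine ⟨e, heW, ((‖J e‖⁻¹ : ℝ) : ℂ) • J e, W.smul_mem _ (hJW _ heW), he1, ?_, ?_,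
      ⟨‖J e‖, ?_⟩, ⟨(‖J e‖ : ℂ)⁻¹ * l, ?_⟩, ⟨‖J e‖ * (p⁻¹ * l), ?_⟩, ⟨(‖J e‖ : ℂ)⁻¹ * p, ?_⟩,
      l, hl1, hle, ?_⟩
    · rw [norm_smul]; simp [hJe0]
    · rw [inner_smul_right, hortho, mul_zero]
    · rw [smul_smul]; simp [hr0]
    · rw [map_smulₛₗ, hle, smul_smul]; simp
    · rw [hJ'e, smul_smul]; simp; field_simp
    · rw [map_smulₛₗ, hpe, smul_smul]; simp
    · rw [map_smulₛₗ, map_smulₛₗ, hle, map_smulₛₗ, smul_smul, smul_smul, mul_comm]; simp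
  · right
    -- Je is an eigenvector of J'J with eigenvalue p⁻¹. Evaluating ⟨Je, J²e⟩ in two ways gives l⟨Je,
    -- e⟩ = p⁻¹⟨Je, e⟩, and ⟨Je, e⟩ ≠ 0.
    have hlp : l = p⁻¹ := by
      have h2 : J' (J (J e)) = p⁻¹ • J e := by
        rw [hle, map_smulₛₗ, hJ'e, smul_smul, ← Complex.star_def, mul_comm, mul_assoc, hll, mul_one]
      have h3 := hJ.adj e (J (J e))
      rw [h2, hle, inner_smul_right, inner_smul_left, map_inv₀, ← Complex.star_def, hpr] at h3
      exact mul_right_cancel₀ (fun h => hortho (inner_eq_zero_symm.1 h)) h3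
    -- p is positive and |p⁻¹| = |l| = 1.
    have hp1 : p = 1 := by
      have h2 : ‖J e‖ ^ 2 = 1 := by
        have h3 : ‖p⁻¹‖ = 1 := hlp ▸ hl1
        rw [hp, norm_inv, Complex.norm_real, inv_eq_one, Real.norm_of_nonneg (by positivity)] at h3
        exact h3
      rw [hp, h2]; simp
    have hl : l = 1 := by rw [hlp, hp1, inv_one]
    rw [hl, one_smul] at hle
    rw [hl, hp1, inv_one, mul_one, one_smul] at hJ'e
    rw [hp1, one_smul] at hpe
    -- J now agrees with J' on e and J²e = e, so e + Je is fixed; if this vanishes, Je = -e and ie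
    -- is fixed by conjugate linearity.
    obtain ⟨g, hgW, hg0, hg, hg'⟩ : ∃ g ∈ W, g ≠ 0 ∧ J g = g ∧ J' g = g := by
      by_cases h : e + J e = 0
      · have h2 : J e = -e := (neg_eq_of_add_eq_zero_right h).symm
        refine ⟨Complex.I • e, W.smul_mem _ heW, ?_, ?_, ?_⟩
        · simp [he]
        · rw [map_smulₛₗ, h2]; simp
        · rw [map_smulₛₗ, hJ'e, h2]; simp
      · refine ⟨e + J e, W.add_mem heW (hJW _ heW), h, ?_, ?_⟩
        · rw [map_add, hle, add_comm]
        · rw [map_add, hJ'e, hpe, add_comm]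
    refine ⟨((‖g‖⁻¹ : ℝ) : ℂ) • g, W.smul_mem _ hgW, ?_, ?_, ?_⟩
    · rw [norm_smul]; simp [hg0]
    · rw [map_smulₛₗ, hg]; simp
    · rw [map_smulₛₗ, hg']; simp

/-- Like `HasFamily`, but with an additional vector fixed by `J` and `J'`. -/
def HasFamilyAndFixed (J J' : E →ₗ⋆[ℂ] E) (τ : ℂ) (W : Submodule ℂ E) (n : ℕ) : Prop :=
  ∃ g ∈ W, ‖g‖ = 1 ∧ J g = g ∧ J' g = g ∧ HasFamily J τ (W ⊓ (ℂ ∙ g)ᗮ) n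

/-- This lets the induction pass to the complement of a subspace that has been split off. -/
theorem IsAdjointPair.orthogonal_mem (hJ : IsAdjointPair J J') {K : Submodule ℂ E}
    (hK : ∀ x ∈ K, J' x ∈ K) : ∀ x ∈ Kᗮ, J x ∈ Kᗮ := fun x hx y hy => by
  rw [inner_eq_zero_symm, hJ.adj]
  exact hx _ (hK _ hy)

theorem IsAdjointPair.symm (hJ : IsAdjointPair J J') : IsAdjointPair J' J :=
  ⟨fun x y => (hJ.adj y x).symm, hJ.right, hJ.left⟩

theorem mem_span_pair_of_map {e f : E} (he : ∃ c : ℂ, J e = c • f) (hf : ∃ c : ℂ, J f = c • e) :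
    ∀ x ∈ Submodule.span ℂ {e, f}, J x ∈ Submodule.span ℂ {e, f} := fun x hx => by
  obtain ⟨a, b, rfl⟩ := Submodule.mem_span_pair.1 hx
  obtain ⟨c, hc⟩ := he
  obtain ⟨d, hd⟩ := hf
  rw [map_add, map_smulₛₗ, map_smulₛₗ, hc, hd, smul_smul, smul_smul]
  exact Submodule.mem_span_pair.2 ⟨_, _, add_comm _ _⟩

/-- Induction on the dimension, splitting off a plane or a fixed line. For τ = -1 a single fixed
vector admits no label, since z² = -1 contradicts z · z = 1. The second claim therefore carries one
unmatched fixed vector through the odd dimensions, until another one is met. -/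
theorem IsAdjointPair.hasFamily (hJ : IsAdjointPair J J') (hτ : τ = 1 ∨ τ = -1) (n : ℕ) :
    ∀ W : Submodule ℂ E, (∀ x ∈ W, J x ∈ W) → (∀ x ∈ W, J' x ∈ W) → finrank ℂ W = n →
      (τ = 1 ∨ Even n → HasFamily J τ W n) ∧
      (τ = -1 → ∀ k, n = 2 * k + 1 → HasFamilyAndFixed J J' τ W (2 * k)) := by
  induction n using Nat.strong_induction_on with
  | _ n ih =>
  intro W hJW hJ'W hn
  rcases Nat.eq_zero_or_pos n with rfl | hpos
  · exact ⟨fun _ => HasFamily.zero W, fun _ k hk => by omega⟩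
  have hW : W ≠ ⊥ := by
    rintro rfl
    simp at hn
    omega
  rcases hJ.exists_pair_or_fixed hJW hJ'W hW with
    ⟨e, he, f, hf, he1, hf1, hef, hJe, hJf, hJ'e, hJ'f, l, hl, hle, hlf⟩ | ⟨g, hg, hg1, hJg, hJ'g⟩
  · set K := Submodule.span ℂ {e, f} with hK
    have hKW : K ≤ W := Submodule.span_le.2 (by rintro x (rfl | rfl) <;> assumption)
    have hKJ := mem_span_pair_of_map hJe hJf
    have hKJ' := mem_span_pair_of_map hJ'e hJ'f
    have hKd : finrank ℂ K = 2 := by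
      have hv : Orthonormal ℂ ![e, f] := by
        rw [orthonormal_iff_ite]
        intro i j
        fin_cases i <;> fin_cases j <;>
          simp [hef, inner_eq_zero_symm.1 hef, inner_self_eq_norm_sq_to_K, he1, hf1]
      have := finrank_span_eq_card hv.linearIndependent
      rwa [Matrix.range_cons, Matrix.range_cons, Matrix.range_empty, Set.union_empty,
        ← Set.insert_eq] at this
    have hd := Submodule.finrank_add_inf_finrank_orthogonal hKW
    rw [hKd, hn, inf_comm] at hd
    have hW'e : ∀ V : Submodule ℂ E, ∀ v ∈ V ⊓ Kᗮ, ⟪e, v⟫_ℂ = 0 := fun V v hv =>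
      hv.2 _ (Submodule.subset_span (by simp))
    have hW'f : ∀ V : Submodule ℂ E, ∀ v ∈ V ⊓ Kᗮ, ⟪f, v⟫_ℂ = 0 := fun V v hv =>
      hv.2 _ (Submodule.subset_span (by simp))
    obtain ⟨h1, h2⟩ := ih (n - 2) (by omega) (W ⊓ Kᗮ)
      (fun x hx => ⟨hJW _ hx.1, hJ.orthogonal_mem hKJ' _ hx.2⟩)
      (fun x hx => ⟨hJ'W _ hx.1, hJ.symm.orthogonal_mem hKJ _ hx.2⟩) (by omega)
    have h2n : n - 2 + 2 = n := by omega
    refine ⟨fun h => ?_, fun h k hk => ?_⟩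
    · have := HasFamily.add_pair hJ inf_le_left he hf he1 hf1 hef (hW'e W) (hW'f W) hJe hJf hJ'e
        hJ'f hl hτ hle hlf (h1 (h.imp id fun h => by
          obtain ⟨k, hk⟩ := h
          exact ⟨k - 1, by omega⟩))
      rwa [h2n] at this
    · obtain ⟨g, hg, hg1, hJg, hJ'g, hF⟩ := h2 h (k - 1) (by omega)
      refine ⟨g, hg.1, hg1, hJg, hJ'g, ?_⟩
      have hg' : ∀ x, ⟪x, g⟫_ℂ = 0 → x ∈ (ℂ ∙ g)ᗮ := fun x hx =>
        Submodule.mem_orthogonal_singleton_iff_inner_left.2 hx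
      have := HasFamily.add_pair (W := W ⊓ (ℂ ∙ g)ᗮ) hJ (inf_le_inf_right _ inf_le_left)
        ⟨he, hg' _ (hW'e W _ hg)⟩ ⟨hf, hg' _ (hW'f W _ hg)⟩ he1 hf1 hef
        (fun v hv => hW'e W v hv.1) (fun v hv => hW'f W v hv.1) hJe hJf hJ'e
        hJ'f hl hτ hle hlf hF
      have h3 : 2 * (k - 1) + 2 = 2 * k := by omega
      rwa [h3] at this
  · have hKW : (ℂ ∙ g) ≤ W := (Submodule.span_singleton_le_iff_mem _ _).2 hg
    have hg0 : g ≠ 0 := fun h => by simp [h] at hg1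
    have hd := Submodule.finrank_add_inf_finrank_orthogonal hKW
    rw [finrank_span_singleton hg0, hn, inf_comm] at hd
    have hmem : ∀ L : E →ₗ⋆[ℂ] E, L g = g → ∀ x ∈ ℂ ∙ g, L x ∈ ℂ ∙ g := fun L hL x hx => by
      obtain ⟨c, rfl⟩ := Submodule.mem_span_singleton.1 hx
      rw [map_smulₛₗ, hL]
      exact Submodule.smul_mem _ _ (Submodule.mem_span_singleton_self g)
    have hW'g : ∀ V : Submodule ℂ E, ∀ v ∈ V ⊓ (ℂ ∙ g)ᗮ, ⟪g, v⟫_ℂ = 0 := fun V v hv =>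
      hv.2 _ (Submodule.mem_span_singleton_self g)
    obtain ⟨h1, h2⟩ := ih (n - 1) (by omega) (W ⊓ (ℂ ∙ g)ᗮ)
      (fun x hx => ⟨hJW _ hx.1, hJ.orthogonal_mem (hmem J' hJ'g) _ hx.2⟩)
      (fun x hx => ⟨hJ'W _ hx.1, hJ.symm.orthogonal_mem (hmem J hJg) _ hx.2⟩) (by omega)
    refine ⟨fun h => ?_, fun h k hk => ⟨g, hg, hg1, hJg, hJ'g, ?_⟩⟩
    · rcases hτ with rfl | hτ1
      · have := HasFamily.add_fixed hJ inf_le_left hg hg1 (hW'g W) hJg hJ'g (h1 (Or.inl rfl))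
        rwa [Nat.sub_add_cancel hpos] at this
      · have hne : Even n := h.resolve_left (by rw [hτ1]; norm_num)
        obtain ⟨k, hk⟩ := hne
        -- The complement of g has the odd dimension 2(k - 1) + 1 and supplies a second fixed vector
        -- g'. The vectors (g ± ig')/√2 are orthonormal, and J and J' interchange them, so they form
        -- a pair with l = 1.
        obtain ⟨g', hg', hg'1, hJg', hJ'g', hF⟩ := h2 hτ1 (k - 1) (by omega)
        have hgg' : ⟪g, g'⟫_ℂ = 0 := hW'g W _ hg'
        have hg'g : ⟪g', g⟫_ℂ = 0 := inner_eq_zero_symm.1 hgg'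
        have hgs : ⟪g, g⟫_ℂ = 1 := by rw [inner_self_eq_norm_sq_to_K, hg1]; simp
        have hg's : ⟪g', g'⟫_ℂ = 1 := by rw [inner_self_eq_norm_sq_to_K, hg'1]; simp
        let r : ℂ := ((Real.sqrt 2)⁻¹ : ℝ)
        have hr : r * r = 1 / 2 := by
          rw [← Complex.ofReal_mul, ← mul_inv, Real.mul_self_sqrt (by norm_num)]; simp
        have hrs : starRingEnd ℂ r = r := Complex.conj_ofReal _
        let e : E := r • (g + Complex.I • g')
        let f : E := r • (g - Complex.I • g')
        have hJe : ∀ L : E →ₗ⋆[ℂ] E, L g = g → L g' = g' → L e = f := fun L h1 h2 => by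
          simp [e, f, map_smulₛₗ, h1, h2, hrs, sub_eq_add_neg]
        have hJf : ∀ L : E →ₗ⋆[ℂ] E, L g = g → L g' = g' → L f = e := fun L h1 h2 => by
          simp [e, f, map_smulₛₗ, h1, h2, hrs, sub_eq_add_neg]
        have hn1 : ∀ x : E, ⟪x, x⟫_ℂ = 1 → ‖x‖ = 1 := fun x hx => by
          have h2 : ‖x‖ ^ 2 = 1 := by rw [@norm_sq_eq_re_inner ℂ, hx]; simp
          exact (pow_eq_one_iff_of_nonneg (norm_nonneg x) two_ne_zero).1 h2
        have hW'g' : ∀ v ∈ W ⊓ (ℂ ∙ g)ᗮ ⊓ (ℂ ∙ g')ᗮ, ⟪g', v⟫_ℂ = 0 := fun v hv =>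
          hv.2 _ (Submodule.mem_span_singleton_self g')
        have := HasFamily.add_pair (e := e) (f := f) (W := W) (l := 1) hJ
          (inf_le_left.trans inf_le_left)
          (W.smul_mem _ (W.add_mem hg (W.smul_mem _ hg'.1)))
          (W.smul_mem _ (W.sub_mem hg (W.smul_mem _ hg'.1)))
          (hn1 _ (by simp only [e, inner_add_left, inner_add_right, inner_smul_left, inner_smul_right,
            hgg', hg'g, hgs, hg's, hrs, Complex.conj_I]; linear_combination 2 * hr - r * r * Complex.I_sq))
          (hn1 _ (by simp only [f, inner_sub_left, inner_sub_right, inner_smul_left, inner_smul_right,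
            hgg', hg'g, hgs, hg's, hrs, Complex.conj_I]; linear_combination 2 * hr - r * r * Complex.I_sq))
          (by simp only [e, f, inner_add_left, inner_sub_right, inner_smul_left, inner_smul_right,
            hgg', hg'g, hgs, hg's, hrs, Complex.conj_I]; linear_combination r * r * Complex.I_sq)
          (fun v hv => by simp only [e, inner_add_left, inner_smul_left, hW'g' v hv, hW'g W v hv.1]; ring)
          (fun v hv => by simp only [f, inner_sub_left, inner_smul_left, hW'g' v hv, hW'g W v hv.1]; ring)
          ⟨1, by simp [hJe J hJg hJg']⟩ ⟨1, by simp [hJf J hJg hJg']⟩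
          ⟨1, by simp [hJe J' hJ'g hJ'g']⟩ ⟨1, by simp [hJf J' hJ'g hJ'g']⟩ (by simp)
          (Or.inr hτ1) (by simp [hJe J hJg hJg', hJf J hJg hJg'])
          (by simp [hJe J hJg hJg', hJf J hJg hJg']) hF
        have h3 : 2 * (k - 1) + 2 = n := by omega
        rwa [h3] at this
    · have := h1 (Or.inr ⟨k, by omega⟩)
      have h3 : n - 1 = 2 * k := by omega
      rwa [h3] at this

/-- The conjugate linear operator `x ↦ A x̄`. -/
def conjLin {m : ℕ} (A : Matrix (Fin m) (Fin m) ℂ) :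
    EuclideanSpace ℂ (Fin m) →ₗ⋆[ℂ] EuclideanSpace ℂ (Fin m) where
  toFun x := WithLp.toLp 2 (A.mulVec (star x.ofLp))
  map_add' x y := by simp [Matrix.mulVec_add]
  map_smul' c x := by simp [Matrix.mulVec_smul]

theorem map_star_mulVec {m : ℕ} (A : Matrix (Fin m) (Fin m) ℂ) (x : Fin m → ℂ) :
    star (A.mulVec x) = (A.map star).mulVec (star x) := by
  ext i
  simp [Matrix.mulVec, dotProduct]

theorem conjLin_conjLin {m : ℕ} (A : Matrix (Fin m) (Fin m) ℂ) (x : EuclideanSpace ℂ (Fin m)) :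
    conjLin A (conjLin A x) = WithLp.toLp 2 ((A * A.map star).mulVec x.ofLp) := by
  simp [conjLin, map_star_mulVec]

theorem isAdjointPair_conjLin {m : ℕ} {A : Matrix (Fin m) (Fin m) ℂ}
    (hAA : A * A.map star ∈ unitary (Matrix (Fin m) (Fin m) ℂ)) :
    IsAdjointPair (conjLin A) (conjLin A.transpose) := by
  have hs : A.transpose * A.transpose.map star = star (A * A.map star) := by
    rw [star_mul, Matrix.star_eq_conjTranspose, Matrix.star_eq_conjTranspose]
    congr 1
    ext i j
    simp
  refine ⟨fun x y => ?_, fun x => ?_, fun x => ?_⟩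
  · simp only [conjLin, LinearMap.coe_mk, AddHom.coe_mk, PiLp.inner_apply, Matrix.mulVec,
      dotProduct, RCLike.inner_apply, map_sum, Finset.mul_sum, Matrix.transpose_apply]
    rw [Finset.sum_comm]
    refine Finset.sum_congr rfl fun i _ => Finset.sum_congr rfl fun j _ => ?_
    simp
    ring
  · rw [conjLin_conjLin, conjLin_conjLin, hs]
    simp only [Matrix.mulVec_mulVec, Unitary.mul_star_self_of_mem hAA, Matrix.one_mulVec]
  · rw [conjLin_conjLin, conjLin_conjLin, hs]
    simp only [Matrix.mulVec_mulVec, Unitary.star_mul_self_of_mem hAA, Matrix.one_mulVec]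

/-- Normal form of `A` under unitary congruence, when `A Ā` is unitary. -/
theorem exists_unitary_normal_form {m : ℕ} {A : Matrix (Fin m) (Fin m) ℂ}
    (hAA : A * A.map star ∈ unitary (Matrix (Fin m) (Fin m) ℂ))
    (hτ : τ = 1 ∨ τ = -1) (hodd : Odd m → τ = 1) :
    ∃ (W : Matrix (Fin m) (Fin m) ℂ) (z : Fin m → Circle),
      W ∈ unitary (Matrix (Fin m) (Fin m) ℂ) ∧
      (∀ k i, z k * z i ≠ 1 → (star W * A * W.map star) k i = 0) ∧
      A * A.map star * W * Matrix.diagonal (fun i => (z i : ℂ) ^ 2) = τ • W := by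
  -- The family found in all of ℂᵐ has m members; they become the columns of W.
  obtain ⟨ι, _, v, z, hv, -, hc, hz, hv2⟩ :=
    ((isAdjointPair_conjLin hAA).hasFamily hτ m ⊤ (fun _ _ => trivial) (fun _ _ => trivial)
      (by simp)).1 (by
        rcases Nat.even_or_odd m with h | h
        · exact Or.inr h
        · exact Or.inl (hodd h))
  let eq : Fin m ≃ ι := (Fintype.equivFinOfCardEq hc).symm
  have hin : ∀ x y : EuclideanSpace ℂ (Fin m), ⟪x, y⟫_ℂ = ∑ i, star (x i) * y i := fun x y => by
    simp [PiLp.inner_apply, mul_comm]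
  have hu : star (Matrix.of fun i j => v (eq j) i) * (Matrix.of fun i j => v (eq j) i) = 1 := by
    classical
    ext i j
    rw [orthonormal_iff_ite] at hv
    have := hv (eq i) (eq j)
    rw [hin] at this
    simpa [Matrix.mul_apply, Matrix.one_apply] using this
  refine ⟨Matrix.of fun i j => v (eq j) i, fun i => z (eq i),
    Unitary.mem_iff.2 ⟨hu, mul_eq_one_comm.1 hu⟩, fun k i hki => ?_, ?_⟩
  · have := hz _ _ hki
    rw [hin] at this
    rw [← this, mul_assoc, Matrix.mul_apply]
    refine Finset.sum_congr rfl fun s _ => ?_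
    simp [conjLin, Matrix.mul_apply, Matrix.mulVec, dotProduct]
  · ext i j
    have := congrArg (fun x : EuclideanSpace ℂ (Fin m) => x i) (hv2 (eq j))
    rw [conjLin_conjLin] at this
    rw [Matrix.mul_diagonal]
    simpa [Matrix.mul_apply, Matrix.mulVec, dotProduct, mul_comm] using this

end NormalForm

/-! ### Existence of an admissible quadruple -/

section Existence

/-- The circle group with the discrete topology. -/
def DiscreteCircle : Type := Circle

instance : CommGroup DiscreteCircle := inferInstanceAs (CommGroup Circle)
instance : TopologicalSpace DiscreteCircle := ⊥
instance : DiscreteTopology DiscreteCircle := ⟨rfl⟩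

/-- The product of the Bohr compactification of `ℤ` and the circle. -/
abbrev BohrCircle : Type := PontryaginDual DiscreteCircle × Circle

/-- The character of the Bohr compactification of `ℤ` that takes the value `z` at `1 ∈ ℤ`. -/
def bohrChar : Circle →* PontryaginDual BohrCircle where
  toFun z :=
    ({ toFun := fun t => t.1 (show DiscreteCircle from z)
       map_one' := rfl
       map_mul' := fun _ _ => rfl
       continuous_toFun :=
        (ContinuousEvalConst.continuous_eval_const (F := ContinuousMonoidHom DiscreteCircle Circle)
          (show DiscreteCircle from z)).comp continuous_fst } : BohrCircle →ₜ* Circle)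
  map_one' := PontryaginDual.ext fun t => map_one t.1
  map_mul' y z := PontryaginDual.ext fun t =>
    map_mul t.1 (show DiscreteCircle from y) (show DiscreteCircle from z)

/-- The projection onto the circle. -/
def circleChar : PontryaginDual BohrCircle :=
  ({ toFun := Prod.snd
     map_one' := rfl
     map_mul' := fun _ _ => rfl
     continuous_toFun := continuous_snd } : BohrCircle →ₜ* Circle)

/-- The image of `1 ∈ ℤ` in the Bohr compactification. -/
def bohrPoint : BohrCircle :=
  (({ toFun := fun z => (show Circle from z)
      map_one' := rfl
      map_mul' := fun _ _ => rfl
      continuous_toFun := continuous_of_discreteTopology } : DiscreteCircle →ₜ* Circle), 1)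

/-- The bicharacter `(γ, γ') ↦ γ'(1, γ(p))`, where `p` is the point `bohrPoint`. -/
def bohrBichar : Bichar (PontryaginDual BohrCircle) where
  toFun c :=
    { toFun := fun d => d (1, c bohrPoint)
      map_one' := rfl
      map_mul' := fun _ _ => rfl }
  map_one' := MonoidHom.ext fun d => map_one d
  map_mul' b c := MonoidHom.ext fun d => by
    change d (1, b bohrPoint * c bohrPoint) = d (1, b bohrPoint) * d (1, c bohrPoint)
    rw [← map_mul, Prod.mk_mul_mk, one_mul]

/-- At the point p the character w χ_z takes the value z, and w reads this value off from (1, z).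
Thus a bicharacter exists that recovers the label z from w χ_z, with no condition on the labels. -/
theorem bohrBichar_bohrChar (z : Circle) :
    bohrBichar (circleChar * bohrChar z) circleChar = z := by
  change (1 : Circle) * z = z
  exact one_mul z

/-- The matrix `W diag(g) W*` over a group algebra. -/
def diagConj {Γ : Type*} [CommGroup Γ] {m : ℕ} (W : Matrix (Fin m) (Fin m) ℂ) (g : Fin m → Γ) :
    Matrix (Fin m) (Fin m) (MonoidAlgebra ℂ Γ) :=
  Matrix.of fun i j => ∑ k, MonoidAlgebra.single (g k) (W i k * star (W j k))

variable {Γ : Type*} [CommGroup Γ] {m : ℕ} {W : Matrix (Fin m) (Fin m) ℂ} (g : Fin m → Γ)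

theorem star_mul_self_apply (hW : W ∈ unitary (Matrix (Fin m) (Fin m) ℂ)) (k l : Fin m) :
    ∑ s, star (W s k) * W s l = if k = l then 1 else 0 := by
  rw [← Matrix.one_apply, ← Unitary.star_mul_self_of_mem hW, Matrix.mul_apply]
  rfl

theorem comul_single_one (a : Γ) :
    Coalgebra.comul (R := ℂ) (MonoidAlgebra.single a (1 : ℂ)) =
      MonoidAlgebra.single a (1 : ℂ) ⊗ₜ[ℂ] MonoidAlgebra.single a (1 : ℂ) := by
  rw [MonoidAlgebra.comul_single, CommSemiring.comul_apply, TensorProduct.map_tmul]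
  rfl

theorem isCorepMatrix_diagConj (hW : W ∈ unitary (Matrix (Fin m) (Fin m) ℂ)) :
    IsCorepMatrix (diagConj W g) := by
  refine ⟨fun i j => ?_, fun i j => ?_⟩
  · have h : ∀ s k l, MonoidAlgebra.single (g k) (W i k * star (W s k)) ⊗ₜ[ℂ]
        MonoidAlgebra.single (g l) (W s l * star (W j l)) =
        (star (W s k) * W s l) • (MonoidAlgebra.single (g k) (W i k) ⊗ₜ[ℂ]
          MonoidAlgebra.single (g l) (star (W j l))) := fun s k l => by
      rw [mul_smul, ← TensorProduct.tmul_smul, TensorProduct.smul_tmul', MonoidAlgebra.smul_single,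
        MonoidAlgebra.smul_single, smul_eq_mul, smul_eq_mul, mul_comm (star (W s k))]
    simp only [diagConj, Matrix.of_apply, map_sum, TensorProduct.sum_tmul, TensorProduct.tmul_sum, h]
    -- The sum over the middle matrix index is brought innermost; it is the inner product of columns
    -- k and l of W, which leaves l = k.
    rw [Finset.sum_congr rfl fun s _ => Finset.sum_comm, Finset.sum_comm]
    refine Finset.sum_congr rfl fun k _ => ?_
    rw [Finset.sum_comm, Finset.sum_eq_single k]
    · rw [← Finset.sum_smul, star_mul_self_apply hW]
      have h1 : MonoidAlgebra.single (g k) (W i k * star (W j k)) =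
          (W i k * star (W j k)) • MonoidAlgebra.single (g k) (1 : ℂ) := by simp
      have h2 : ∀ c : ℂ, MonoidAlgebra.single (g k) c = c • MonoidAlgebra.single (g k) (1 : ℂ) :=
        fun c => by simp
      rw [if_pos rfl, one_smul, h1, map_smul, comul_single_one, h2 (W i k),
        h2 (star (W j k)), TensorProduct.smul_tmul_smul]
    · intro l _ hl
      rw [← Finset.sum_smul, star_mul_self_apply hW, if_neg hl.symm, zero_smul]
    · simp
  · rw [← Unitary.mul_star_self_of_mem hW, Matrix.mul_apply]
    simp [diagConj, MonoidAlgebra.counit_single]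

theorem diagConj_eq : diagConj W g = W.map (algebraMap ℂ (MonoidAlgebra ℂ Γ)) *
    Matrix.diagonal (fun k => MonoidAlgebra.single (g k) 1) *
      (star W).map (algebraMap ℂ (MonoidAlgebra ℂ Γ)) := by
  ext1 i j
  rw [Matrix.mul_apply]
  simp [diagConj, Matrix.mul_diagonal, MonoidAlgebra.single_mul_single]

theorem star_map_algebraMap {R : Type*} [Ring R] [Algebra ℂ R] [StarRing R] [StarModule ℂ R]
    (M : Matrix (Fin m) (Fin m) ℂ) :
    star (M.map (algebraMap ℂ R)) = (star M).map (algebraMap ℂ R) := by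
  ext1 i j
  simp only [Matrix.star_apply, Matrix.map_apply]
  exact (algebraMap_star_comm _).symm

theorem map_algebraMap_mem_unitary {R : Type*} [Ring R] [Algebra ℂ R] [StarRing R] [StarModule ℂ R]
    {M : Matrix (Fin m) (Fin m) ℂ} (hM : M ∈ unitary (Matrix (Fin m) (Fin m) ℂ)) :
    M.map (algebraMap ℂ R) ∈ unitary (Matrix (Fin m) (Fin m) R) := by
  rw [Unitary.mem_iff, star_map_algebraMap, ← Matrix.map_mul, ← Matrix.map_mul,
    Unitary.star_mul_self_of_mem hM, Unitary.mul_star_self_of_mem hM]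
  simp

theorem diagConj_mem_unitary (hW : W ∈ unitary (Matrix (Fin m) (Fin m) ℂ)) :
    diagConj W g ∈ unitary (Matrix (Fin m) (Fin m) (MonoidAlgebra ℂ Γ)) := by
  rw [diagConj_eq, ← star_map_algebraMap]
  have h := map_algebraMap_mem_unitary (R := MonoidAlgebra ℂ Γ) hW
  refine mul_mem (mul_mem h ?_) (Unitary.star_mem h)
  rw [Unitary.mem_iff, Matrix.star_eq_conjTranspose, Matrix.diagonal_conjTranspose]
  simp only [Matrix.diagonal_mul_diagonal]
  simp [star_single, MonoidAlgebra.single_mul_single, ← MonoidAlgebra.one_def]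

/-- With M = W*AW̄ and Z = diag(z), the support condition on M says that M intertwines diag(z̄) with
Z, and diag(w²g⁻¹) with diag(g) for g_i = w χ_{z_i}. The second statement is the relation between X̄
and X. The first gives AC = (WZW*)A, whence AC times its conjugate is WZW* · AĀ · WZW* = τ1 by the
equation for AĀW. -/
theorem exists_isAdmissible {A : Matrix (Fin m) (Fin m) ℂ} (hA : IsUnit A.det)
    (hAA : A * A.map star ∈ unitary (Matrix (Fin m) (Fin m) ℂ)) {τ : ℂ}
    (hτ : τ = 1 ∨ τ = -1) (hodd : Odd m → τ = 1) :
    ∃ X w β, IsAdmissible (Γ := PontryaginDual BohrCircle) A τ X w β := by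
  obtain ⟨W, z, hW, hz, hW2⟩ := exists_unitary_normal_form hAA hτ hodd
  have hWW := Unitary.mul_star_self_of_mem hW
  have hWs := Unitary.star_mul_self_of_mem hW
  set g : Fin m → PontryaginDual BohrCircle := fun i => circleChar * bohrChar (z i) with hg
  set M := star W * A * W.map star with hM
  have hWT : W.map star * W.transpose = 1 := by
    have h1 : W.map star = (star W).transpose := by
      ext i j
      simp [Matrix.star_apply]
    rw [h1, ← Matrix.transpose_mul, hWW, Matrix.transpose_one]
  have hAW : A * W.map star = W * M := by
    rw [hM, ← mul_assoc, ← mul_assoc, hWW, one_mul]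
  refine ⟨diagConj W g, circleChar, bohrBichar, isCorepMatrix_diagConj _ hW,
    diagConj_mem_unitary g hW, ?_, ?_⟩
  · have h1 : MonoidAlgebra.single (circleChar ^ 2) (1 : ℂ) • (diagConj W g).map star =
        (W.map star).map (algebraMap ℂ _) *
          Matrix.diagonal (fun k => MonoidAlgebra.single (circleChar ^ 2 * (g k)⁻¹) (1 : ℂ)) *
          W.transpose.map (algebraMap ℂ _) := by
      ext1 i j
      rw [Matrix.mul_apply]
      simp [diagConj, Matrix.mul_diagonal, MonoidAlgebra.single_mul_single, Finset.mul_sum,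
        star_single, star_sum]
    have h2 : M.map (algebraMap ℂ (MonoidAlgebra ℂ (PontryaginDual BohrCircle))) *
          Matrix.diagonal (fun k => MonoidAlgebra.single (circleChar ^ 2 * (g k)⁻¹) (1 : ℂ)) =
        Matrix.diagonal (fun k => MonoidAlgebra.single (g k) (1 : ℂ)) * M.map (algebraMap ℂ _) := by
      ext1 i j
      rw [Matrix.mul_diagonal, Matrix.diagonal_mul]
      -- If z_i z_j = 1, then w²(w χ_{z_j})⁻¹ = w χ_{z_i}; otherwise the entry of M vanishes.
      by_cases hij : z i * z j = 1
      · have h3 : circleChar ^ 2 * (g j)⁻¹ = g i := by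
          rw [hg, mul_inv_eq_iff_eq_mul]
          simp only
          rw [mul_mul_mul_comm, ← map_mul, hij, map_one, mul_one, sq]
        rw [h3, mul_comm]
      · simp [hz i j hij]
    rw [conjBy, h1, diagConj_eq, ← mul_assoc, ← mul_assoc, ← Matrix.map_mul, hAW, Matrix.map_mul,
      mul_assoc (W.map _), h2]
    simp only [mul_assoc]
    rw [← Matrix.map_mul, ← Matrix.map_mul]
    congr 3
    rw [hM, mul_assoc, mul_assoc, ← mul_assoc (W.map star), hWT, one_mul,
      Matrix.mul_nonsing_inv _ hA, mul_one]
  · set Z : Matrix (Fin m) (Fin m) ℂ := Matrix.diagonal fun i => (z i : ℂ) with hZ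
    set Z' : Matrix (Fin m) (Fin m) ℂ := Matrix.diagonal fun i => star (z i : ℂ) with hZ'
    have hZs : Z'.map star = Z := by
      ext i j
      by_cases h : i = j
      · simp [hZ, hZ', h]
      · simp [hZ, hZ', h]
    have hWTs : W.transpose.map star = star W := by
      ext i j
      simp [Matrix.star_apply]
    have hWss : (W.map star).map star = W := by
      ext i j
      simp
    -- The entry x_ij* has the coefficient W̄_ik W_jk at (w χ_{z_k})⁻¹, where β(·, w) equals z̄_k.
    have hC : charMatrix (diagConj W g) circleChar bohrBichar = W.map star * Z' * W.transpose := by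
      ext1 i j
      rw [Matrix.mul_apply]
      simp only [charMatrix, diagConj, Matrix.of_apply, star_sum, star_single, map_sum,
        LinearMap.sum_apply, Bichar.lin_single, hZ', Matrix.mul_diagonal, map_inv,
        MonoidHom.inv_apply, hg, bohrBichar_bohrChar, Circle.coe_inv_eq_conj, star_mul', star_star,
        Matrix.map_apply, Matrix.transpose_apply]
      refine Finset.sum_congr rfl fun k _ => ?_
      rw [Complex.star_def]
      ring
    have h2 : M * Z' = Z * M := by
      ext i j
      rw [Matrix.mul_diagonal, Matrix.diagonal_mul]
      by_cases hij : z i * z j = 1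
      · rw [eq_inv_of_mul_eq_one_left hij, Circle.coe_inv_eq_conj, mul_comm]; rfl
      · simp [hz i j hij]
    have hZZ : Z * Z' = 1 := by
      rw [hZ, hZ', Matrix.diagonal_mul_diagonal]
      simp [Complex.mul_conj]
    have hZ2 : A * A.map star * W * Z = τ • (W * Z') := by
      have h3 : Matrix.diagonal (fun i => (z i : ℂ) ^ 2) = Z * Z := by
        rw [hZ, Matrix.diagonal_mul_diagonal]
        simp only [sq]
      rw [h3] at hW2
      rw [← Matrix.smul_mul, ← hW2]
      simp only [mul_assoc, hZZ, mul_one]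
    have hmap : ∀ P Q : Matrix (Fin m) (Fin m) ℂ, (P * Q).map star = P.map star * Q.map star :=
      fun P Q => Matrix.map_mul (f := starRingEnd ℂ)
    rw [hC, hmap, hmap, hmap, hWss, hZs, hWTs]
    calc A * (W.map star * Z' * W.transpose) * (A.map star * (W * Z * star W))
        = W * (M * Z') * W.transpose * (A.map star * (W * Z * star W)) := by
          rw [← mul_assoc W, ← hAW]
          simp only [mul_assoc]
      _ = W * Z * star W * A * (W.map star * W.transpose) * (A.map star * (W * Z * star W)) := by
          rw [h2, hM]
          simp only [mul_assoc]
      _ = W * Z * star W * (A * A.map star * W * Z) * star W := by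
          rw [hWT, mul_one]
          simp only [mul_assoc]
      _ = τ • (W * (Z * (star W * W) * Z') * star W) := by
          rw [hZ2]
          simp only [mul_assoc, Matrix.smul_mul, Matrix.mul_smul]
      _ = τ • 1 := by
          rw [hWs, mul_one, hZZ, mul_one, hWW]

end Existence

/-! ### Group algebras twisted by a bicharacter -/

section TwistedGroupAlgebra

variable {G : Type*} [CommGroup G]

/-- The group algebra of `G`, with the product twisted by a bicharacter `σ`. -/
def TwistedGroupAlg (_σ : Bichar G) : Type _ := G →₀ ℂ

namespace TwistedGroupAlg

variable (σ : Bichar G)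

instance : AddCommGroup (TwistedGroupAlg σ) := inferInstanceAs (AddCommGroup (G →₀ ℂ))
instance : Module ℂ (TwistedGroupAlg σ) := inferInstanceAs (Module ℂ (G →₀ ℂ))

/-- The basis vector `e_g`. -/
def basisVec (g : G) : TwistedGroupAlg σ := Finsupp.single g (1 : ℂ)

/-- The linear map with prescribed values on the basis. -/
def lift {M : Type*} [AddCommGroup M] [Module ℂ M] (f : G → M) : TwistedGroupAlg σ →ₗ[ℂ] M :=
  Finsupp.linearCombination ℂ f

variable {σ}

@[simp]
theorem lift_basisVec {M : Type*} [AddCommGroup M] [Module ℂ M] (f : G → M) (g : G) :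
    lift σ f (basisVec σ g) = f g := by
  exact (Finsupp.linearCombination_single ℂ 1 g).trans (one_smul _ _)

theorem linearMap_ext {M : Type*} [AddCommGroup M] [Module ℂ M] {f f' : TwistedGroupAlg σ →ₗ[ℂ] M}
    (h : ∀ g, f (basisVec σ g) = f' (basisVec σ g)) : f = f' :=
  Finsupp.lhom_ext' fun g => LinearMap.ext_ring (h g)

variable (σ) in
/-- The product as a bilinear map. -/
def mulLin : TwistedGroupAlg σ →ₗ[ℂ] TwistedGroupAlg σ →ₗ[ℂ] TwistedGroupAlg σ :=
  lift σ fun g => lift σ fun h => (σ g h : ℂ) • basisVec σ (g * h)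

instance : Mul (TwistedGroupAlg σ) := ⟨fun x y => mulLin σ x y⟩
instance : One (TwistedGroupAlg σ) := ⟨basisVec σ 1⟩

theorem mul_eq (x y : TwistedGroupAlg σ) : x * y = mulLin σ x y := rfl

theorem basisVec_mul (g h : G) :
    basisVec σ g * basisVec σ h = (σ g h : ℂ) • basisVec σ (g * h) := by
  simp [mul_eq, mulLin]

theorem one_eq : (1 : TwistedGroupAlg σ) = basisVec σ 1 := rfl

@[elab_as_elim]
theorem induction {p : TwistedGroupAlg σ → Prop} (x : TwistedGroupAlg σ) (h0 : p 0)
    (hadd : ∀ x y, p x → p y → p (x + y)) (hsmul : ∀ (c : ℂ) g, p (c • basisVec σ g)) : p x := by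
  refine Finsupp.induction_linear (motive := p) x h0 hadd fun g c => ?_
  have : (Finsupp.single g c : G →₀ ℂ) = c • (Finsupp.single g (1 : ℂ) : G →₀ ℂ) := by simp
  rw [this]
  exact hsmul c g

theorem basisVec_mul_assoc (x y z : TwistedGroupAlg σ) : x * y * z = x * (y * z) := by
  simp only [mul_eq]
  induction x using induction with
  | h0 => simp
  | hadd x x' hx hx' => simp [hx, hx']
  | hsmul c g =>
    simp only [map_smul, LinearMap.smul_apply]
    congr 1
    induction y using induction with
    | h0 => simp
    | hadd y y' hy hy' => simp [hy, hy']
    | hsmul d h =>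
      simp only [map_smul, LinearMap.smul_apply]
      congr 1
      induction z using induction with
      | h0 => simp
      | hadd z z' hz hz' => simp [hz, hz']
      | hsmul e k =>
        simp only [map_smul, ← mul_eq, basisVec_mul, LinearMap.smul_apply]
        rw [smul_smul (σ g h : ℂ), smul_smul (σ h k : ℂ), mul_assoc, map_mul, map_mul,
          MonoidHom.mul_apply, Circle.coe_mul, Circle.coe_mul]
        congr 2
        ring

instance : Ring (TwistedGroupAlg σ) where
  __ := (inferInstance : AddCommGroup (TwistedGroupAlg σ))
  left_distrib x y z := by simp [mul_eq]
  right_distrib x y z := by simp [mul_eq]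
  zero_mul x := by simp [mul_eq]
  mul_zero x := by simp [mul_eq]
  mul_assoc := basisVec_mul_assoc
  one_mul x := by
    have h : mulLin σ (1 : TwistedGroupAlg σ) = LinearMap.id :=
      linearMap_ext fun g => by simp [mulLin, one_eq]
    rw [mul_eq, h, LinearMap.id_apply]
  mul_one x := by
    have h : (mulLin σ).flip (1 : TwistedGroupAlg σ) = LinearMap.id :=
      linearMap_ext fun g => by simp [mulLin, one_eq]
    exact LinearMap.congr_fun h x

instance : Algebra ℂ (TwistedGroupAlg σ) :=
  Algebra.ofModule (fun c x y => by simp [mul_eq]) (fun c x y => by simp [mul_eq])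

/-- The involution, `e_g* = e_g⁻¹`. -/
def starFun (x : TwistedGroupAlg σ) : TwistedGroupAlg σ :=
  lift σ (fun g => (σ g g : ℂ) • basisVec σ g⁻¹)
    (Finsupp.mapRange (starRingEnd ℂ) (map_zero _) x : G →₀ ℂ)

theorem starFun_add (x y : TwistedGroupAlg σ) : starFun (x + y) = starFun x + starFun y := by
  exact (congrArg (lift σ _) (Finsupp.mapRange_add (fun _ _ => map_add _ _ _) _ _)).trans
    (map_add (lift σ _) _ _)

theorem starFun_smul (c : ℂ) (x : TwistedGroupAlg σ) : starFun (c • x) = star c • starFun x := by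
  exact (congrArg (lift σ _) (Finsupp.mapRange_smul' c (star c) x
    fun d => map_mul (starRingEnd ℂ) c d)).trans (map_smul (lift σ _) (star c) _)

theorem starFun_basisVec (g : G) : starFun (basisVec σ g) = (σ g g : ℂ) • basisVec σ g⁻¹ := by
  unfold starFun
  have : (Finsupp.mapRange (starRingEnd ℂ) (map_zero _) (basisVec σ g) : G →₀ ℂ) =
      basisVec σ g := by
    refine Finsupp.mapRange_single.trans ?_
    rw [map_one]
    rfl
  rw [this]
  exact lift_basisVec _ g

theorem starFun_zero : starFun (0 : TwistedGroupAlg σ) = 0 := by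
  have := starFun_smul (0 : ℂ) (0 : TwistedGroupAlg σ)
  simpa using this

theorem starFun_starFun (x : TwistedGroupAlg σ) : starFun (starFun x) = x := by
  induction x using induction with
  | h0 => simp [starFun_zero]
  | hadd x y hx hy => rw [starFun_add, starFun_add, hx, hy]
  | hsmul c g =>
    rw [starFun_smul, starFun_smul, star_star, starFun_basisVec, starFun_smul, starFun_basisVec,
      smul_smul (star _), inv_inv, map_inv, map_inv, MonoidHom.inv_apply, inv_inv,
      Complex.star_def, ← Circle.coe_inv_eq_conj, ← Circle.coe_mul, inv_mul_cancel, Circle.coe_one,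
      one_smul]

theorem starFun_mul (x y : TwistedGroupAlg σ) : starFun (x * y) = starFun y * starFun x := by
  induction x using induction with
  | h0 => simp [starFun_zero]
  | hadd x x' hx hx' => rw [add_mul, starFun_add, starFun_add, hx, hx', mul_add]
  | hsmul c g =>
    rw [smul_mul_assoc, starFun_smul, starFun_smul, mul_smul_comm]
    congr 1
    induction y using induction with
    | h0 => simp [starFun_zero]
    | hadd y y' hy hy' => rw [mul_add, starFun_add, starFun_add, hy, hy', add_mul]
    | hsmul d h =>
      rw [mul_smul_comm, starFun_smul, starFun_smul, smul_mul_assoc]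
      congr 1
      rw [basisVec_mul, starFun_smul, starFun_basisVec, starFun_basisVec, starFun_basisVec,
        smul_mul_assoc, mul_smul_comm, basisVec_mul, smul_smul, smul_smul, smul_smul, mul_inv_rev]
      congr 1
      rw [Complex.star_def, ← Circle.coe_inv_eq_conj]
      simp only [← Circle.coe_mul, map_mul, MonoidHom.mul_apply, map_inv, MonoidHom.inv_apply,
        inv_inv]
      -- Both sides are now products of values of σ on pairs from g, h and of inverses of such
      -- values; in additive notation this is an identity in a free abelian group.
      refine congrArg (fun c : Circle => (c : ℂ)) (Additive.ofMul.injective ?_)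
      simp only [ofMul_mul, ofMul_inv]
      abel

instance : StarRing (TwistedGroupAlg σ) where
  star := starFun
  star_involutive := starFun_starFun
  star_mul := starFun_mul
  star_add := starFun_add

instance : StarModule ℂ (TwistedGroupAlg σ) where
  star_smul := starFun_smul

theorem star_basisVec (g : G) : star (basisVec σ g) = (σ g g : ℂ) • basisVec σ g⁻¹ :=
  starFun_basisVec g

/-- The scalar σ(g,g) in e_g* cancels the factor σ(g,g⁻¹) or σ(g⁻¹,g) of the product. -/
theorem basisVec_mem_unitary (g : G) : basisVec σ g ∈ unitary (TwistedGroupAlg σ) := by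
  rw [Unitary.mem_iff, star_basisVec, smul_mul_assoc, mul_smul_comm, basisVec_mul, basisVec_mul,
    smul_smul, smul_smul, one_eq]
  simp [← Circle.coe_mul]

end TwistedGroupAlg

end TwistedGroupAlgebra

/-! ### Corepresentation matrices of a group algebra and projections -/

section Spectral

variable {Γ : Type*} [CommGroup Γ] {m : ℕ}

/-- A complex matrix as a matrix over a complex algebra. -/
abbrev scalarMatrix (R : Type*) [Ring R] [Algebra ℂ R] :
    Matrix (Fin m) (Fin m) ℂ →+* Matrix (Fin m) (Fin m) R :=
  (algebraMap ℂ R).mapMatrix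

theorem scalarMatrix_apply (R : Type*) [Ring R] [Algebra ℂ R] (M : Matrix (Fin m) (Fin m) ℂ)
    (i j : Fin m) : scalarMatrix R M i j = algebraMap ℂ R (M i j) := rfl

/-- The entrywise complex conjugate, as a ring homomorphism. -/
abbrev conjC : Matrix (Fin m) (Fin m) ℂ →+* Matrix (Fin m) (Fin m) ℂ := (starRingEnd ℂ).mapMatrix

/-- A finite family of orthogonal projections with sum `1`, indexed by elements of `Γ`. -/
structure SpectralFamily (Γ : Type*) (m : ℕ) where
  supp : Finset Γ
  proj : Γ → Matrix (Fin m) (Fin m) ℂ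
  proj_mul_self : ∀ a, proj a * proj a = proj a
  proj_mul_of_ne : ∀ a b, a ≠ b → proj a * proj b = 0
  star_proj : ∀ a, star (proj a) = proj a
  sum_proj : ∑ a ∈ supp, proj a = 1

namespace SpectralFamily

variable (Q : SpectralFamily Γ m)

theorem proj_apply_star (a : Γ) (i j : Fin m) : star (Q.proj a i j) = Q.proj a j i := by
  conv_rhs => rw [← Q.star_proj]
  rfl

/-- The entrywise complex conjugate of a family of projections. -/
def conj : SpectralFamily Γ m where
  supp := Q.supp
  proj a := conjC (Q.proj a)
  proj_mul_self a := by rw [← map_mul, Q.proj_mul_self]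
  proj_mul_of_ne a b h := by rw [← map_mul, Q.proj_mul_of_ne a b h, map_zero]
  star_proj a := by
    conv_rhs => rw [← Q.star_proj a]
    rfl
  sum_proj := by rw [← map_sum, Q.sum_proj, map_one]

variable {E : Type*} [Ring E] [Algebra ℂ E]

/-- The matrix `∑ a, P_a ⊗ l_a`. -/
def expand (l : Γ → E) : Matrix (Fin m) (Fin m) E :=
  Matrix.of fun i j => ∑ a ∈ Q.supp, Q.proj a i j • l a

theorem expand_apply (l : Γ → E) (i j : Fin m) :
    Q.expand l i j = ∑ a ∈ Q.supp, Q.proj a i j • l a := rfl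

theorem proj_eq_zero {a : Γ} (ha : a ∉ Q.supp) : Q.proj a = 0 := by
  rw [← mul_one (Q.proj a), ← Q.sum_proj, Finset.mul_sum]
  exact Finset.sum_eq_zero fun b hb => Q.proj_mul_of_ne a b (fun h => ha (h ▸ hb))

theorem proj_mul_expand (a : Γ) (l : Γ → E) :
    scalarMatrix E (Q.proj a) * Q.expand l = (Q.proj a).map (· • l a) := by
  ext1 i j
  simp only [Matrix.mul_apply, scalarMatrix_apply, expand_apply, Finset.mul_sum, Matrix.map_apply]
  rw [Finset.sum_comm]
  have h : ∀ b, ∑ k, algebraMap ℂ E (Q.proj a i k) * Q.proj b k j • l b =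
      (Q.proj a * Q.proj b) i j • l b := fun b => by
    simp only [Matrix.mul_apply, Finset.sum_smul, ← Algebra.smul_def, smul_smul]
  simp only [h]
  by_cases ha : a ∈ Q.supp
  · rw [Finset.sum_eq_single_of_mem a ha, Q.proj_mul_self]
    intro b _ hb
    rw [Q.proj_mul_of_ne a b hb.symm, Matrix.zero_apply, zero_smul]
  · simp [Q.proj_eq_zero ha]

theorem expand_mul_proj (a : Γ) (l : Γ → E) :
    Q.expand l * scalarMatrix E (Q.proj a) = (Q.proj a).map (· • l a) := by
  ext1 i j
  simp only [Matrix.mul_apply, scalarMatrix_apply, expand_apply, Finset.sum_mul, Matrix.map_apply]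
  rw [Finset.sum_comm]
  have h : ∀ b, ∑ k, Q.proj b i k • l b * algebraMap ℂ E (Q.proj a k j) =
      (Q.proj b * Q.proj a) i j • l b := fun b => by
    simp only [Matrix.mul_apply, Finset.sum_smul, ← Algebra.commutes, ← Algebra.smul_def,
      smul_smul]
    exact Finset.sum_congr rfl fun k _ => by rw [mul_comm]
  simp only [h]
  by_cases ha : a ∈ Q.supp
  · rw [Finset.sum_eq_single_of_mem a ha, Q.proj_mul_self]
    intro b _ hb
    rw [Q.proj_mul_of_ne b a hb, Matrix.zero_apply, zero_smul]
  · simp [Q.proj_eq_zero ha]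

theorem eq_of_forall_proj_mul {M N : Matrix (Fin m) (Fin m) E}
    (h : ∀ a, scalarMatrix E (Q.proj a) * M = scalarMatrix E (Q.proj a) * N) : M = N := by
  rw [← one_mul M, ← one_mul N, ← map_one (scalarMatrix E), ← Q.sum_proj, map_sum, Finset.sum_mul,
    Finset.sum_mul]
  exact Finset.sum_congr rfl fun a _ => h a

theorem eq_of_forall_proj_mul_proj {M N : Matrix (Fin m) (Fin m) E}
    (h : ∀ a b, scalarMatrix E (Q.proj a) * M * scalarMatrix E (Q.proj b) =
      scalarMatrix E (Q.proj a) * N * scalarMatrix E (Q.proj b)) : M = N := by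
  refine Q.eq_of_forall_proj_mul fun a => ?_
  rw [← mul_one (_ * M), ← mul_one (_ * N), ← map_one (scalarMatrix E), ← Q.sum_proj, map_sum,
    Finset.mul_sum, Finset.mul_sum]
  exact Finset.sum_congr rfl fun b _ => h a b

theorem expand_mul (l l' : Γ → E) : Q.expand l * Q.expand l' = Q.expand (l * l') := by
  refine Q.eq_of_forall_proj_mul fun a => ?_
  rw [← mul_assoc, proj_mul_expand, proj_mul_expand]
  have h : (Q.proj a).map (· • l a) = Matrix.diagonal (fun _ => l a) * scalarMatrix E (Q.proj a) := by
    ext1 i j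
    rw [Matrix.diagonal_mul, scalarMatrix_apply, Matrix.map_apply, ← Algebra.commutes,
      Algebra.smul_def]
  rw [h, mul_assoc, proj_mul_expand]
  ext1 i j
  simp [Matrix.diagonal_mul]

theorem expand_one : Q.expand (1 : Γ → E) = 1 := by
  refine Q.eq_of_forall_proj_mul fun a => ?_
  rw [proj_mul_expand, mul_one]
  ext1 i j
  simp [scalarMatrix_apply, Algebra.smul_def]

theorem star_expand [StarRing E] [StarModule ℂ E] (l : Γ → E) :
    star (Q.expand l) = Q.expand (star l) := by
  ext1 i j
  rw [Matrix.star_apply, expand_apply, expand_apply, star_sum]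
  simp only [star_smul, proj_apply_star, Pi.star_apply]

theorem expand_mem_unitary [StarRing E] [StarModule ℂ E] {l : Γ → E}
    (hl : ∀ a, l a ∈ unitary E) : Q.expand l ∈ unitary (Matrix (Fin m) (Fin m) E) := by
  rw [Unitary.mem_iff, star_expand, expand_mul, expand_mul, ← Q.expand_one (E := E)]
  exact ⟨congrArg _ (funext fun a => Unitary.star_mul_self_of_mem (hl a)),
    congrArg _ (funext fun a => Unitary.mul_star_self_of_mem (hl a))⟩

theorem map_expand {E' F : Type*} [Ring E'] [Algebra ℂ E'] [FunLike F E E']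
    [LinearMapClass F ℂ E E'] (f : F) (l : Γ → E) :
    (Q.expand l).map f = Q.expand (fun a => f (l a)) := by
  ext1 i j
  simp [expand_apply]

/-- The corepresentation matrix `∑ a, P_a a` of the group algebra. -/
def toMatrix : Matrix (Fin m) (Fin m) (MonoidAlgebra ℂ Γ) :=
  Q.expand fun a => MonoidAlgebra.single a 1

end SpectralFamily

theorem IsCorepMatrix.single_smul {X : Matrix (Fin m) (Fin m) (MonoidAlgebra ℂ Γ)}
    (hX : IsCorepMatrix X) (w : Γ) :
    IsCorepMatrix (MonoidAlgebra.single w (1 : ℂ) • X) := by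
  refine ⟨fun i j => ?_, fun i j => ?_⟩
  · simp only [Matrix.smul_apply, smul_eq_mul, Bialgebra.comul_mul, comul_single_one, hX.1,
      Finset.mul_sum, Algebra.TensorProduct.tmul_mul_tmul]
  · simp only [Matrix.smul_apply, smul_eq_mul, Bialgebra.counit_mul, hX.2]
    simp [MonoidAlgebra.counit_single]

theorem single_smul_mem_unitary {X : Matrix (Fin m) (Fin m) (MonoidAlgebra ℂ Γ)}
    (hX : X ∈ unitary (Matrix (Fin m) (Fin m) (MonoidAlgebra ℂ Γ))) (w : Γ) :
    MonoidAlgebra.single w (1 : ℂ) • X ∈ unitary (Matrix (Fin m) (Fin m) (MonoidAlgebra ℂ Γ)) := by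
  have h : star (MonoidAlgebra.single w (1 : ℂ)) * MonoidAlgebra.single w (1 : ℂ) = 1 := by
    simp [star_single, MonoidAlgebra.single_mul_single, MonoidAlgebra.one_def]
  have h' : MonoidAlgebra.single w (1 : ℂ) * star (MonoidAlgebra.single w (1 : ℂ)) = 1 := by
    rw [mul_comm, h]
  rw [Unitary.mem_iff] at hX ⊢
  rw [star_smul, Matrix.smul_mul, Matrix.mul_smul, Matrix.smul_mul, Matrix.mul_smul, smul_smul,
    smul_smul, hX.1, hX.2, h, h', one_smul]
  exact ⟨rfl, rfl⟩

/-- The coefficient functional. -/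
def coefLin (a : Γ) : MonoidAlgebra ℂ Γ →ₗ[ℂ] ℂ :=
  Finsupp.lapply a ∘ₗ (MonoidAlgebra.coeffLinearEquiv ℂ).toLinearMap

theorem coefLin_apply (a : Γ) (x : MonoidAlgebra ℂ Γ) : coefLin a x = x.coeff a := rfl

theorem coefLin_single [DecidableEq Γ] (a b : Γ) (c : ℂ) :
    coefLin a (MonoidAlgebra.single b c) = if a = b then c else 0 := by
  change Finsupp.single b c a = _
  rw [Finsupp.single_apply]
  simp only [eq_comm]

theorem coefLin_star (a : Γ) (x : MonoidAlgebra ℂ Γ) :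
    coefLin a⁻¹ (star x) = star (coefLin a x) := by
  classical
  change (groupAlgStarHom Γ x).coeff a⁻¹ = star (x.coeff a)
  induction x using MonoidAlgebra.induction_linear with
  | zero => simp
  | add x y hx hy => simp [hx, hy]
  | single g c =>
    rw [groupAlgStarHom_single, ← coefLin_apply, ← coefLin_apply, coefLin_single,
      coefLin_single, inv_inj]
    by_cases h : a = g <;> simp [h]

theorem groupAlg_linearMap_ext {M : Type*} [AddCommGroup M] [Module ℂ M]
    {f g : MonoidAlgebra ℂ Γ →ₗ[ℂ] M}
    (h : ∀ a, f (MonoidAlgebra.single a 1) = g (MonoidAlgebra.single a 1)) : f = g :=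
  MonoidAlgebra.lhom_ext' fun a => LinearMap.ext_ring (h a)

/-- Group elements are group-like, so a comultiplied element has only diagonal coefficients. For a
corepresentation matrix this is the orthogonality of its coefficient matrices. -/
theorem coefLin_comul [DecidableEq Γ] (a b : Γ) (x : MonoidAlgebra ℂ Γ) :
    LinearMap.mul' ℂ ℂ (TensorProduct.map (coefLin a) (coefLin b) (Coalgebra.comul (R := ℂ) x)) =
      if a = b then coefLin a x else 0 := by
  have h : LinearMap.mul' ℂ ℂ ∘ₗ TensorProduct.map (coefLin a) (coefLin b) ∘ₗ
      Coalgebra.comul (R := ℂ) = if a = b then coefLin a else 0 := by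
    refine groupAlg_linearMap_ext fun c => ?_
    simp only [LinearMap.comp_apply, comul_single_one, TensorProduct.map_tmul,
      LinearMap.mul'_apply, coefLin_single]
    by_cases h : a = b
    · subst h
      simp [coefLin_single]
    · rw [if_neg h]
      by_cases h' : a = c
      · subst h'
        simp [Ne.symm h]
      · simp [h']
  have := LinearMap.congr_fun h x
  rw [LinearMap.comp_apply, LinearMap.comp_apply] at this
  rw [this]
  split_ifs <;> rfl

/-- Every unitary corepresentation matrix of a group algebra comes from projections. -/
theorem exists_spectralFamily {X : Matrix (Fin m) (Fin m) (MonoidAlgebra ℂ Γ)}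
    (hX : IsCorepMatrix X) (hU : X ∈ unitary (Matrix (Fin m) (Fin m) (MonoidAlgebra ℂ Γ))) :
    ∃ Q : SpectralFamily Γ m, X = Q.toMatrix := by
  classical
  let P : Γ → Matrix (Fin m) (Fin m) ℂ := fun a => X.map (coefLin a)
  have hPP : ∀ a b, P a * P b = if a = b then P a else 0 := fun a b => by
    ext i j
    have := coefLin_comul a b (X i j)
    rw [hX.1, map_sum, map_sum] at this
    simp only [TensorProduct.map_tmul, LinearMap.mul'_apply] at this
    rw [Matrix.mul_apply]
    refine this.trans ?_
    split_ifs <;> rfl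
  -- In matrix form, P_a X = a P_a.
  have hPX : ∀ a i j, ∑ k, P a i k • X k j = MonoidAlgebra.single a (P a i j) := fun a i j => by
    ext b
    have := congrFun (congrFun (hPP a b) i) j
    rw [Matrix.mul_apply] at this
    rw [← coefLin_apply, ← coefLin_apply, map_sum, coefLin_single]
    simp only [map_smul, smul_eq_mul]
    refine this.trans ?_
    by_cases h : a = b
    · simp [h]
    · simp [h, Ne.symm h]
  -- Multiplying P_a X = a P_a by X* gives P_a X* = a⁻¹P_a, and the coefficient of a⁻¹ in X* is
  -- P_a*. Hence P_a P_a* = P_a, which makes the idempotent P_a self-adjoint.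
  have hPs : ∀ a, P a * star (P a) = P a := fun a => by
    ext i j
    have h1 : ∀ k l, ∑ s, X k s * star (X l s) = if k = l then 1 else 0 := fun k l => by
      rw [← Matrix.one_apply, ← Unitary.mul_star_self_of_mem hU, Matrix.mul_apply]
      rfl
    have h2 : ∑ s, MonoidAlgebra.single a (P a i s) * star (X j s) =
        MonoidAlgebra.single 1 (P a i j) := by
      simp only [← hPX, Finset.sum_mul]
      rw [Finset.sum_comm]
      simp only [smul_mul_assoc, ← Finset.smul_sum, h1]
      simp [MonoidAlgebra.one_def]
    have h3 : ∑ s, P a i s • star (X j s) = MonoidAlgebra.single a⁻¹ (P a i j) := by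
      have := congrArg (fun x => MonoidAlgebra.single a⁻¹ (1 : ℂ) * x) h2
      simp only [Finset.mul_sum, ← mul_assoc, MonoidAlgebra.single_mul_single, inv_mul_cancel,
        mul_one, one_mul] at this
      rw [← this]
      refine Finset.sum_congr rfl fun s _ => ?_
      rw [Algebra.smul_def]
      rfl
    have h5 := congrArg (coefLin a⁻¹) h3
    rw [map_sum, coefLin_single, if_pos rfl] at h5
    rw [← h5, Matrix.mul_apply]
    refine Finset.sum_congr rfl fun s _ => ?_
    rw [map_smul, coefLin_star, smul_eq_mul]
    rfl
  let S : Finset Γ := Finset.univ.biUnion fun p : Fin m × Fin m => (X p.1 p.2).coeff.support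
  have hS : ∀ i j, (X i j).coeff.support ⊆ S := fun i j =>
    Finset.subset_biUnion_of_mem (fun p : Fin m × Fin m => (X p.1 p.2).coeff.support)
      (Finset.mem_univ (i, j))
  have hsum : ∀ i j, X i j = ∑ a ∈ S, P a i j • MonoidAlgebra.single a (1 : ℂ) := fun i j => by
    ext b
    rw [← coefLin_apply, ← coefLin_apply, map_sum]
    simp only [map_smul, coefLin_single, smul_eq_mul, mul_ite, mul_one, mul_zero]
    rw [Finset.sum_ite_eq]
    split_ifs with h
    · rfl
    · by_contra h'
      exact h (hS i j (Finsupp.mem_support_iff.2 h'))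
  refine ⟨⟨S, P, fun a => by rw [hPP, if_pos rfl], fun a b h => by rw [hPP, if_neg h], fun a => ?_,
    ?_⟩, ?_⟩
  · conv_rhs => rw [← hPs a]
    conv_lhs => rw [← hPs a, star_mul, star_star]
  · ext i j
    rw [← hX.2 i j, hsum i j, map_sum, Matrix.sum_apply]
    simp [MonoidAlgebra.counit_single]
  · ext1 i j
    exact hsum i j

end Spectral

/-! ### Orthogonality relations between spectral components -/

section TwistedOrth

variable {Γ : Type*} [CommGroup Γ] {m : ℕ} (Q : SpectralFamily Γ m)
variable {R : Type*} [Ring R] [Algebra ℂ R] [StarRing R] [StarModule ℂ R]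

theorem map_star_scalarMatrix (M : Matrix (Fin m) (Fin m) ℂ) :
    (scalarMatrix R M).map star = scalarMatrix R (conjC M) := by
  ext1 i j
  exact (algebraMap_star_comm _).symm

theorem star_scalarMatrix (M : Matrix (Fin m) (Fin m) ℂ) :
    star (scalarMatrix R M) = scalarMatrix R (star M) :=
  star_map_algebraMap M

theorem map_star_scalarMatrix_mul (M : Matrix (Fin m) (Fin m) ℂ) (u : Matrix (Fin m) (Fin m) R) :
    (scalarMatrix R M * u).map star = scalarMatrix R (conjC M) * u.map star := by
  ext1 i j
  simp only [Matrix.map_apply, Matrix.mul_apply, star_sum, star_mul, ← map_star_scalarMatrix]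
  refine Finset.sum_congr rfl fun k _ => ?_
  rw [scalarMatrix_apply, ← algebraMap_star_comm, Algebra.commutes]

theorem map_star_mul_scalarMatrix (M : Matrix (Fin m) (Fin m) ℂ) (u : Matrix (Fin m) (Fin m) R) :
    (u * scalarMatrix R M).map star = u.map star * scalarMatrix R (conjC M) := by
  ext1 i j
  simp only [Matrix.map_apply, Matrix.mul_apply, star_sum, star_mul, ← map_star_scalarMatrix]
  refine Finset.sum_congr rfl fun k _ => ?_
  rw [scalarMatrix_apply, ← algebraMap_star_comm, Algebra.commutes]

/-- The component of a matrix between the ranges of two projections. -/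
def SpectralFamily.comp (u : Matrix (Fin m) (Fin m) R) (a b : Γ) : Matrix (Fin m) (Fin m) R :=
  scalarMatrix R (Q.proj a) * u * scalarMatrix R (Q.proj b)

theorem SpectralFamily.comp_apply (u : Matrix (Fin m) (Fin m) R) (a b : Γ) (i j : Fin m) :
    Q.comp u a b i j = ∑ s, ∑ t, (Q.proj a i s * Q.proj b t j) • u s t := by
  simp only [comp, Matrix.mul_apply, scalarMatrix_apply, Finset.sum_mul]
  rw [Finset.sum_comm]
  refine Finset.sum_congr rfl fun s _ => Finset.sum_congr rfl fun t _ => ?_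
  rw [mul_assoc, ← Algebra.commutes, ← Algebra.smul_def, ← Algebra.smul_def, smul_smul]

theorem SpectralFamily.sum_comp (u : Matrix (Fin m) (Fin m) R) :
    ∑ a ∈ Q.supp, ∑ b ∈ Q.supp, Q.comp u a b = u := by
  simp only [comp]
  simp only [← Finset.mul_sum, ← Finset.sum_mul, ← map_sum, Q.sum_proj, map_one, one_mul, mul_one]

theorem SpectralFamily.comp_map_star (u : Matrix (Fin m) (Fin m) R) (a b : Γ) :
    (Q.comp u a b).map star = Q.conj.comp (u.map star) a b := by
  rw [comp, map_star_mul_scalarMatrix, map_star_scalarMatrix_mul]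
  rfl

/-- The matrix `u` is unitary, and its components satisfy a twisted orthogonality relation. -/
structure IsTwistedOrth (A : Matrix (Fin m) (Fin m) ℂ) (θ : Γ → Γ → ℂ)
    (u : Matrix (Fin m) (Fin m) R) : Prop where
  unitary : u ∈ unitary (Matrix (Fin m) (Fin m) R)
  comp_inv : ∀ a b, Q.comp u a⁻¹ b⁻¹ =
    θ a b • (scalarMatrix R A * (Q.comp u a b).map star * scalarMatrix R A⁻¹)

variable {Q} {A : Matrix (Fin m) (Fin m) ℂ} {θ : Γ → Γ → ℂ}

/-- The condition `A P̄_a = P_{a⁻¹} A`. -/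
def SpectralFamily.IsSymm (Q : SpectralFamily Γ m) (A : Matrix (Fin m) (Fin m) ℂ) : Prop :=
  ∀ a, A * Q.conj.proj a = Q.proj a⁻¹ * A

theorem SpectralFamily.IsSymm.inv_mul (hA : IsUnit A.det) (hQ : Q.IsSymm A) (a : Γ) :
    A⁻¹ * Q.proj a⁻¹ = Q.conj.proj a * A⁻¹ := by
  calc A⁻¹ * Q.proj a⁻¹ = A⁻¹ * (Q.proj a⁻¹ * A) * A⁻¹ := by
        rw [mul_assoc, mul_assoc, Matrix.mul_nonsing_inv _ hA, mul_one]
    _ = Q.conj.proj a * A⁻¹ := by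
        rw [← hQ, ← mul_assoc, Matrix.nonsing_inv_mul _ hA, one_mul]

/-- The relation `u = A V A⁻¹`, where `V` is the conjugate of `u` with components multiplied by
`θ`. -/
theorem isTwistedOrth_iff (hA : IsUnit A.det) (hQ : Q.IsSymm A) {u V : Matrix (Fin m) (Fin m) R}
    (hV : ∀ a b, Q.conj.comp V a b = θ a b • Q.conj.comp (u.map star) a b) :
    IsTwistedOrth Q A θ u ↔
      u ∈ unitary (Matrix (Fin m) (Fin m) R) ∧ u = conjBy A V := by
  have key : ∀ a b, Q.comp (conjBy A V) a⁻¹ b⁻¹ =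
      θ a b • (scalarMatrix R A * (Q.comp u a b).map star * scalarMatrix R A⁻¹) := fun a b => by
    rw [Q.comp_map_star, ← Matrix.smul_mul, ← Matrix.mul_smul, ← hV]
    change scalarMatrix R (Q.proj a⁻¹) * (scalarMatrix R A * V * scalarMatrix R A⁻¹) *
      scalarMatrix R (Q.proj b⁻¹) = scalarMatrix R A * (scalarMatrix R (Q.conj.proj a) * V *
        scalarMatrix R (Q.conj.proj b)) * scalarMatrix R A⁻¹
    have h1 : scalarMatrix R (Q.proj a⁻¹) * scalarMatrix R A =
        scalarMatrix R A * scalarMatrix R (Q.conj.proj a) := by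
      rw [← map_mul, ← map_mul, hQ]
    have h2 : scalarMatrix R A⁻¹ * scalarMatrix R (Q.proj b⁻¹) =
        scalarMatrix R (Q.conj.proj b) * scalarMatrix R A⁻¹ := by
      rw [← map_mul, ← map_mul, hQ.inv_mul hA]
    simp only [mul_assoc, h2]
    rw [← mul_assoc _ (scalarMatrix R A), h1]
    simp only [mul_assoc]
  refine ⟨fun h => ⟨h.unitary, Q.eq_of_forall_proj_mul_proj fun a b => ?_⟩, fun h => ⟨h.1, ?_⟩⟩
  · have := (h.comp_inv a⁻¹ b⁻¹).trans (key a⁻¹ b⁻¹).symm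
    rwa [inv_inv, inv_inv] at this
  · intro a b
    rw [← key, ← h.2]

variable {E S : Type*} [Ring E] [Algebra ℂ E] [StarRing E] [StarModule ℂ E]

/-- The matrix `(∑ a, P_a ⊗ l_a) (1 ⊗ u) (∑ b, P_b ⊗ r_b)`. -/
def SpectralFamily.twist (Q : SpectralFamily Γ m) (l r : Γ → E) (u : Matrix (Fin m) (Fin m) R) :
    Matrix (Fin m) (Fin m) (R ⊗[ℂ] E) :=
  (Q.expand l).map (Algebra.TensorProduct.includeRight : E →ₐ[ℂ] R ⊗[ℂ] E) *
    u.map (Algebra.TensorProduct.includeLeft : R →ₐ[ℂ] R ⊗[ℂ] E) *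
    (Q.expand r).map (Algebra.TensorProduct.includeRight : E →ₐ[ℂ] R ⊗[ℂ] E)

/-- P_a picks l_a out of ∑ P_c ⊗ l_c on the left, and P_b picks out r_b on the right. -/
theorem SpectralFamily.comp_twist (l r : Γ → E) (u : Matrix (Fin m) (Fin m) R) (a b : Γ) :
    Q.comp (Q.twist l r u) a b = (Q.comp u a b).map (· ⊗ₜ[ℂ] (l a * r b)) := by
  have h : Q.comp (Q.twist l r u) a b = (scalarMatrix _ (Q.proj a) *
    (Q.expand l).map (Algebra.TensorProduct.includeRight : E →ₐ[ℂ] R ⊗[ℂ] E)) *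
    u.map (Algebra.TensorProduct.includeLeft : R →ₐ[ℂ] R ⊗[ℂ] E) *
    ((Q.expand r).map (Algebra.TensorProduct.includeRight : E →ₐ[ℂ] R ⊗[ℂ] E) *
      scalarMatrix _ (Q.proj b)) := by
    simp only [comp, twist, mul_assoc]
  rw [h, map_expand, map_expand, proj_mul_expand, expand_mul_proj]
  ext1 i j
  rw [Matrix.map_apply, Q.comp_apply, TensorProduct.sum_tmul]
  simp only [Matrix.mul_apply, Matrix.map_apply, Finset.sum_mul]
  rw [Finset.sum_comm]
  refine Finset.sum_congr rfl fun s _ => ?_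
  rw [TensorProduct.sum_tmul]
  refine Finset.sum_congr rfl fun t _ => ?_
  simp [TensorProduct.smul_tmul', smul_smul, mul_comm]

theorem star_map_of_star_comm {f : R → S} [Ring S] [StarRing S] (hf : ∀ x, f (star x) = star (f x))
    (u : Matrix (Fin m) (Fin m) R) : star (u.map f) = (star u).map f := by
  ext1 i j
  simp [Matrix.star_apply, hf]

theorem map_mem_unitary [Ring S] [Algebra ℂ S] [StarRing S] (f : R →ₐ[ℂ] S)
    (hf : ∀ x, f (star x) = star (f x)) {u : Matrix (Fin m) (Fin m) R}
    (hu : u ∈ unitary (Matrix (Fin m) (Fin m) R)) : u.map f ∈ unitary (Matrix (Fin m) (Fin m) S) := by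
  rw [Unitary.mem_iff, star_map_of_star_comm hf, ← Matrix.map_mul, ← Matrix.map_mul,
    Unitary.star_mul_self_of_mem hu, Unitary.mul_star_self_of_mem hu]
  simp

/-- Up to the scalar s, taking the adjoint of l_a r_b inverts a and b, as the orthogonality relation
does; so that relation persists and s is absorbed into θ. Both comparison homomorphisms and the
coaction are instances. -/
theorem IsTwistedOrth.twist {u : Matrix (Fin m) (Fin m) R} (hu : IsTwistedOrth Q A θ u)
    {l r : Γ → E} {s θ' : Γ → Γ → ℂ} (hl : ∀ a, l a ∈ _root_.unitary E)
    (hr : ∀ a, r a ∈ _root_.unitary E)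
    (hs : ∀ a b, star (l a * r b) = s a b • (l a⁻¹ * r b⁻¹))
    (hθ : ∀ a b, θ' a b * s a b = θ a b) : IsTwistedOrth Q A θ' (Q.twist l r u) := by
  refine ⟨mul_mem (mul_mem ?_ ?_) ?_, fun a b => ?_⟩
  · exact map_mem_unitary _ (fun x => by simp) (Q.expand_mem_unitary hl)
  · exact map_mem_unitary _ (fun x => by simp) hu.unitary
  · exact map_mem_unitary _ (fun x => by simp) (Q.expand_mem_unitary hr)
  · rw [Q.comp_twist, Q.comp_twist, hu.comp_inv]
    ext1 i j
    simp only [Matrix.map_apply, Matrix.smul_apply, Matrix.mul_apply, scalarMatrix_apply,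
      TensorProduct.star_tmul, hs, ← hθ, Finset.sum_mul, TensorProduct.sum_tmul, Finset.smul_sum,
      TensorProduct.tmul_smul]
    refine Finset.sum_congr rfl fun p _ => Finset.sum_congr rfl fun q _ => ?_
    simp only [← Algebra.commutes, ← Algebra.smul_def, TensorProduct.smul_tmul', smul_smul]
    congr 2
    ring

theorem SpectralFamily.comp_sum_smul_comp (u : Matrix (Fin m) (Fin m) R) (a b : Γ) :
    Q.comp (∑ c ∈ Q.supp, ∑ d ∈ Q.supp, θ c d • Q.comp u c d) a b = θ a b • Q.comp u a b := by
  have h1 : ∀ c d, Q.comp (Q.comp u c d) a b =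
      scalarMatrix R (Q.proj a * Q.proj c) * u * scalarMatrix R (Q.proj d * Q.proj b) :=
    fun c d => by simp only [comp, map_mul, mul_assoc]
  have h2 : Q.comp (∑ c ∈ Q.supp, ∑ d ∈ Q.supp, θ c d • Q.comp u c d) a b =
      ∑ c ∈ Q.supp, ∑ d ∈ Q.supp, θ c d • Q.comp (Q.comp u c d) a b := by
    simp only [comp, Finset.mul_sum, Finset.sum_mul, Matrix.smul_mul, Matrix.mul_smul]
  rw [h2]
  simp only [h1]
  by_cases ha : a ∈ Q.supp
  · by_cases hb : b ∈ Q.supp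
    · rw [Finset.sum_eq_single_of_mem a ha, Finset.sum_eq_single_of_mem b hb, Q.proj_mul_self,
        Q.proj_mul_self]
      · rfl
      · intro d _ hd
        rw [Q.proj_mul_of_ne d b hd, map_zero, mul_zero, smul_zero]
      · intro c _ hc
        refine Finset.sum_eq_zero fun d _ => ?_
        rw [Q.proj_mul_of_ne a c hc.symm, map_zero, zero_mul, zero_mul, smul_zero]
    · simp [comp, Q.proj_eq_zero hb]
  · simp [comp, Q.proj_eq_zero ha]

/-- The twist in the relations of the braided quantum group. -/
def braidedTwist (β : Bichar Γ) (w a b : Γ) : ℂ := (β (a⁻¹ * b) (a * w) : ℂ)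

/-- The twist in the relations of the free orthogonal quantum group. -/
def orthTwist (β : Bichar Γ) (w a b : Γ) : ℂ := (β (a⁻¹ * b) w : ℂ)

variable (Q) in
/-- The corepresentation matrix `∑ a, P_a w a`. -/
def SpectralFamily.shift (w : Γ) : Matrix (Fin m) (Fin m) (MonoidAlgebra ℂ Γ) :=
  MonoidAlgebra.single w (1 : ℂ) • Q.toMatrix

theorem SpectralFamily.shift_eq (w : Γ) :
    Q.shift w = Q.expand fun a => MonoidAlgebra.single (w * a) (1 : ℂ) := by
  ext1 i j
  simp only [shift, toMatrix, Matrix.smul_apply, expand_apply, smul_eq_mul, Finset.mul_sum,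
    mul_smul_comm, MonoidAlgebra.single_mul_single, mul_one]

/-- With X = w ∑ P_a a, the product x_tj* x_sl contributes degrees b⁻¹a, in which w cancels, and
x_il* contributes (ew)⁻¹. The sum over l produces P_a P_e and forces e = a, which leaves the scalar
β(a⁻¹b, aw). -/
theorem conjMatrix_shift (β : Bichar Γ) (w : Γ) (u : Matrix (Fin m) (Fin m) R) :
    conjMatrix β (Q.shift w) u = ∑ a ∈ Q.conj.supp, ∑ b ∈ Q.conj.supp,
      braidedTwist β w a b • Q.conj.comp (u.map star) a b := by
  ext1 i j
  have h1 : ∀ s t l, β.lin (star (Q.shift w t j) * Q.shift w s l) (star (Q.shift w i l)) =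
      ∑ a ∈ Q.supp, ∑ b ∈ Q.supp, ∑ e ∈ Q.supp, (β (b⁻¹ * a) (e * w)⁻¹ : ℂ) *
        star (Q.proj b t j) * (Q.proj a s l * Q.proj e l i) := fun s t l => by
    have h3 : star (Q.shift w t j) * Q.shift w s l = ∑ a ∈ Q.supp, ∑ b ∈ Q.supp,
        MonoidAlgebra.single (b⁻¹ * a) (star (Q.proj b t j) * Q.proj a s l) := by
      simp only [SpectralFamily.shift_eq, SpectralFamily.expand_apply, star_sum, star_smul,
        Finset.sum_mul_sum, star_single, star_one, smul_mul_smul_comm,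
        MonoidAlgebra.single_mul_single, MonoidAlgebra.smul_single, mul_one, smul_eq_mul]
      rw [Finset.sum_comm]
      refine Finset.sum_congr rfl fun a _ => Finset.sum_congr rfl fun b _ => ?_
      congr 1
      rw [mul_inv_rev, mul_assoc, inv_mul_cancel_left]
    have h4 : star (Q.shift w i l) = ∑ e ∈ Q.supp,
        MonoidAlgebra.single (e * w)⁻¹ (Q.proj e l i) := by
      simp only [SpectralFamily.shift_eq, SpectralFamily.expand_apply, star_sum, star_smul,
        star_single, star_one, MonoidAlgebra.smul_single, mul_one, smul_eq_mul, Q.proj_apply_star,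
        mul_comm w]
    rw [h3, h4]
    simp only [map_sum, LinearMap.sum_apply, Bichar.lin_single]
    rw [Finset.sum_comm]
    refine Finset.sum_congr rfl fun a _ => ?_
    rw [Finset.sum_comm]
    refine Finset.sum_congr rfl fun b _ => Finset.sum_congr rfl fun e _ => ?_
    ring
  have h2 : ∀ s t, ∑ l, β.lin (star (Q.shift w t j) * Q.shift w s l) (star (Q.shift w i l)) =
      ∑ a ∈ Q.supp, ∑ b ∈ Q.supp,
        (β (b⁻¹ * a) (a * w)⁻¹ : ℂ) * star (Q.proj b t j) * Q.proj a s i := fun s t => by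
    simp only [h1]
    rw [Finset.sum_comm]
    refine Finset.sum_congr rfl fun a ha => ?_
    rw [Finset.sum_comm]
    refine Finset.sum_congr rfl fun b _ => ?_
    rw [Finset.sum_comm, Finset.sum_eq_single_of_mem a ha]
    · rw [← Finset.mul_sum, ← Matrix.mul_apply, Q.proj_mul_self]
    · intro e _ he
      rw [← Finset.mul_sum, ← Matrix.mul_apply, Q.proj_mul_of_ne a e he.symm, Matrix.zero_apply,
        mul_zero]
  have h5 : conjMatrix β (Q.shift w) u i j =
      ∑ s, ∑ t, (∑ l, β.lin (star (Q.shift w t j) * Q.shift w s l) (star (Q.shift w i l))) •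
        star (u s t) := by
    rw [conjMatrix, Matrix.of_apply]
    refine Finset.sum_congr rfl fun s _ => ?_
    rw [Finset.sum_comm]
    simp only [Finset.sum_smul]
  rw [h5]
  simp only [h2, Matrix.sum_apply, Matrix.smul_apply, SpectralFamily.comp_apply, Finset.sum_smul,
    Finset.smul_sum]
  rw [Finset.sum_congr rfl fun s _ => Finset.sum_comm, Finset.sum_comm]
  refine Finset.sum_congr rfl fun a _ => ?_
  rw [Finset.sum_congr rfl fun s _ => Finset.sum_comm, Finset.sum_comm]
  refine Finset.sum_congr rfl fun b _ => Finset.sum_congr rfl fun s _ =>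
    Finset.sum_congr rfl fun t _ => ?_
  rw [Matrix.map_apply, smul_smul, ← Q.proj_apply_star a i s]
  congr 1
  have h6 : β (b⁻¹ * a) (a * w)⁻¹ = β (a⁻¹ * b) (a * w) := by
    rw [map_inv, ← MonoidHom.inv_apply, ← map_inv, mul_inv_rev, inv_inv]
  rw [h6]
  change _ = braidedTwist β w a b * (star (Q.proj a i s) * star (Q.proj b t j))
  rw [braidedTwist]
  ring

theorem isTwistedOrth_iff_braided (hA : IsUnit A.det) (hQ : Q.IsSymm A) {β : Bichar Γ} {w : Γ}
    {u : Matrix (Fin m) (Fin m) R} : IsTwistedOrth Q A (braidedTwist β w) u ↔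
      u ∈ unitary (Matrix (Fin m) (Fin m) R) ∧ u = conjBy A (conjMatrix β (Q.shift w) u) :=
  isTwistedOrth_iff hA hQ fun a b => by
    rw [conjMatrix_shift, SpectralFamily.comp_sum_smul_comp]

theorem charMatrix_shift (β : Bichar Γ) (w : Γ) : charMatrix (Q.shift w) w β =
    Q.conj.expand (fun a => (β (w * a)⁻¹ w : ℂ)) := by
  ext1 i j
  simp only [charMatrix, Matrix.of_apply, SpectralFamily.shift_eq, SpectralFamily.expand_apply,
    star_sum, star_smul, star_single, star_one, map_sum, map_smul, LinearMap.sum_apply,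
    LinearMap.smul_apply, Bichar.lin_single, one_mul, smul_eq_mul]
  rfl

theorem charMatrix_shift_mul (β : Bichar Γ) (w : Γ) :
    charMatrix (Q.shift w) w β * Q.conj.expand (fun a => (β (w * a) w : ℂ)) = 1 := by
  rw [charMatrix_shift, SpectralFamily.expand_mul, ← Q.conj.expand_one]
  congr 1
  ext1 a
  simp only [Pi.mul_apply, ← Circle.coe_mul, ← MonoidHom.mul_apply, ← map_mul]
  simp

theorem scalarMatrix_complex (M : Matrix (Fin m) (Fin m) ℂ) : scalarMatrix ℂ M = M := by
  ext1 i j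
  rfl

/-- C acts on the range of P̄_a as the scalar β((wa)⁻¹, w). Conjugation by C thus multiplies the
component (a, b) by β((wa)⁻¹, w) β(wb, w) = β(a⁻¹b, w). -/
theorem isTwistedOrth_iff_orth (hA : IsUnit A.det) (hQ : Q.IsSymm A) {β : Bichar Γ} {w : Γ}
    {u : Matrix (Fin m) (Fin m) R} : IsTwistedOrth Q A (orthTwist β w) u ↔
      u ∈ unitary (Matrix (Fin m) (Fin m) R) ∧
        u = conjBy (A * charMatrix (Q.shift w) w β) (u.map star) := by
  set C := charMatrix (Q.shift w) w β with hC
  have hinv : C⁻¹ = Q.conj.expand (fun a => (β (w * a) w : ℂ)) :=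
    Matrix.inv_eq_right_inv (charMatrix_shift_mul β w)
  have h1 : conjBy (A * C) (u.map star) = conjBy A (conjBy C (u.map star)) := by
    change scalarMatrix R (A * C) * u.map star * scalarMatrix R (A * C)⁻¹ =
      scalarMatrix R A * (scalarMatrix R C * u.map star * scalarMatrix R C⁻¹) * scalarMatrix R A⁻¹
    rw [Matrix.mul_inv_rev]
    simp only [map_mul, mul_assoc]
  rw [h1]
  refine isTwistedOrth_iff hA hQ fun a b => ?_
  have h2 : Q.conj.proj a * C = (β (w * a)⁻¹ w : ℂ) • Q.conj.proj a := by
    have := Q.conj.proj_mul_expand a (fun a => (β (w * a)⁻¹ w : ℂ))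
    rw [scalarMatrix_complex, ← charMatrix_shift] at this
    rw [this]
    ext1 i j
    simp [mul_comm]
  have h3 : C⁻¹ * Q.conj.proj b = (β (w * b) w : ℂ) • Q.conj.proj b := by
    have := Q.conj.expand_mul_proj b (fun a => (β (w * a) w : ℂ))
    rw [scalarMatrix_complex, ← hinv] at this
    rw [this]
    ext1 i j
    simp [mul_comm]
  have h4 : Q.conj.comp (conjBy C (u.map star)) a b =
      scalarMatrix R (Q.conj.proj a * C) * u.map star * scalarMatrix R (C⁻¹ * Q.conj.proj b) := by
    change scalarMatrix R (Q.conj.proj a) * (scalarMatrix R C * u.map star * scalarMatrix R C⁻¹) *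
      scalarMatrix R (Q.conj.proj b) = _
    simp only [map_mul, mul_assoc]
  have h5 : ∀ (c : ℂ) (M : Matrix (Fin m) (Fin m) ℂ),
      scalarMatrix R (c • M) = c • scalarMatrix R M := fun c M => by
    ext1 i j
    rw [scalarMatrix_apply, Matrix.smul_apply, Matrix.smul_apply, smul_eq_mul, map_mul,
      Algebra.smul_def]
    rfl
  rw [h4, h2, h3, h5, h5, Matrix.smul_mul, Matrix.smul_mul, Matrix.mul_smul, smul_smul,
    SpectralFamily.comp]
  congr 1
  rw [← Circle.coe_mul, ← MonoidHom.mul_apply, ← map_mul, orthTwist]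
  congr 3
  rw [mul_inv_rev, mul_assoc, inv_mul_cancel_left]

theorem coefLin_toMatrix (a : Γ) (i j : Fin m) : coefLin a (Q.toMatrix i j) = Q.proj a i j := by
  classical
  simp only [SpectralFamily.toMatrix, SpectralFamily.expand_apply, map_sum, map_smul,
    coefLin_single, smul_eq_mul, mul_ite, mul_one, mul_zero]
  rw [Finset.sum_ite_eq]
  split_ifs with h
  · rfl
  · rw [Q.proj_eq_zero h, Matrix.zero_apply]

/-- The entries of `ū` are linear combinations of the entries of `u`. -/
theorem IsTwistedOrth.star_mem_span (hA : IsUnit A.det) (hθ : ∀ a b, θ a b ≠ 0)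
    {u : Matrix (Fin m) (Fin m) R} (hu : IsTwistedOrth Q A θ u) (i j : Fin m) :
    star (u i j) ∈ Submodule.span ℂ {x : R | ∃ i j, u i j = x} := by
  set N := Submodule.span ℂ {x : R | ∃ i j, u i j = x}
  have hmul : ∀ (M : Matrix (Fin m) (Fin m) ℂ) (v : Matrix (Fin m) (Fin m) R),
      (∀ i j, v i j ∈ N) → ∀ i j, (scalarMatrix R M * v) i j ∈ N := fun M v hv i j => by
    rw [Matrix.mul_apply]
    refine N.sum_mem fun k _ => ?_
    rw [scalarMatrix_apply, ← Algebra.smul_def]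
    exact N.smul_mem _ (hv _ _)
  have hmul' : ∀ (M : Matrix (Fin m) (Fin m) ℂ) (v : Matrix (Fin m) (Fin m) R),
      (∀ i j, v i j ∈ N) → ∀ i j, (v * scalarMatrix R M) i j ∈ N := fun M v hv i j => by
    rw [Matrix.mul_apply]
    refine N.sum_mem fun k _ => ?_
    rw [scalarMatrix_apply, ← Algebra.commutes, ← Algebra.smul_def]
    exact N.smul_mem _ (hv _ _)
  have h1 : ∀ a b i j, (Q.comp u a b).map star i j ∈ N := fun a b i j => by
    have h2 : (Q.comp u a b).map star = (θ a b)⁻¹ •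
        (scalarMatrix R A⁻¹ * Q.comp u a⁻¹ b⁻¹ * scalarMatrix R A) := by
      have hA1 : scalarMatrix R A⁻¹ * scalarMatrix R A = 1 := by
        rw [← map_mul, Matrix.nonsing_inv_mul _ hA, map_one]
      rw [hu.comp_inv, Matrix.mul_smul, Matrix.smul_mul, smul_smul, inv_mul_cancel₀ (hθ a b),
        one_smul]
      simp only [mul_assoc, hA1, mul_one]
      rw [← mul_assoc, hA1, one_mul]
    rw [h2]
    refine N.smul_mem _ (hmul' _ _ (hmul _ _ (hmul' _ _ (hmul _ _ ?_))) i j)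
    exact fun i j => Submodule.subset_span ⟨i, j, rfl⟩
  have h3 : star (u i j) = ∑ a ∈ Q.supp, ∑ b ∈ Q.supp, (Q.comp u a b).map star i j := by
    conv_lhs => rw [← Q.sum_comp u]
    simp only [Matrix.sum_apply, star_sum, Matrix.map_apply]
  rw [h3]
  exact N.sum_mem fun a _ => N.sum_mem fun b _ => h1 a b i j

/-- The projections are those of w⁻¹X = ∑ P_a a. Removing w from the conjugation relation gives A(∑
P̄_a a⁻¹) = (∑ P_a a)A, and coefficients can be compared. -/
theorem IsAdmissible.exists_spectralFamily {τ : ℂ} {X : Matrix (Fin m) (Fin m) (MonoidAlgebra ℂ Γ)}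
    {w : Γ} {β : Bichar Γ} (hA : IsUnit A.det) (h : IsAdmissible A τ X w β) :
    ∃ Q : SpectralFamily Γ m, X = Q.shift w ∧ Q.IsSymm A := by
  obtain ⟨Q, hQ⟩ := BraidedQG.exists_spectralFamily (h.corep.single_smul w⁻¹)
    (single_smul_mem_unitary h.unitary w⁻¹)
  have hX : X = Q.shift w := by
    rw [SpectralFamily.shift, ← hQ, smul_smul, MonoidAlgebra.single_mul_single, mul_inv_cancel,
      mul_one, ← MonoidAlgebra.one_def, one_smul]
  refine ⟨Q, hX, fun a => ?_⟩
  set ι := scalarMatrix (m := m) (MonoidAlgebra ℂ Γ)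
  have h1 : ι A * (MonoidAlgebra.single (w ^ 2) (1 : ℂ) • X.map star) = X * ι A := by
    have h2 : X = ι A * (MonoidAlgebra.single (w ^ 2) (1 : ℂ) • X.map star) * ι A⁻¹ :=
      h.conj_eq.symm
    conv_rhs => rw [h2]
    rw [mul_assoc, ← map_mul, Matrix.nonsing_inv_mul _ hA, map_one, mul_one]
  have h2 : MonoidAlgebra.single (w ^ 2) (1 : ℂ) • X.map star =
      MonoidAlgebra.single w (1 : ℂ) • Q.toMatrix.map star := by
    rw [hX]
    ext1 i j
    simp only [SpectralFamily.shift, Matrix.smul_apply, Matrix.map_apply, smul_eq_mul, star_mul',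
      star_single, ← mul_assoc, MonoidAlgebra.single_mul_single, star_one, mul_one]
    rw [sq, mul_inv_cancel_right]
  have h3 : ι A * Q.toMatrix.map star = Q.toMatrix * ι A := by
    rw [h2, hX, SpectralFamily.shift, Matrix.mul_smul, Matrix.smul_mul] at h1
    have := congrArg (fun M => MonoidAlgebra.single w⁻¹ (1 : ℂ) • M) h1
    simpa only [smul_smul, MonoidAlgebra.single_mul_single, inv_mul_cancel, mul_one,
      ← MonoidAlgebra.one_def, one_smul] using this
  ext i j
  -- The coefficient of a⁻¹ on the left belongs to P̄_a, on the right to P_{a⁻¹}.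
  have h4 := congrArg (fun M : Matrix (Fin m) (Fin m) (MonoidAlgebra ℂ Γ) => coefLin a⁻¹ (M i j)) h3
  simp only [Matrix.mul_apply, Matrix.map_apply, map_sum, ι, scalarMatrix_apply, ← Algebra.commutes,
    ← Algebra.smul_def, map_smul, coefLin_star, coefLin_toMatrix, smul_eq_mul] at h4
  rw [Matrix.mul_apply, Matrix.mul_apply]
  refine h4.trans (Finset.sum_congr rfl fun k _ => ?_)
  exact mul_comm _ _

end TwistedOrth

/-! ### Homomorphisms out of the universal algebras -/

section Universal

variable {m : ℕ}

/-- The quotient map as a `*`-homomorphism. -/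
def UnivStarAlg.mkStar {ι : Type} (r : FreeStarAlg ι → FreeStarAlg ι → Prop) :
    FreeStarAlg ι →⋆ₐ[ℂ] UnivStarAlg r :=
  { UnivStarAlg.mk r with map_star' := UnivStarAlg.mk_star r }

theorem UnivStarAlg.mkStar_eq_of_rel {ι : Type} {r : FreeStarAlg ι → FreeStarAlg ι → Prop}
    {a b : FreeStarAlg ι} (h : r a b) : UnivStarAlg.mkStar r a = UnivStarAlg.mkStar r b :=
  RingQuot.mkAlgHom_rel ℂ (Or.inl h)

theorem UnivStarAlg.subalgebra_eq_top {ι : Type} {r : FreeStarAlg ι → FreeStarAlg ι → Prop}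
    (S : Subalgebra ℂ (UnivStarAlg r)) (h : ∀ i, UnivStarAlg.gen r i ∈ S)
    (h' : ∀ i, star (UnivStarAlg.gen r i) ∈ S) : S = ⊤ := by
  rw [eq_top_iff]
  rintro x -
  obtain ⟨y, rfl⟩ := UnivStarAlg.mk_surjective r x
  refine FreeAlgebra.induction (R := ℂ) (X := ι ⊕ ι)
    (motive := fun y => UnivStarAlg.mk r (y : FreeStarAlg ι) ∈ S) ?_ ?_ ?_ ?_ y
  · intro c
    have h2 : UnivStarAlg.mk r (algebraMap ℂ (FreeStarAlg ι) c) ∈ S := by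
      rw [AlgHom.commutes]
      exact S.algebraMap_mem c
    exact h2
  · rintro (i | i)
    · exact h i
    · have e : (FreeAlgebra.ι ℂ (Sum.inr i) : FreeAlgebra ℂ (ι ⊕ ι)) =
          (star (FreeStarAlg.gen i) : FreeStarAlg ι) :=
        (FreeStarAlg.starFun_ι (Sum.inl i)).symm
      have h2 := h' i
      rw [UnivStarAlg.gen, ← UnivStarAlg.mk_star, ← e] at h2
      exact h2
  · intro a b ha hb
    have h2 : ∀ a b : FreeStarAlg ι, UnivStarAlg.mk r a ∈ S → UnivStarAlg.mk r b ∈ S →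
        UnivStarAlg.mk r (a * b) ∈ S := fun a b ha hb => by
      rw [map_mul]
      exact S.mul_mem ha hb
    exact h2 a b ha hb
  · intro a b ha hb
    have h2 : ∀ a b : FreeStarAlg ι, UnivStarAlg.mk r a ∈ S → UnivStarAlg.mk r b ∈ S →
        UnivStarAlg.mk r (a + b) ∈ S := fun a b ha hb => by
      rw [map_add]
      exact S.add_mem ha hb
    exact h2 a b ha hb

/-- The matrix of generators of a universal `*`-algebra. -/
def genMatrix (r : FreeStarAlg (Fin m × Fin m) → FreeStarAlg (Fin m × Fin m) → Prop) :
    Matrix (Fin m) (Fin m) (UnivStarAlg r) :=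
  Matrix.of fun i j => UnivStarAlg.gen r (i, j)

variable {F : Matrix (Fin m) (Fin m) ℂ} {V : Matrix (Fin m) (Fin m) (FreeStarAlg (Fin m × Fin m))}
variable {R S : Type*} [Ring R] [Algebra ℂ R] [StarRing R] [StarModule ℂ R]
variable [Ring S] [Algebra ℂ S] [StarRing S] [StarModule ℂ S]

theorem map_conjBy (φ : R →⋆ₐ[ℂ] S) (v : Matrix (Fin m) (Fin m) R) :
    (conjBy F v).map φ = conjBy F (v.map φ) := by
  have h : ∀ M : Matrix (Fin m) (Fin m) ℂ, (M.map (algebraMap ℂ R)).map φ =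
      M.map (algebraMap ℂ S) := fun M => by
    ext1 i j
    exact AlgHomClass.commutes φ _
  rw [conjBy, Matrix.map_mul, Matrix.map_mul, h, h]
  rfl

theorem genMatrix_mem_unitary :
    genMatrix (OrthRel F V) ∈ unitary (Matrix (Fin m) (Fin m) (UnivStarAlg (OrthRel F V))) := by
  set r := OrthRel F V
  have h : genMatrix r = (freeMatrix m).map (UnivStarAlg.mkStar r) := rfl
  have hs : star (genMatrix r) = (star (freeMatrix m)).map (UnivStarAlg.mkStar r) := by
    rw [h, star_map_of_star_comm fun x => map_star _ x]
  have h1 : (1 : Matrix (Fin m) (Fin m) (FreeStarAlg (Fin m × Fin m))).map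
      (UnivStarAlg.mkStar r) = 1 := Matrix.map_one _ (map_zero _) (map_one _)
  rw [Unitary.mem_iff, hs, h, ← Matrix.map_mul, ← Matrix.map_mul, ← h1]
  constructor <;> ext1 i j
  · exact UnivStarAlg.mkStar_eq_of_rel (.star_mul i j)
  · exact UnivStarAlg.mkStar_eq_of_rel (.mul_star i j)

theorem genMatrix_eq_conjBy :
    genMatrix (OrthRel F V) = conjBy F (V.map (UnivStarAlg.mkStar (OrthRel F V))) := by
  rw [← map_conjBy]
  ext1 i j
  exact UnivStarAlg.mkStar_eq_of_rel (.orth i j)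

/-- The matrix V lives over the free *-algebra, and its image makes sense only after the generators
have been sent to p; hence the quantification over φ, which covers v̄ and Ū_X alike. -/
theorem exists_hom_of_orthRel {p : Matrix (Fin m) (Fin m) R}
    (hp : p ∈ unitary (Matrix (Fin m) (Fin m) R))
    (hV : ∀ φ : FreeStarAlg (Fin m × Fin m) →⋆ₐ[ℂ] R, (freeMatrix m).map φ = p →
      p = conjBy F (V.map φ)) :
    ∃ ψ : UnivStarAlg (OrthRel F V) →⋆ₐ[ℂ] R, ∀ i j, ψ (genMatrix (OrthRel F V) i j) = p i j := by
  obtain ⟨φ, hφ, -⟩ := FreeStarAlg.existsUnique_lift (fun x : Fin m × Fin m => p x.1 x.2)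
  have h : (freeMatrix m).map φ = p := by
    ext1 i j
    exact hφ (i, j)
  have hs : (star (freeMatrix m)).map φ = star p := by
    rw [← star_map_of_star_comm fun x => map_star _ x, h]
  have h1 : (1 : Matrix (Fin m) (Fin m) (FreeStarAlg (Fin m × Fin m))).map φ = 1 :=
    Matrix.map_one _ (map_zero _) (map_one _)
  obtain ⟨ψ, hψ, -⟩ := UnivStarAlg.existsUnique_lift (OrthRel F V)
    (fun x : Fin m × Fin m => p x.1 x.2) φ hφ (by
      rintro a b (⟨i, j⟩ | ⟨i, j⟩ | ⟨i, j⟩)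
      · rw [← Matrix.map_apply (f := φ), ← Matrix.map_apply (f := φ), Matrix.map_mul, h, hs, h1,
          Unitary.mul_star_self_of_mem hp]
      · rw [← Matrix.map_apply (f := φ), ← Matrix.map_apply (f := φ), Matrix.map_mul, h, hs, h1,
          Unitary.star_mul_self_of_mem hp]
      · rw [← Matrix.map_apply (f := φ), ← Matrix.map_apply (f := φ), map_conjBy, h]
        exact congrFun (congrFun (hV φ h) i) j)
  exact ⟨ψ, fun i j => hψ (i, j)⟩

theorem map_conjMatrix {Γ : Type*} [CommGroup Γ] (β : Bichar Γ)
    (X : Matrix (Fin m) (Fin m) (MonoidAlgebra ℂ Γ)) (φ : R →⋆ₐ[ℂ] S)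
    (v : Matrix (Fin m) (Fin m) R) : (conjMatrix β X v).map φ = conjMatrix β X (v.map φ) := by
  ext1 i j
  simp only [conjMatrix, Matrix.map_apply, Matrix.of_apply, map_sum, map_smul, map_star]

section

variable {Γ : Type*} [CommGroup Γ] {Q : SpectralFamily Γ m} {A : Matrix (Fin m) (Fin m) ℂ}
variable (hA : IsUnit A.det) (hQ : Q.IsSymm A) {β : Bichar Γ} {w : Γ}

include hA hQ

theorem BraidedFreeOrth.isTwistedOrth_fund :
    IsTwistedOrth Q A (braidedTwist β w) (BraidedFreeOrth.fund A (Q.shift w) β) := by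
  refine (isTwistedOrth_iff_braided hA hQ).2 ⟨genMatrix_mem_unitary, ?_⟩
  refine genMatrix_eq_conjBy.trans ?_
  rw [map_conjMatrix]
  rfl

theorem BraidedFreeOrth.exists_hom {p : Matrix (Fin m) (Fin m) R}
    (hp : IsTwistedOrth Q A (braidedTwist β w) p) :
    ∃ ψ : BraidedFreeOrth A (Q.shift w) β →⋆ₐ[ℂ] R,
      ∀ i j, ψ (BraidedFreeOrth.fund A (Q.shift w) β i j) = p i j := by
  rw [isTwistedOrth_iff_braided hA hQ] at hp
  refine exists_hom_of_orthRel hp.1 fun φ hφ => ?_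
  rw [map_conjMatrix, hφ]
  exact hp.2

theorem FreeOrth.isTwistedOrth_fund : IsTwistedOrth Q A (orthTwist β w)
    (FreeOrth.fund (A * charMatrix (Q.shift w) w β)) := by
  refine (isTwistedOrth_iff_orth hA hQ).2 ⟨genMatrix_mem_unitary, ?_⟩
  refine genMatrix_eq_conjBy.trans (congrArg _ ?_)
  ext1 i j
  exact map_star (UnivStarAlg.mkStar _) _

theorem FreeOrth.exists_hom {p : Matrix (Fin m) (Fin m) R}
    (hp : IsTwistedOrth Q A (orthTwist β w) p) :
    ∃ ψ : FreeOrth (A * charMatrix (Q.shift w) w β) →⋆ₐ[ℂ] R,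
      ∀ i j, ψ (FreeOrth.fund (A * charMatrix (Q.shift w) w β) i j) = p i j := by
  rw [isTwistedOrth_iff_orth hA hQ] at hp
  refine exists_hom_of_orthRel hp.1 fun φ hφ => ?_
  have h : ((freeMatrix m).map star).map φ = p.map star := by
    rw [← hφ]
    ext1 i j
    exact map_star φ _
  rw [h]
  exact hp.2

/-- The orthogonality relation expresses every u_ij* linearly through the entries of u, so no
adjoints are needed among the generators. -/
theorem BraidedFreeOrth.adjoin_eq_top :
    Algebra.adjoin ℂ {x | ∃ i j, BraidedFreeOrth.fund A (Q.shift w) β i j = x} = ⊤ := by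
  refine UnivStarAlg.subalgebra_eq_top _ (fun p => Algebra.subset_adjoin ⟨p.1, p.2, rfl⟩) fun p => ?_
  exact Algebra.span_le_adjoin ℂ _ ((BraidedFreeOrth.isTwistedOrth_fund hA hQ).star_mem_span hA
    (fun a b => Circle.coe_ne_zero _) p.1 p.2)

end

end Universal

/-! ### The Hopf *-algebra of the free orthogonal quantum group -/

section FreeOrth

variable {m : ℕ}

section ConjBy

variable {R : Type*} [Ring R] [Algebra ℂ R] {F G : Matrix (Fin m) (Fin m) ℂ}

theorem conjBy_eq (F : Matrix (Fin m) (Fin m) ℂ) (v : Matrix (Fin m) (Fin m) R) :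
    conjBy F v = scalarMatrix R F * v * scalarMatrix R F⁻¹ := rfl

theorem scalarMatrix_mul_inv (hF : IsUnit F.det) : scalarMatrix R F * scalarMatrix R F⁻¹ = 1 := by
  rw [← map_mul, Matrix.mul_nonsing_inv _ hF, map_one]

theorem scalarMatrix_inv_mul (hF : IsUnit F.det) : scalarMatrix R F⁻¹ * scalarMatrix R F = 1 := by
  rw [← map_mul, Matrix.nonsing_inv_mul _ hF, map_one]

theorem conjBy_one (hF : IsUnit F.det) : conjBy F (1 : Matrix (Fin m) (Fin m) R) = 1 := by
  rw [conjBy_eq, mul_one, scalarMatrix_mul_inv hF]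

theorem conjBy_mul (hF : IsUnit F.det) (v v' : Matrix (Fin m) (Fin m) R) :
    conjBy F (v * v') = conjBy F v * conjBy F v' := by
  simp only [conjBy_eq]
  calc scalarMatrix R F * (v * v') * scalarMatrix R F⁻¹
      = scalarMatrix R F * v * 1 * v' * scalarMatrix R F⁻¹ := by simp only [mul_assoc, mul_one]
    _ = _ := by rw [← scalarMatrix_inv_mul hF]; simp only [mul_assoc]

theorem conjBy_conjBy (v : Matrix (Fin m) (Fin m) R) :
    conjBy F (conjBy G v) = conjBy (F * G) v := by
  simp only [conjBy_eq, Matrix.mul_inv_rev, map_mul, mul_assoc]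

theorem conjBy_one_left (v : Matrix (Fin m) (Fin m) R) : conjBy 1 v = v := by
  simp [conjBy_eq]

theorem conjBy_inv_conjBy (hF : IsUnit F.det) (v : Matrix (Fin m) (Fin m) R) :
    conjBy F⁻¹ (conjBy F v) = v := by
  rw [conjBy_conjBy, Matrix.nonsing_inv_mul _ hF, conjBy_one_left]

theorem conjBy_conjBy_inv (hF : IsUnit F.det) (v : Matrix (Fin m) (Fin m) R) :
    conjBy F (conjBy F⁻¹ v) = v := by
  rw [conjBy_conjBy, Matrix.mul_nonsing_inv _ hF, conjBy_one_left]

theorem conjBy_apply (v : Matrix (Fin m) (Fin m) R) (i j : Fin m) :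
    conjBy F v i j = ∑ s, ∑ t, (F i s * F⁻¹ t j) • v s t := by
  simp only [conjBy_eq, Matrix.mul_apply, scalarMatrix_apply, Finset.sum_mul]
  rw [Finset.sum_comm]
  refine Finset.sum_congr rfl fun s _ => Finset.sum_congr rfl fun t _ => ?_
  rw [mul_assoc, ← Algebra.commutes, ← Algebra.smul_def, ← Algebra.smul_def, smul_smul]

theorem conjBy_smul_left {c : ℂ} (hc : c ≠ 0) (hF : IsUnit F.det) (v : Matrix (Fin m) (Fin m) R) :
    conjBy (c • F) v = conjBy F v := by
  have h : (c • F)⁻¹ = c⁻¹ • F⁻¹ := Matrix.inv_eq_right_inv (by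
    rw [Matrix.smul_mul, Matrix.mul_smul, smul_smul, mul_inv_cancel₀ hc, one_smul,
      Matrix.mul_nonsing_inv _ hF])
  ext1 i j
  simp only [conjBy_apply, h, Matrix.smul_apply, smul_eq_mul]
  refine Finset.sum_congr rfl fun s _ => Finset.sum_congr rfl fun t _ => ?_
  congr 1
  field_simp

theorem conjBy_map {S F' : Type*} [Ring S] [Algebra ℂ S] [FunLike F' R S] [LinearMapClass F' ℂ R S]
    (f : F') (v : Matrix (Fin m) (Fin m) R) : (conjBy F v).map f = conjBy F (v.map f) := by
  ext1 i j
  simp only [Matrix.map_apply, conjBy_apply, map_sum, map_smul]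

theorem inv_map_star (hF : IsUnit F.det) : (F.map star)⁻¹ = F⁻¹.map star := by
  refine Matrix.inv_eq_right_inv ?_
  have h := congrArg (fun M : Matrix (Fin m) (Fin m) ℂ => conjC M) (Matrix.mul_nonsing_inv _ hF)
  rw [map_mul, map_one] at h
  exact h

end ConjBy

variable {F : Matrix (Fin m) (Fin m) ℂ}

theorem FreeOrth.fund_mem_unitary :
    FreeOrth.fund F ∈ unitary (Matrix (Fin m) (Fin m) (FreeOrth F)) :=
  genMatrix_mem_unitary

theorem FreeOrth.fund_eq_conjBy : FreeOrth.fund F = conjBy F ((FreeOrth.fund F).map star) := by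
  refine genMatrix_eq_conjBy.trans (congrArg _ ?_)
  ext1 i j
  exact map_star (UnivStarAlg.mkStar _) _

theorem FreeOrth.fund_map_star (hF : IsUnit F.det) :
    (FreeOrth.fund F).map star = conjBy F⁻¹ (FreeOrth.fund F) := by
  conv_rhs => rw [FreeOrth.fund_eq_conjBy, conjBy_inv_conjBy hF]

theorem FreeOrth.adjoin_eq_top (hF : IsUnit F.det) :
    Algebra.adjoin ℂ {x | ∃ i j, FreeOrth.fund F i j = x} = ⊤ := by
  have hmem : ∀ s t, FreeOrth.fund F s t ∈
      Algebra.adjoin ℂ {x | ∃ i j, FreeOrth.fund F i j = x} :=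
    fun s t => Algebra.subset_adjoin ⟨s, t, rfl⟩
  refine UnivStarAlg.subalgebra_eq_top _ (fun p => hmem p.1 p.2) fun p => ?_
  have h : star (FreeOrth.fund F p.1 p.2) = conjBy F⁻¹ (FreeOrth.fund F) p.1 p.2 := by
    rw [← FreeOrth.fund_map_star hF, Matrix.map_apply]
  change star (FreeOrth.fund F p.1 p.2) ∈ _
  rw [h, conjBy_apply]
  exact Subalgebra.sum_mem _ fun s _ => Subalgebra.sum_mem _ fun t _ =>
    Subalgebra.smul_mem _ (hmem s t) _

theorem FreeOrth.algHom_ext (hF : IsUnit F.det) {S : Type*} [Semiring S] [Algebra ℂ S]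
    {f g : FreeOrth F →ₐ[ℂ] S} (h : ∀ i j, f (FreeOrth.fund F i j) = g (FreeOrth.fund F i j)) :
    f = g :=
  AlgHom.ext_of_adjoin_eq_top (FreeOrth.adjoin_eq_top hF) (by
    rintro x ⟨i, j, rfl⟩
    exact h i j)

theorem FreeOrth.exists_starHom {R : Type*} [Ring R] [Algebra ℂ R] [StarRing R] [StarModule ℂ R]
    {p : Matrix (Fin m) (Fin m) R} (hp : p ∈ unitary (Matrix (Fin m) (Fin m) R))
    (hF : p = conjBy F (p.map star)) :
    ∃ ψ : FreeOrth F →⋆ₐ[ℂ] R, ∀ i j, ψ (FreeOrth.fund F i j) = p i j := by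
  refine exists_hom_of_orthRel hp fun φ hφ => ?_
  have h : ((freeMatrix m).map star).map φ = p.map star := by
    rw [← hφ]
    ext1 i j
    exact map_star φ _
  rwa [h]

/-- This serves to build the antipode, which need not commute with the involution. The images p of v
and q of v̄ are therefore independent data, and `h₄` is needed for the adjoint of the relation v = F
v̄ F⁻¹. -/
theorem FreeOrth.exists_algHom (hF : IsUnit F.det) {S : Type*} [Ring S] [Algebra ℂ S]
    {p q : Matrix (Fin m) (Fin m) S} (h₁ : p * q.transpose = 1) (h₂ : q.transpose * p = 1)
    (h₃ : p = conjBy F q) (h₄ : q = conjBy (F.map star) p) :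
    ∃ ψ : FreeOrth F →ₐ[ℂ] S, (∀ i j, ψ (FreeOrth.fund F i j) = p i j) ∧
      ∀ i j, ψ (star (FreeOrth.fund F i j)) = q i j := by
  let φ : FreeStarAlg (Fin m × Fin m) →ₐ[ℂ] S :=
    FreeAlgebra.lift ℂ (Sum.elim (fun x : Fin m × Fin m => p x.1 x.2)
      fun x : Fin m × Fin m => q x.1 x.2)
  have hp : ∀ i j, φ (freeMatrix m i j) = p i j := fun i j =>
    FreeAlgebra.lift_ι_apply (Sum.elim (fun x : Fin m × Fin m => p x.1 x.2)
      fun x : Fin m × Fin m => q x.1 x.2) (Sum.inl (i, j))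
  have hq : ∀ i j, φ (star (freeMatrix m i j)) = q i j := fun i j => by
    have e : (FreeAlgebra.ι ℂ (Sum.inr (i, j)) : FreeAlgebra ℂ (Fin m × Fin m ⊕ Fin m × Fin m)) =
        (star (freeMatrix m i j) : FreeStarAlg (Fin m × Fin m)) :=
      (FreeStarAlg.starFun_ι (Sum.inl (i, j))).symm
    rw [← e]
    exact FreeAlgebra.lift_ι_apply (Sum.elim (fun x : Fin m × Fin m => p x.1 x.2)
      fun x : Fin m × Fin m => q x.1 x.2)
      (Sum.inr (i, j))
  have hone : ∀ i j, φ ((1 : Matrix (Fin m) (Fin m) _) i j) = (1 : Matrix (Fin m) (Fin m) S) i j :=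
    fun i j => by rw [Matrix.one_apply, Matrix.one_apply]; split_ifs <;> simp
  have hone' : ∀ i j, φ (star ((1 : Matrix (Fin m) (Fin m) _) i j)) =
      (1 : Matrix (Fin m) (Fin m) S) j i :=
    fun i j => by
      rcases eq_or_ne i j with rfl | h
      · rw [Matrix.one_apply_eq, Matrix.one_apply_eq, star_one, map_one]
      · rw [Matrix.one_apply_ne h, Matrix.one_apply_ne h.symm, star_zero, map_zero]
  have hr : ∀ a b, OrthRel F ((freeMatrix m).map star) a b →
      φ a = φ b ∧ φ (star a) = φ (star b) := by
    rintro a b (⟨i, j⟩ | ⟨i, j⟩ | ⟨i, j⟩)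
    · constructor
      · rw [hone, ← h₁]
        simp only [Matrix.mul_apply, Matrix.star_apply, map_sum, map_mul, hp, hq,
          Matrix.transpose_apply]
      · rw [hone', ← h₁]
        simp only [Matrix.mul_apply, Matrix.star_apply, star_sum, star_mul, star_star, map_sum,
          map_mul, hp, hq, Matrix.transpose_apply]
    · constructor
      · rw [hone, ← h₂]
        simp only [Matrix.mul_apply, Matrix.star_apply, map_sum, map_mul, hp, hq,
          Matrix.transpose_apply]
      · rw [hone', ← h₂]
        simp only [Matrix.mul_apply, Matrix.star_apply, star_sum, star_mul, star_star, map_sum,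
          map_mul, hp, hq, Matrix.transpose_apply]
    · constructor
      · rw [hp, h₃, conjBy_apply, conjBy_apply]
        simp only [map_sum, map_smul, Matrix.map_apply, hq]
      · rw [hq, h₄, conjBy_apply, conjBy_apply, inv_map_star hF]
        simp only [map_sum, map_smul, Matrix.map_apply, hp, star_sum, star_smul, star_star,
          star_mul']
  have hr' : ∀ ⦃a b⦄, starClosure (OrthRel F ((freeMatrix m).map star)) a b → φ a = φ b := by
    rintro a b (h | h)
    · exact (hr a b h).1
    · have := (hr _ _ h).2
      rwa [star_star, star_star] at this
  let ψ : FreeOrth F →ₐ[ℂ] S := RingQuot.liftAlgHom ℂ ⟨φ, hr'⟩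
  have hψ : ∀ x, ψ (UnivStarAlg.mk _ x) = φ x := fun x =>
    RingQuot.liftAlgHom_mkAlgHom_apply ℂ φ hr' x
  refine ⟨ψ, fun i j => (hψ _).trans (hp i j), fun i j => ?_⟩
  refine Eq.trans ?_ ((hψ (star (freeMatrix m i j))).trans (hq i j))
  rw [UnivStarAlg.mk_star]
  rfl

section Hopf

theorem FreeOrth.exists_comul (F : Matrix (Fin m) (Fin m) ℂ) (hF : IsUnit F.det) :
    ∃ Δ : FreeOrth F →⋆ₐ[ℂ] FreeOrth F ⊗[ℂ] FreeOrth F,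
      ∀ i j, Δ (FreeOrth.fund F i j) = ∑ k, FreeOrth.fund F i k ⊗ₜ[ℂ] FreeOrth.fund F k j := by
  set v := FreeOrth.fund F
  let f : FreeOrth F →ₐ[ℂ] FreeOrth F ⊗[ℂ] FreeOrth F := Algebra.TensorProduct.includeLeft
  let g : FreeOrth F →ₐ[ℂ] FreeOrth F ⊗[ℂ] FreeOrth F := Algebra.TensorProduct.includeRight
  have hf : ∀ x, f (star x) = star (f x) := fun x => by simp [f]
  have hg : ∀ x, g (star x) = star (g x) := fun x => by simp [g]
  have hfs : (v.map f).map star = (v.map star).map f := by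
    ext1 i j
    exact (hf _).symm
  have hgs : (v.map g).map star = (v.map star).map g := by
    ext1 i j
    exact (hg _).symm
  have hs : (v.map f * v.map g).map star = (v.map f).map star * (v.map g).map star := by
    ext1 i j
    simp only [Matrix.map_apply, Matrix.mul_apply, star_sum, star_mul, ← hf, ← hg]
    simp [f, g]
  obtain ⟨Δ, hΔ⟩ := FreeOrth.exists_starHom (F := F) (p := v.map f * v.map g)
    (mul_mem (map_mem_unitary _ hf FreeOrth.fund_mem_unitary)
      (map_mem_unitary _ hg FreeOrth.fund_mem_unitary)) (by
      rw [hs, conjBy_mul hF, hfs, hgs, ← conjBy_map, ← conjBy_map, ← FreeOrth.fund_eq_conjBy])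
  refine ⟨Δ, fun i j => (hΔ i j).trans ?_⟩
  simp [Matrix.mul_apply, f, g]

theorem FreeOrth.exists_counit (F : Matrix (Fin m) (Fin m) ℂ) (hF : IsUnit F.det) :
    ∃ ε : FreeOrth F →⋆ₐ[ℂ] ℂ,
      ∀ i j, ε (FreeOrth.fund F i j) = (1 : Matrix (Fin m) (Fin m) ℂ) i j :=
  FreeOrth.exists_starHom (one_mem _) (by
    rw [Matrix.map_one _ (star_zero _) (star_one _), conjBy_one hF])

/-- S is obtained as a homomorphism to the opposite algebra. From S(v) = v* and v̄ = F⁻¹vF,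
linearity forces S(v̄) = F⁻¹v*F. -/
theorem FreeOrth.exists_antipode (hF : IsUnit F.det) {c : ℂ} (hc : c ≠ 0)
    (hFF : F * F.map star = c • 1) :
    ∃ S : FreeOrth F →ₗ[ℂ] FreeOrth F, S 1 = 1 ∧ (∀ x y, S (x * y) = S y * S x) ∧
      (∀ i j, S (FreeOrth.fund F i j) = star (FreeOrth.fund F j i)) ∧
      ∀ i j, S (star (FreeOrth.fund F i j)) = conjBy F⁻¹ (star (FreeOrth.fund F)) i j := by
  set v := FreeOrth.fund F
  -- The scalar value of F F̄ makes conjugation by F̄ the same as conjugation by F⁻¹, as the adjoint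
  -- of the orthogonality relation requires.
  have hFs : F.map star = c • F⁻¹ := by
    rw [← Matrix.mul_one F⁻¹, ← Matrix.mul_smul, ← hFF, ← mul_assoc, Matrix.nonsing_inv_mul _ hF,
      one_mul]
  have hF' : IsUnit F⁻¹.det := Matrix.isUnit_nonsing_inv_det _ hF
  let o : FreeOrth F ≃ₗ[ℂ] (FreeOrth F)ᵐᵒᵖ := MulOpposite.opLinearEquiv ℂ
  set w := conjBy F⁻¹ (star v) with hw
  have h1 : w * v.map star = 1 := by
    rw [FreeOrth.fund_map_star hF, hw, ← conjBy_mul hF',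
      Unitary.star_mul_self_of_mem FreeOrth.fund_mem_unitary, conjBy_one hF']
  have h2 : v.map star * w = 1 := by
    rw [FreeOrth.fund_map_star hF, hw, ← conjBy_mul hF',
      Unitary.mul_star_self_of_mem FreeOrth.fund_mem_unitary, conjBy_one hF']
  have h3 : w.map o = conjBy F⁻¹ ((star v).map o) := conjBy_map o (star v)
  have hone : ∀ i j, o ((1 : Matrix (Fin m) (Fin m) _) j i) =
      (1 : Matrix (Fin m) (Fin m) (FreeOrth F)ᵐᵒᵖ) i j := fun i j => by
    rcases eq_or_ne i j with rfl | h
    · rw [Matrix.one_apply_eq, Matrix.one_apply_eq]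
      rfl
    · rw [Matrix.one_apply_ne h, Matrix.one_apply_ne h.symm, map_zero]
  obtain ⟨ψ, hψ, hψ'⟩ := FreeOrth.exists_algHom hF (p := (star v).map o) (q := w.map o)
    (by
      ext1 i j
      rw [← hone, ← h1]
      simp [Matrix.mul_apply, o, Matrix.star_apply])
    (by
      ext1 i j
      rw [← hone, ← h2]
      simp [Matrix.mul_apply, o, Matrix.star_apply])
    (by rw [h3, conjBy_conjBy_inv hF])
    (by rw [h3, hFs, conjBy_smul_left hc hF'])
  refine ⟨o.symm.toLinearMap ∘ₗ ψ.toLinearMap, ?_, fun x y => ?_, fun i j => ?_, fun i j => ?_⟩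
  · simp [o]
  · simp [o]
  · exact (congrArg o.symm (hψ i j)).trans (o.symm_apply_apply _)
  · exact (congrArg o.symm (hψ' i j)).trans (o.symm_apply_apply _)

section Antipode

variable {H : Type*} [Ring H] [Algebra ℂ H] {S : H →ₗ[ℂ] H}

/-- By antimultiplicativity S(xa)yb = S(a)(S(x)y)b, so the scalar produced by the left factor comes
out. The antipode identity is thus inherited by products. -/
theorem mul'_antipode_rTensor_mul (hS : ∀ x y, S (x * y) = S y * S x) {s : H ⊗[ℂ] H} {c : ℂ}
    (hs : LinearMap.mul' ℂ H (S.rTensor H s) = algebraMap ℂ H c) (t : H ⊗[ℂ] H) :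
    LinearMap.mul' ℂ H (S.rTensor H (s * t)) = c • LinearMap.mul' ℂ H (S.rTensor H t) := by
  induction t using TensorProduct.induction_on with
  | zero => simp
  | add x y hx hy => rw [mul_add, map_add, map_add, hx, hy, map_add, map_add, smul_add]
  | tmul a b =>
    have h : ∀ s : H ⊗[ℂ] H, LinearMap.mul' ℂ H (S.rTensor H (s * a ⊗ₜ b)) =
        S a * LinearMap.mul' ℂ H (S.rTensor H s) * b := fun s => by
      induction s using TensorProduct.induction_on with
      | zero => simp
      | add x y hx hy => simp only [add_mul, map_add, hx, hy, mul_add]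
      | tmul x y => simp [hS, mul_assoc]
    rw [h, hs, ← Algebra.commutes, mul_assoc, ← Algebra.smul_def]
    simp

theorem mul'_antipode_lTensor_mul (hS : ∀ x y, S (x * y) = S y * S x) {t : H ⊗[ℂ] H} {c : ℂ}
    (ht : LinearMap.mul' ℂ H (S.lTensor H t) = algebraMap ℂ H c) (s : H ⊗[ℂ] H) :
    LinearMap.mul' ℂ H (S.lTensor H (s * t)) = c • LinearMap.mul' ℂ H (S.lTensor H s) := by
  induction s using TensorProduct.induction_on with
  | zero => simp
  | add x y hx hy => rw [add_mul, map_add, map_add, hx, hy, map_add, map_add, smul_add]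
  | tmul a b =>
    have h : ∀ t : H ⊗[ℂ] H, LinearMap.mul' ℂ H (S.lTensor H (a ⊗ₜ b * t)) =
        a * LinearMap.mul' ℂ H (S.lTensor H t) * S b := fun t => by
      induction t using TensorProduct.induction_on with
      | zero => simp
      | add x y hx hy => simp only [add_mul, map_add, hx, hy, mul_add]
      | tmul x y => simp [hS, mul_assoc]
    rw [h, ht, ← Algebra.commutes, mul_assoc, ← Algebra.smul_def]
    simp

end Antipode

/-- The antipode identities and S(S(x*)*) = x are inherited by sums and products. On generators the
former are the unitarity of v, and the latter is v = F v̄ F⁻¹ because F̄⁻¹ is proportional to F. The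
last two conclusions are needed to compare π ∘ S with π and to find the degrees of antipodes. -/
theorem FreeOrth.exists_hopfStar (hF : IsUnit F.det) {c : ℂ} (hc : c ≠ 0)
    (hFF : F * F.map star = c • 1) :
    ∃ ℋ : HopfStar (FreeOrth F),
      (∀ i j, ℋ.comul (FreeOrth.fund F i j) =
        ∑ k, FreeOrth.fund F i k ⊗ₜ[ℂ] FreeOrth.fund F k j) ∧
      (∀ i j, ℋ.counit (FreeOrth.fund F i j) = (1 : Matrix (Fin m) (Fin m) ℂ) i j) ∧
      (∀ i j, ℋ.antipode (FreeOrth.fund F i j) = star (FreeOrth.fund F j i)) ∧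
      ℋ.antipode 1 = 1 ∧ ∀ x y, ℋ.antipode (x * y) = ℋ.antipode y * ℋ.antipode x := by
  obtain ⟨Δ, hΔ⟩ := FreeOrth.exists_comul F hF
  obtain ⟨ε, hε⟩ := FreeOrth.exists_counit F hF
  obtain ⟨S, hS1, hSmul, hS, hS'⟩ := FreeOrth.exists_antipode hF hc hFF
  have hind : ∀ {p : FreeOrth F → Prop} (x : FreeOrth F), (∀ i j, p (FreeOrth.fund F i j)) →
      (∀ c, p (algebraMap ℂ _ c)) → (∀ x y, p x → p y → p (x + y)) →
      (∀ x y, p x → p y → p (x * y)) → p x := fun {p} x h0 h1 h2 h3 => by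
    have hx : x ∈ Algebra.adjoin ℂ {x | ∃ i j, FreeOrth.fund F i j = x} := by
      rw [FreeOrth.adjoin_eq_top hF]
      trivial
    refine Algebra.adjoin_induction (p := fun x _ => p x) ?_ h1 (fun x y _ _ => h2 x y)
      (fun x y _ _ => h3 x y) hx
    rintro x ⟨i, j, rfl⟩
    exact h0 i j
  refine ⟨{ comul := Δ, counit := ε, antipode := S, coassoc := ?_, counit_left := ?_,
            counit_right := ?_, antipode_left := ?_, antipode_right := ?_, antipode_star := ?_ },
    hΔ, hε, hS, hS1, hSmul⟩
  · have h : ((Algebra.TensorProduct.assoc ℂ ℂ ℂ (FreeOrth F) (FreeOrth F)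
          (FreeOrth F)).toAlgHom.comp (Algebra.TensorProduct.map Δ.toAlgHom (AlgHom.id ℂ _))).comp
          Δ.toAlgHom = (Algebra.TensorProduct.map (AlgHom.id ℂ _) Δ.toAlgHom).comp Δ.toAlgHom := by
      refine FreeOrth.algHom_ext hF fun i j => ?_
      simp [hΔ, TensorProduct.sum_tmul, TensorProduct.tmul_sum]
      rw [Finset.sum_comm]
    exact congrArg AlgHom.toLinearMap h
  · have h : ((Algebra.TensorProduct.lid ℂ (FreeOrth F)).toAlgHom.comp
        (Algebra.TensorProduct.map ε.toAlgHom (AlgHom.id ℂ _))).comp Δ.toAlgHom =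
          AlgHom.id ℂ _ := by
      refine FreeOrth.algHom_ext hF fun i j => ?_
      simp [hΔ, hε, Matrix.one_apply]
    exact congrArg AlgHom.toLinearMap h
  · have h : ((Algebra.TensorProduct.rid ℂ ℂ (FreeOrth F)).toAlgHom.comp
        (Algebra.TensorProduct.map (AlgHom.id ℂ _) ε.toAlgHom)).comp Δ.toAlgHom =
          AlgHom.id ℂ _ := by
      refine FreeOrth.algHom_ext hF fun i j => ?_
      simp [hΔ, hε, Matrix.one_apply]
    exact congrArg AlgHom.toLinearMap h
  · ext x
    change LinearMap.mul' ℂ _ (S.rTensor _ (Δ x)) = algebraMap ℂ _ (ε x)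
    refine hind (p := fun x => LinearMap.mul' ℂ _ (S.rTensor _ (Δ x)) = algebraMap ℂ _ (ε x)) x
      (fun i j => ?_) (fun c => ?_) (fun x y hx hy => ?_) fun x y hx hy => ?_
    · have h := congrArg (fun M : Matrix (Fin m) (Fin m) (FreeOrth F) => M i j)
        (Unitary.star_mul_self_of_mem (FreeOrth.fund_mem_unitary (F := F)))
      simp only [Matrix.mul_apply] at h
      simp only [hΔ, map_sum, LinearMap.rTensor_tmul, LinearMap.mul'_apply, hS, hε]
      refine h.trans ?_
      simp only [Matrix.one_apply]
      split_ifs <;> simp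
    · simp [Algebra.algebraMap_eq_smul_one, Algebra.TensorProduct.one_def, hS1]
    · simp only [map_add, hx, hy]
    · rw [map_mul, mul'_antipode_rTensor_mul hSmul hx, hy, map_mul, map_mul, Algebra.smul_def]
  · ext x
    change LinearMap.mul' ℂ _ (S.lTensor _ (Δ x)) = algebraMap ℂ _ (ε x)
    refine hind (p := fun x => LinearMap.mul' ℂ _ (S.lTensor _ (Δ x)) = algebraMap ℂ _ (ε x)) x
      (fun i j => ?_) (fun c => ?_) (fun x y hx hy => ?_) fun x y hx hy => ?_
    · have h := congrArg (fun M : Matrix (Fin m) (Fin m) (FreeOrth F) => M i j)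
        (Unitary.mul_star_self_of_mem (FreeOrth.fund_mem_unitary (F := F)))
      simp only [Matrix.mul_apply] at h
      simp only [hΔ, map_sum, LinearMap.lTensor_tmul, LinearMap.mul'_apply, hS, hε]
      refine h.trans ?_
      simp only [Matrix.one_apply]
      split_ifs <;> simp
    · simp [Algebra.algebraMap_eq_smul_one, Algebra.TensorProduct.one_def, hS1]
    · simp only [map_add, hx, hy]
    · rw [map_mul, mul'_antipode_lTensor_mul hSmul hy, hx, map_mul, map_mul, Algebra.smul_def,
        Algebra.commutes]
  · intro x
    refine hind (p := fun x => S (star (S (star x))) = x) x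
      (fun i j => ?_) (fun c => ?_) (fun x y hx hy => ?_) fun x y hx hy => ?_
    · have h1 : S (star (S (star (FreeOrth.fund F i j)))) = (conjBy (F⁻¹.map star) ((FreeOrth.fund F).map star)) i j := by
        rw [hS', conjBy_apply, conjBy_apply, inv_map_star (Matrix.isUnit_nonsing_inv_det _ hF)]
        simp only [star_sum, star_smul, map_sum, map_smul, Matrix.star_apply, star_star,
          Matrix.map_apply, hS, star_mul']
      have h2 : F⁻¹.map star = c⁻¹ • F := by
        rw [← inv_map_star hF]
        refine Matrix.inv_eq_left_inv ?_
        rw [Matrix.smul_mul, hFF, smul_smul, inv_mul_cancel₀ hc, one_smul]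
      rw [h1, h2, conjBy_smul_left (inv_ne_zero hc) hF, ← FreeOrth.fund_eq_conjBy]
    · simp [Algebra.algebraMap_eq_smul_one, hS1]
    · simp only [star_add, map_add, hx, hy]
    · rw [star_mul, hSmul, star_mul, hSmul, hx, hy]

end Hopf

end FreeOrth

/-! ### The Hopf *-algebra map to the group algebra -/

section Expand

variable {Γ : Type*} [CommGroup Γ] {m : ℕ} {Q : SpectralFamily Γ m}
variable {E : Type*} [Ring E] [Algebra ℂ E]

theorem SpectralFamily.comp_expand_self (l : Γ → E) (a : Γ) :
    Q.comp (Q.expand l) a a = (Q.proj a).map (· • l a) := by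
  rw [SpectralFamily.comp, Q.proj_mul_expand, ← Q.expand_mul_proj, mul_assoc, ← map_mul,
    Q.proj_mul_self]

theorem SpectralFamily.comp_expand_of_ne (l : Γ → E) {a b : Γ} (h : a ≠ b) :
    Q.comp (Q.expand l) a b = 0 := by
  rw [SpectralFamily.comp, Q.proj_mul_expand, ← Q.expand_mul_proj, mul_assoc, ← map_mul,
    Q.proj_mul_of_ne a b h, map_zero, mul_zero]

/-- Only components with a = b survive, so θ matters on the diagonal only, and there the relation is
A P̄_a = P_{a⁻¹} A. This yields π, with l_a = a, and the counit, with l = 1. -/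
theorem isTwistedOrth_expand [StarRing E] [StarModule ℂ E] {A : Matrix (Fin m) (Fin m) ℂ}
    (hA : IsUnit A.det) (hQ : Q.IsSymm A) {θ : Γ → Γ → ℂ} (hθ : ∀ a, θ a a = 1) {l : Γ → E}
    (hl : ∀ a, l a ∈ unitary E) (hs : ∀ a, star (l a) = l a⁻¹) :
    IsTwistedOrth Q A θ (Q.expand l) := by
  refine ⟨Q.expand_mem_unitary hl, fun a b => ?_⟩
  rcases eq_or_ne a b with rfl | h
  · rw [hθ, one_smul, SpectralFamily.comp_expand_self, SpectralFamily.comp_expand_self]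
    have h2 : Q.proj a⁻¹ = A * Q.conj.proj a * A⁻¹ := by
      rw [hQ, mul_assoc, Matrix.mul_nonsing_inv _ hA, mul_one]
    ext1 i j
    rw [h2]
    simp only [Matrix.map_apply, Matrix.mul_apply, scalarMatrix_apply, star_smul, hs,
      Finset.sum_smul, Finset.sum_mul]
    refine Finset.sum_congr rfl fun s _ => Finset.sum_congr rfl fun t _ => ?_
    rw [← Algebra.smul_def, ← Algebra.commutes, ← Algebra.smul_def, smul_smul, smul_smul]
    refine congrArg (· • l a⁻¹) ?_
    have h3 : Q.conj.proj a t s = star (Q.proj a t s) := rfl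
    rw [h3]
    ring
  · rw [SpectralFamily.comp_expand_of_ne _ h,
      SpectralFamily.comp_expand_of_ne _ (fun h' => h (inv_injective h'))]
    ext1 i j
    simp [Matrix.mul_apply]

theorem single_mem_unitary (a : Γ) : MonoidAlgebra.single a (1 : ℂ) ∈ unitary (MonoidAlgebra ℂ Γ) := by
  rw [Unitary.mem_iff, star_single]
  simp [MonoidAlgebra.single_mul_single, MonoidAlgebra.one_def]

theorem SpectralFamily.toMatrix_comul (i j : Fin m) :
    Coalgebra.comul (R := ℂ) (Q.toMatrix i j) = ∑ k, Q.toMatrix i k ⊗ₜ[ℂ] Q.toMatrix k j := by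
  let f : MonoidAlgebra ℂ Γ →ₐ[ℂ] MonoidAlgebra ℂ Γ ⊗[ℂ] MonoidAlgebra ℂ Γ :=
    Algebra.TensorProduct.includeLeft
  let g : MonoidAlgebra ℂ Γ →ₐ[ℂ] MonoidAlgebra ℂ Γ ⊗[ℂ] MonoidAlgebra ℂ Γ :=
    Algebra.TensorProduct.includeRight
  have h : Q.toMatrix.map f * Q.toMatrix.map g = Q.expand fun a =>
      MonoidAlgebra.single a (1 : ℂ) ⊗ₜ[ℂ] MonoidAlgebra.single a (1 : ℂ) := by
    rw [SpectralFamily.toMatrix, Q.map_expand, Q.map_expand, Q.expand_mul]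
    congr 1
    ext1 a
    simp [f, g]
  have h' := congrArg (fun M : Matrix (Fin m) (Fin m) _ => M i j) h
  simp only [Matrix.mul_apply, Matrix.map_apply, SpectralFamily.expand_apply] at h'
  simp only [f, g, Algebra.TensorProduct.includeLeft_apply,
    Algebra.TensorProduct.includeRight_apply, Algebra.TensorProduct.tmul_mul_tmul, mul_one,
    one_mul] at h'
  rw [h', SpectralFamily.toMatrix, SpectralFamily.expand_apply, map_sum]
  simp only [map_smul, comul_single_one]

theorem SpectralFamily.toMatrix_counit (i j : Fin m) :
    Coalgebra.counit (R := ℂ) (Q.toMatrix i j) = (1 : Matrix (Fin m) (Fin m) ℂ) i j := by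
  rw [← Q.sum_proj, Matrix.sum_apply]
  simp [SpectralFamily.toMatrix, SpectralFamily.expand_apply]

variable {A : Matrix (Fin m) (Fin m) ℂ} {β : Bichar Γ} {w : Γ}

/-- The inversion of the group algebra. -/
def groupAlgInv (Γ : Type*) [CommGroup Γ] : MonoidAlgebra ℂ Γ →ₐ[ℂ] MonoidAlgebra ℂ Γ :=
  MonoidAlgebra.mapDomainAlgHom ℂ ℂ (invMonoidHom : Γ →* Γ)

theorem groupAlgInv_single (a : Γ) (c : ℂ) :
    groupAlgInv Γ (MonoidAlgebra.single a c) = MonoidAlgebra.single a⁻¹ c := by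
  simp [groupAlgInv]

theorem FreeOrth.exists_hopfMap (hA : IsUnit A.det) (hQ : Q.IsSymm A)
    (hF : IsUnit (A * charMatrix (Q.shift w) w β).det)
    (ℋ : HopfStar (FreeOrth (A * charMatrix (Q.shift w) w β)))
    (hΔ : ∀ i j, ℋ.comul (FreeOrth.fund _ i j) =
        ∑ k, FreeOrth.fund _ i k ⊗ₜ[ℂ] FreeOrth.fund _ k j)
    (hε : ∀ i j, ℋ.counit (FreeOrth.fund _ i j) = (1 : Matrix (Fin m) (Fin m) ℂ) i j)
    (hS : ∀ i j, ℋ.antipode (FreeOrth.fund _ i j) = star (FreeOrth.fund _ j i))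
    (hS1 : ℋ.antipode 1 = 1) (hSm : ∀ x y, ℋ.antipode (x * y) = ℋ.antipode y * ℋ.antipode x) :
    ∃ π : FreeOrth (A * charMatrix (Q.shift w) w β) →⋆ₐ[ℂ] MonoidAlgebra ℂ Γ,
      IsHopfMap ℋ π ∧ (∀ i j, π (FreeOrth.fund _ i j) = Q.toMatrix i j) ∧
      ∀ x, π (ℋ.antipode x) = groupAlgInv Γ (π x) := by
  obtain ⟨π, hπ⟩ := FreeOrth.exists_hom (β := β) (w := w) hA hQ
    (isTwistedOrth_expand hA hQ (fun a => by simp [orthTwist])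
      (fun a => single_mem_unitary a) fun a => by rw [star_single, star_one])
  refine ⟨π, ⟨fun x => ?_, fun x => ?_⟩, hπ, fun x => ?_⟩
  · have h : (Algebra.TensorProduct.map π.toAlgHom π.toAlgHom).comp ℋ.comul.toAlgHom =
        (Bialgebra.comulAlgHom ℂ (MonoidAlgebra ℂ Γ)).comp π.toAlgHom := by
      refine FreeOrth.algHom_ext hF fun i j => ?_
      have h1 := Q.toMatrix_comul i j
      simp only [SpectralFamily.toMatrix] at h1
      simp [hΔ, hπ, h1]
    exact DFunLike.congr_fun h x
  · have h : (Bialgebra.counitAlgHom ℂ (MonoidAlgebra ℂ Γ)).comp π.toAlgHom =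
        ℋ.counit.toAlgHom := by
      refine FreeOrth.algHom_ext hF fun i j => ?_
      have h1 := Q.toMatrix_counit i j
      simp only [SpectralFamily.toMatrix] at h1
      simp [hε, hπ, h1]
    exact DFunLike.congr_fun h x
  · let f : FreeOrth (A * charMatrix (Q.shift w) w β) →ₐ[ℂ] MonoidAlgebra ℂ Γ :=
      AlgHom.ofLinearMap (π.toAlgHom.toLinearMap ∘ₗ ℋ.antipode)
        (by simp [hS1]) (fun x y => by simp [hSm, mul_comm])
    have h : f = (groupAlgInv Γ).comp π.toAlgHom := by
      refine FreeOrth.algHom_ext hF fun i j => ?_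
      change π (ℋ.antipode (FreeOrth.fund _ i j)) = groupAlgInv Γ (π (FreeOrth.fund _ i j))
      rw [hS, map_star, hπ, hπ]
      simp [SpectralFamily.expand_apply, groupAlgInv_single, star_single, Q.proj_apply_star]
    exact DFunLike.congr_fun h x

end Expand

/-! ### The bigrading defined by a Hopf *-algebra map -/

section Bihomogeneous

variable {Γ : Type*} [CommGroup Γ]
variable {H : Type*} [Ring H] [Algebra ℂ H] [StarRing H] [StarModule ℂ H]
variable {ℋ : HopfStar H} {π : H →⋆ₐ[ℂ] MonoidAlgebra ℂ Γ} {a b c d : Γ} {x y : H}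

theorem single_mul_single_one (a b : Γ) : (MonoidAlgebra.single a (1 : ℂ)) *
    MonoidAlgebra.single b (1 : ℂ) = MonoidAlgebra.single (a * b) (1 : ℂ) := by
  rw [MonoidAlgebra.single_mul_single, one_mul]

theorem one_mem_bihomogeneous : (1 : H) ∈ bihomogeneous ℋ π 1 1 := by
  constructor <;> simp [Algebra.TensorProduct.one_def, MonoidAlgebra.one_def]

theorem mul_mem_bihomogeneous (hx : x ∈ bihomogeneous ℋ π a b) (hy : y ∈ bihomogeneous ℋ π c d) :
    x * y ∈ bihomogeneous ℋ π (a * c) (b * d) := by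
  constructor
  · rw [map_mul]
    refine (map_mul (Algebra.TensorProduct.map π.toAlgHom (AlgHom.id ℂ H)) _ _).trans ?_
    refine (congrArg₂ (· * ·) hx.1 hy.1).trans ?_
    simp only [Algebra.TensorProduct.tmul_mul_tmul, single_mul_single_one]
  · rw [map_mul]
    refine (map_mul (Algebra.TensorProduct.map (AlgHom.id ℂ H) π.toAlgHom) _ _).trans ?_
    refine (congrArg₂ (· * ·) hx.2 hy.2).trans ?_
    simp only [Algebra.TensorProduct.tmul_mul_tmul, single_mul_single_one]

theorem star_mem_bihomogeneous (hx : x ∈ bihomogeneous ℋ π a b) :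
    star x ∈ bihomogeneous ℋ π a⁻¹ b⁻¹ := by
  have h1 : ∀ t : H ⊗[ℂ] H, π.toAlgHom.toLinearMap.rTensor H (star t) =
      star (π.toAlgHom.toLinearMap.rTensor H t) := fun t => by
    induction t using TensorProduct.induction_on with
    | zero => simp
    | add s t hs ht => simp only [star_add, map_add, hs, ht]
    | tmul s t => simp [TensorProduct.star_tmul, map_star]
  have h2 : ∀ t : H ⊗[ℂ] H, π.toAlgHom.toLinearMap.lTensor H (star t) =
      star (π.toAlgHom.toLinearMap.lTensor H t) := fun t => by
    induction t using TensorProduct.induction_on with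
    | zero => simp
    | add s t hs ht => simp only [star_add, map_add, hs, ht]
    | tmul s t => simp [TensorProduct.star_tmul, map_star]
  constructor
  · rw [map_star, h1, hx.1, TensorProduct.star_tmul, star_single, star_one]
  · rw [map_star, h2, hx.2, TensorProduct.star_tmul, star_single, star_one]

theorem smul_mem_bihomogeneous (c : ℂ) (hx : x ∈ bihomogeneous ℋ π a b) :
    c • x ∈ bihomogeneous ℋ π a b := by
  constructor
  · rw [map_smul, map_smul, hx.1, TensorProduct.tmul_smul]
  · rw [map_smul, map_smul, hx.2, TensorProduct.smul_tmul']

variable {M : Type*} [AddCommGroup M] [Module ℂ M]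

/-- The map `x ↦ x₍₂₎ ⊗ g(π(x₍₁₎) ⊗ π(x₍₃₎))`. -/
def bigradedMap (ℋ : HopfStar H) (π : H →⋆ₐ[ℂ] MonoidAlgebra ℂ Γ)
    (g : MonoidAlgebra ℂ Γ ⊗[ℂ] MonoidAlgebra ℂ Γ →ₗ[ℂ] M) : H →ₗ[ℂ] H ⊗[ℂ] M :=
  g.lTensor H ∘ₗ (TensorProduct.leftComm ℂ (MonoidAlgebra ℂ Γ) H (MonoidAlgebra ℂ Γ)).toLinearMap ∘ₗ
    (π.toAlgHom.toLinearMap.lTensor H ∘ₗ ℋ.comul.toAlgHom.toLinearMap).lTensor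
      (MonoidAlgebra ℂ Γ) ∘ₗ
    π.toAlgHom.toLinearMap.rTensor H ∘ₗ ℋ.comul.toAlgHom.toLinearMap

theorem bigradedMap_of_mem (g : MonoidAlgebra ℂ Γ ⊗[ℂ] MonoidAlgebra ℂ Γ →ₗ[ℂ] M)
    (hx : x ∈ bihomogeneous ℋ π a b) : bigradedMap ℋ π g x =
      x ⊗ₜ[ℂ] g (MonoidAlgebra.single a 1 ⊗ₜ[ℂ] MonoidAlgebra.single b 1) := by
  have h1 : π.toAlgHom.toLinearMap.rTensor H (ℋ.comul.toAlgHom.toLinearMap x) = _ := hx.1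
  have h2 : π.toAlgHom.toLinearMap.lTensor H (ℋ.comul.toAlgHom.toLinearMap x) = _ := hx.2
  simp only [bigradedMap, LinearMap.comp_apply, h1, LinearMap.lTensor_tmul, h2,
    LinearEquiv.coe_coe, TensorProduct.leftComm_tmul]

/-- Since π ∘ S is π followed by inversion, the adjoint coaction depends on the outer legs only
through their images under π. -/
theorem adCoact_eq_bigradedMap (hS : ∀ x, π (ℋ.antipode x) = groupAlgInv Γ (π x)) :
    adCoact ℋ π = bigradedMap ℋ π (LinearMap.mul' ℂ (MonoidAlgebra ℂ Γ) ∘ₗ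
      (groupAlgInv Γ).toLinearMap.rTensor (MonoidAlgebra ℂ Γ)) := by
  have h1 : ∀ (p : H) (r : H ⊗[ℂ] H),
      (π.toAlgHom.toLinearMap ∘ₗ LinearMap.mul' ℂ H ∘ₗ ℋ.antipode.rTensor H).lTensor H
        (TensorProduct.leftComm ℂ H H H (p ⊗ₜ[ℂ] r)) =
      (LinearMap.mul' ℂ (MonoidAlgebra ℂ Γ) ∘ₗ
        (groupAlgInv Γ).toLinearMap.rTensor (MonoidAlgebra ℂ Γ)).lTensor H
        (TensorProduct.leftComm ℂ (MonoidAlgebra ℂ Γ) H (MonoidAlgebra ℂ Γ)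
          (π p ⊗ₜ[ℂ] π.toAlgHom.toLinearMap.lTensor H r)) := fun p r => by
    induction r using TensorProduct.induction_on with
    | zero => simp
    | add s t hs ht => simp only [TensorProduct.tmul_add, map_add, hs, ht]
    | tmul s t => simp [hS]
  have h2 : ∀ t : H ⊗[ℂ] H,
      (π.toAlgHom.toLinearMap ∘ₗ LinearMap.mul' ℂ H ∘ₗ ℋ.antipode.rTensor H).lTensor H
        (TensorProduct.leftComm ℂ H H H (ℋ.comul.toAlgHom.toLinearMap.lTensor H t)) =
      (LinearMap.mul' ℂ (MonoidAlgebra ℂ Γ) ∘ₗ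
        (groupAlgInv Γ).toLinearMap.rTensor (MonoidAlgebra ℂ Γ)).lTensor H
        (TensorProduct.leftComm ℂ (MonoidAlgebra ℂ Γ) H (MonoidAlgebra ℂ Γ)
          ((π.toAlgHom.toLinearMap.lTensor H ∘ₗ ℋ.comul.toAlgHom.toLinearMap).lTensor
            (MonoidAlgebra ℂ Γ) (π.toAlgHom.toLinearMap.rTensor H t))) := fun t => by
    induction t using TensorProduct.induction_on with
    | zero => simp
    | add s t hs ht => simp only [map_add, hs, ht]
    | tmul s t => exact h1 s (ℋ.comul t)
  exact LinearMap.ext fun x => h2 (ℋ.comul x)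

theorem adCoact_of_mem (hS : ∀ x, π (ℋ.antipode x) = groupAlgInv Γ (π x))
    (hx : x ∈ bihomogeneous ℋ π a b) :
    adCoact ℋ π x = x ⊗ₜ[ℂ] MonoidAlgebra.single (a⁻¹ * b) (1 : ℂ) := by
  rw [adCoact_eq_bigradedMap hS, bigradedMap_of_mem _ hx]
  simp [groupAlgInv_single]

/-- Applying the counit to the remaining leg of the two degree conditions gives π(x) = ε(x)a =
ε(x)b, and distinct group elements are linearly independent. -/
theorem counit_eq_zero_of_mem (hx : x ∈ bihomogeneous ℋ π a b) (hab : a ≠ b) : ℋ.counit x = 0 := by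
  have h1 : ∀ t : H ⊗[ℂ] H, TensorProduct.rid ℂ _ (ℋ.counit.toAlgHom.toLinearMap.lTensor _
      (π.toAlgHom.toLinearMap.rTensor H t)) =
      π (TensorProduct.rid ℂ H (ℋ.counit.toAlgHom.toLinearMap.lTensor H t)) := fun t => by
    induction t using TensorProduct.induction_on with
    | zero => simp
    | add s t hs ht => simp only [map_add, hs, ht]
    | tmul s t => simp
  have h2 : ∀ t : H ⊗[ℂ] H, TensorProduct.lid ℂ _ (ℋ.counit.toAlgHom.toLinearMap.rTensor _
      (π.toAlgHom.toLinearMap.lTensor H t)) =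
      π (TensorProduct.lid ℂ H (ℋ.counit.toAlgHom.toLinearMap.rTensor H t)) := fun t => by
    induction t using TensorProduct.induction_on with
    | zero => simp
    | add s t hs ht => simp only [map_add, hs, ht]
    | tmul s t => simp
  have h3 : π x = ℋ.counit x • MonoidAlgebra.single a (1 : ℂ) := by
    have h := h1 (ℋ.comul x)
    have h' : TensorProduct.rid ℂ H (ℋ.counit.toAlgHom.toLinearMap.lTensor H (ℋ.comul x)) = x :=
      LinearMap.congr_fun ℋ.counit_right x
    rw [hx.1, h'] at h
    rw [← h]
    simp
  have h4 : π x = ℋ.counit x • MonoidAlgebra.single b (1 : ℂ) := by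
    have h := h2 (ℋ.comul x)
    have h' : TensorProduct.lid ℂ H (ℋ.counit.toAlgHom.toLinearMap.rTensor H (ℋ.comul x)) = x :=
      LinearMap.congr_fun ℋ.counit_left x
    rw [hx.2, h'] at h
    rw [← h]
    simp
  classical
  have h5 := congrArg (coefLin a) (h3.symm.trans h4)
  simpa [coefLin_single, hab] using h5

end Bihomogeneous

/-! ### The bicharacter of the transmutation -/

section TransmutationBichar

variable {Γ : Type*} [CommGroup Γ]

/-- The bicharacter `((a, b), (c, d)) ↦ β(a⁻¹b, c⁻¹)`. -/
def transBichar (β : Bichar Γ) : Bichar (Γ × Γ) :=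
  MonoidHom.mk' (fun g => (β (g.1⁻¹ * g.2)).comp ((MonoidHom.fst Γ Γ)⁻¹)) fun g h => by
    ext1 k
    change β ((g.1 * h.1)⁻¹ * (g.2 * h.2)) _ = β (g.1⁻¹ * g.2) _ * β (h.1⁻¹ * h.2) _
    rw [mul_inv, mul_mul_mul_comm, map_mul]
    rfl

theorem transBichar_apply (β : Bichar Γ) (g h : Γ × Γ) :
    transBichar β g h = β (g.1⁻¹ * g.2) h.1⁻¹ := rfl

end TransmutationBichar

section Comp

variable {Γ : Type*} {m : ℕ} (Q : SpectralFamily Γ m)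
variable {R S : Type*} [Ring R] [Algebra ℂ R] [Ring S] [Algebra ℂ S]

theorem SpectralFamily.map_comp [CommGroup Γ] [StarRing R] [StarModule ℂ R] [StarRing S]
    [StarModule ℂ S] (f : R →ₗ[ℂ] S) (p : Matrix (Fin m) (Fin m) R) (a b : Γ) (i j : Fin m) :
    f (Q.comp p a b i j) = Q.comp (p.map f) a b i j := by
  rw [Q.comp_apply, Q.comp_apply]
  simp only [map_sum, map_smul, Matrix.map_apply]

theorem SpectralFamily.comp_mul [CommGroup Γ] [StarRing R] [StarModule ℂ R]
    (p q : Matrix (Fin m) (Fin m) R) (a b : Γ) :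
    Q.comp (p * q) a b = ∑ e ∈ Q.supp, Q.comp p a e * Q.comp q e b := by
  have h : ∀ e, Q.comp p a e * Q.comp q e b =
      scalarMatrix R (Q.proj a) * p * scalarMatrix R (Q.proj e) * (q * scalarMatrix R (Q.proj b)) :=
    fun e => by
      conv_rhs => rw [← Q.proj_mul_self e, map_mul]
      simp only [SpectralFamily.comp, mul_assoc]
  simp only [h]
  rw [← Finset.sum_mul, ← Finset.mul_sum, ← map_sum, Q.sum_proj, map_one, mul_one,
    SpectralFamily.comp]
  simp only [mul_assoc]

end Comp

/-- A Hopf `*`-algebra `H` over `ℂΓ` and a `*`-algebra `B`, generated by the entries of matrices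
`v` and `u`, and `*`-homomorphisms that relate `u` and `v` by twisting. -/
structure TransmutationData {Γ : Type*} [CommGroup Γ] {m : ℕ} (β : Bichar Γ)
    (Q : SpectralFamily Γ m) {B H : Type*} [Ring B] [Algebra ℂ B] [StarRing B] [StarModule ℂ B]
    [Ring H] [Algebra ℂ H] [StarRing H] [StarModule ℂ H] (u : Matrix (Fin m) (Fin m) B)
    (v : Matrix (Fin m) (Fin m) H) where
  hopf : HopfStar H
  proj : H →⋆ₐ[ℂ] MonoidAlgebra ℂ Γ
  toTwist : B →⋆ₐ[ℂ] H ⊗[ℂ] TwistedGroupAlg (transBichar β)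
  ofTwist : H →⋆ₐ[ℂ] B ⊗[ℂ] TwistedGroupAlg (transBichar β)⁻¹
  coact : B →⋆ₐ[ℂ] B ⊗[ℂ] MonoidAlgebra ℂ Γ
  counit : B →⋆ₐ[ℂ] ℂ
  adjoin_u : Algebra.adjoin ℂ {x | ∃ i j, u i j = x} = ⊤
  adjoin_v : Algebra.adjoin ℂ {x | ∃ i j, v i j = x} = ⊤
  comul_v : ∀ i j, hopf.comul (v i j) = ∑ k, v i k ⊗ₜ[ℂ] v k j
  counit_v : ∀ i j, hopf.counit (v i j) = (1 : Matrix (Fin m) (Fin m) ℂ) i j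
  antipode_v : ∀ i j, hopf.antipode (v i j) = star (v j i)
  antipode_one : hopf.antipode 1 = 1
  antipode_mul : ∀ x y, hopf.antipode (x * y) = hopf.antipode y * hopf.antipode x
  hopfMap : IsHopfMap hopf proj
  proj_v : ∀ i j, proj (v i j) = Q.toMatrix i j
  proj_antipode : ∀ x, proj (hopf.antipode x) = groupAlgInv Γ (proj x)
  toTwist_u : u.map toTwist = Q.twist
    (fun a => TwistedGroupAlg.basisVec (transBichar β) (a, 1))
    (fun b => TwistedGroupAlg.basisVec (transBichar β) (1, b)) v
  ofTwist_v : v.map ofTwist = Q.twist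
    (fun a => TwistedGroupAlg.basisVec (transBichar β)⁻¹ (a, 1))
    (fun b => TwistedGroupAlg.basisVec (transBichar β)⁻¹ (1, b)) u
  coact_u : u.map coact = Q.twist (fun a => MonoidAlgebra.single a⁻¹ (1 : ℂ))
    (fun b => MonoidAlgebra.single b (1 : ℂ)) u
  counit_u : ∀ i j, counit (u i j) = (1 : Matrix (Fin m) (Fin m) ℂ) i j

/-! ### Corresponding homogeneous elements -/

namespace TransmutationData

variable {Γ : Type*} [CommGroup Γ] {m : ℕ} {β : Bichar Γ} {Q : SpectralFamily Γ m}
variable {B H : Type*} [Ring B] [Algebra ℂ B] [StarRing B] [StarModule ℂ B]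
variable [Ring H] [Algebra ℂ H] [StarRing H] [StarModule ℂ H]
variable {u : Matrix (Fin m) (Fin m) B} {v : Matrix (Fin m) (Fin m) H}

variable (β Q u v) in
/-- The pairs of homogeneous elements of `B` and `H` that correspond to each other. -/
inductive Pair : Γ → Γ → B → H → Prop
  | one : Pair 1 1 1 1
  | gen (a b : Γ) (i j : Fin m) : Pair a b (Q.comp u a b i j) (Q.comp v a b i j)
  | mul {a b c d : Γ} {x x' : B} {y y' : H} : Pair a b x y → Pair c d x' y' →
      Pair (a * c) (b * d) (x * x') ((β (a⁻¹ * b) c⁻¹ : ℂ) • (y * y'))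

theorem span_eq_top_of_adjoin {R ι : Type*} [Ring R] [Algebra ℂ R] {g : ι → R} {s : Set R}
    (hg : Algebra.adjoin ℂ (Set.range g) = ⊤) (h1 : 1 ∈ s)
    (hs : ∀ i, g i ∈ Submodule.span ℂ s)
    (hmul : ∀ x ∈ s, ∀ y ∈ s, x * y ∈ Submodule.span ℂ s) : Submodule.span ℂ s = ⊤ := by
  have hmul' : ∀ x ∈ Submodule.span ℂ s, ∀ y ∈ Submodule.span ℂ s, x * y ∈ Submodule.span ℂ s := by
    intro x hx y hy
    induction hx using Submodule.span_induction with
    | zero => simp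
    | add x x' _ _ hx hx' => rw [add_mul]; exact add_mem hx hx'
    | smul c x _ hx => rw [smul_mul_assoc]; exact Submodule.smul_mem _ c hx
    | mem x hx =>
      induction hy using Submodule.span_induction with
      | zero => simp
      | add x x' _ _ hx hx' => rw [mul_add]; exact add_mem hx hx'
      | smul c x _ hx => rw [mul_smul_comm]; exact Submodule.smul_mem _ c hx
      | mem y hy => exact hmul x hx y hy
  rw [eq_top_iff]
  rintro x -
  have hx : x ∈ Algebra.adjoin ℂ (Set.range g) := hg ▸ Algebra.mem_top
  induction hx using Algebra.adjoin_induction with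
  | mem x hx =>
    obtain ⟨i, rfl⟩ := hx
    exact hs i
  | algebraMap c =>
    rw [Algebra.algebraMap_eq_smul_one]
    exact Submodule.smul_mem _ c (Submodule.subset_span h1)
  | add x y _ _ hx hy => exact add_mem hx hy
  | mul x y _ _ hx hy => exact hmul' x hx y hy

theorem range_entries {R : Type*} (u : Matrix (Fin m) (Fin m) R) :
    Set.range (fun p : Fin m × Fin m => u p.1 p.2) = {x | ∃ i j, u i j = x} := by
  ext x
  simp

variable (D : TransmutationData β Q u v)

include D

theorem span_fst : Submodule.span ℂ {x : B | ∃ a b y, Pair β Q u v a b x y} = ⊤ := by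
  refine span_eq_top_of_adjoin (g := fun p : Fin m × Fin m => u p.1 p.2)
    (by rw [range_entries, D.adjoin_u]) ⟨1, 1, 1, .one⟩ (fun p => ?_) ?_
  · have h : u p.1 p.2 = ∑ a ∈ Q.supp, ∑ b ∈ Q.supp, Q.comp u a b p.1 p.2 := by
      conv_lhs => rw [← Q.sum_comp u]
      simp only [Matrix.sum_apply]
    rw [h]
    exact sum_mem fun a _ => sum_mem fun b _ => Submodule.subset_span ⟨a, b, _, .gen a b _ _⟩
  · rintro x ⟨a, b, y, h⟩ x' ⟨c, d, y', h'⟩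
    exact Submodule.subset_span ⟨_, _, _, h.mul h'⟩

theorem span_snd : Submodule.span ℂ {y : H | ∃ a b x, Pair β Q u v a b x y} = ⊤ := by
  refine span_eq_top_of_adjoin (g := fun p : Fin m × Fin m => v p.1 p.2)
    (by rw [range_entries, D.adjoin_v]) ⟨1, 1, 1, .one⟩ (fun p => ?_) ?_
  · have h : v p.1 p.2 = ∑ a ∈ Q.supp, ∑ b ∈ Q.supp, Q.comp v a b p.1 p.2 := by
      conv_lhs => rw [← Q.sum_comp v]
      simp only [Matrix.sum_apply]
    rw [h]
    exact sum_mem fun a _ => sum_mem fun b _ => Submodule.subset_span ⟨a, b, _, .gen a b _ _⟩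
  · rintro y ⟨a, b, x, h⟩ y' ⟨c, d, x', h'⟩
    -- It is the deformed product that forms a pair, but its scalar is invertible.
    rw [← inv_smul_smul₀ (Circle.coe_ne_zero (β (a⁻¹ * b) c⁻¹)) (y * y')]
    exact Submodule.smul_mem _ _ (Submodule.subset_span ⟨_, _, _, h.mul h'⟩)

/-- Linear identities on B, and by `ext_snd` on H, thus need to be checked only on pairs. -/
theorem ext_fst {M : Type*} [AddCommGroup M] [Module ℂ M] {f g : B →ₗ[ℂ] M}
    (h : ∀ a b x y, Pair β Q u v a b x y → f x = g x) : f = g :=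
  LinearMap.ext_on D.span_fst fun x ⟨a, b, y, hx⟩ => h a b x y hx

theorem ext_snd {M : Type*} [AddCommGroup M] [Module ℂ M] {f g : H →ₗ[ℂ] M}
    (h : ∀ a b x y, Pair β Q u v a b x y → f y = g y) : f = g :=
  LinearMap.ext_on D.span_snd fun y ⟨a, b, x, hx⟩ => h a b x y hx

/-- The scalar in the constructor `mul` of `Pair` is the cocycle of the twisted group algebra, so
products match. -/
theorem toTwist_of_pair {a b : Γ} {x : B} {y : H} (h : Pair β Q u v a b x y) :
    D.toTwist x = y ⊗ₜ[ℂ] TwistedGroupAlg.basisVec (transBichar β) (a, b) := by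
  induction h with
  | one => rw [map_one]; rfl
  | gen a b i j =>
    refine (Q.map_comp D.toTwist.toAlgHom.toLinearMap u a b i j).trans ?_
    refine (congrArg (fun M => Q.comp M a b i j) D.toTwist_u).trans ?_
    rw [Q.comp_twist, Matrix.map_apply, TwistedGroupAlg.basisVec_mul]
    simp [transBichar_apply]
  | mul h h' hx hx' =>
    rw [map_mul, hx, hx', Algebra.TensorProduct.tmul_mul_tmul, TwistedGroupAlg.basisVec_mul,
      TensorProduct.tmul_smul, TensorProduct.smul_tmul']
    rfl

theorem ofTwist_of_pair {a b : Γ} {x : B} {y : H} (h : Pair β Q u v a b x y) :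
    D.ofTwist y = x ⊗ₜ[ℂ] TwistedGroupAlg.basisVec (transBichar β)⁻¹ (a, b) := by
  induction h with
  | one => rw [map_one]; rfl
  | gen a b i j =>
    refine (Q.map_comp D.ofTwist.toAlgHom.toLinearMap v a b i j).trans ?_
    refine (congrArg (fun M => Q.comp M a b i j) D.ofTwist_v).trans ?_
    rw [Q.comp_twist, Matrix.map_apply, TwistedGroupAlg.basisVec_mul]
    simp [transBichar_apply]
  | mul h h' hx hx' =>
    refine (map_smul D.ofTwist _ _).trans ?_
    rw [map_mul D.ofTwist, hx, hx', Algebra.TensorProduct.tmul_mul_tmul,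
      TwistedGroupAlg.basisVec_mul, TensorProduct.tmul_smul, smul_smul]
    rename_i a b c d _ _ _ _
    have h3 : (transBichar β)⁻¹ (a, b) (c, d) = (β (a⁻¹ * b) c⁻¹)⁻¹ := rfl
    rw [h3, ← Circle.coe_mul, mul_inv_cancel, Circle.coe_one, one_smul]
    rfl

theorem mem_bihomogeneous_of_pair {a b : Γ} {x : B} {y : H} (h : Pair β Q u v a b x y) :
    y ∈ bihomogeneous D.hopf D.proj a b := by
  induction h with
  | one => exact one_mem_bihomogeneous
  | gen a b i j =>
    constructor
    · refine (TensorProduct.comm ℂ _ _).injective ?_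
      let f : H →ₗ[ℂ] H ⊗[ℂ] MonoidAlgebra ℂ Γ := (TensorProduct.comm ℂ _ _).toLinearMap ∘ₗ
        D.proj.toAlgHom.toLinearMap.rTensor H ∘ₗ D.hopf.comul.toAlgHom.toLinearMap
      have h : v.map f = Q.twist (fun a => MonoidAlgebra.single a (1 : ℂ)) 1 v := by
        ext1 i j
        rw [SpectralFamily.twist, Q.expand_one, Matrix.map_one _ (map_zero _) (map_one _), mul_one]
        simp [f, D.comul_v, D.proj_v, Matrix.mul_apply, SpectralFamily.toMatrix]
      refine (Q.map_comp f v a b i j).trans ?_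
      rw [h, Q.comp_twist]
      simp
    · let f : H →ₗ[ℂ] H ⊗[ℂ] MonoidAlgebra ℂ Γ :=
        D.proj.toAlgHom.toLinearMap.lTensor H ∘ₗ D.hopf.comul.toAlgHom.toLinearMap
      have h : v.map f = Q.twist 1 (fun a => MonoidAlgebra.single a (1 : ℂ)) v := by
        ext1 i j
        rw [SpectralFamily.twist, Q.expand_one, Matrix.map_one _ (map_zero _) (map_one _)]
        simp [f, D.comul_v, D.proj_v, Matrix.mul_apply, SpectralFamily.toMatrix]
      refine (Q.map_comp f v a b i j).trans ?_
      rw [h, Q.comp_twist]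
      simp
  | mul h h' hx hx' => exact smul_mem_bihomogeneous _ (mul_mem_bihomogeneous hx hx')

theorem coact_of_pair {a b : Γ} {x : B} {y : H} (h : Pair β Q u v a b x y) :
    D.coact x = x ⊗ₜ[ℂ] MonoidAlgebra.single (a⁻¹ * b) (1 : ℂ) := by
  induction h with
  | one => rw [map_one]; simp [Algebra.TensorProduct.one_def, MonoidAlgebra.one_def]
  | gen a b i j =>
    refine (Q.map_comp D.coact.toAlgHom.toLinearMap u a b i j).trans ?_
    refine (congrArg (fun M => Q.comp M a b i j) D.coact_u).trans ?_
    rw [Q.comp_twist, Matrix.map_apply, single_mul_single_one]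
  | mul h h' hx hx' =>
    rw [map_mul, hx, hx', Algebra.TensorProduct.tmul_mul_tmul, single_mul_single_one, mul_inv,
      mul_mul_mul_comm]

/-- On generators, Δ(v_{ab}) = ∑ v_{ae} ⊗ v_{eb}. The same inner degree e in both legs is what later
makes the braiding scalars independent of e. -/
theorem comul_mem_of_pair {a b : Γ} {x : B} {y : H} (h : Pair β Q u v a b x y) :
    D.hopf.comul y ∈ Submodule.span ℂ {t | ∃ e x₁ y₁ x₂ y₂, Pair β Q u v a e x₁ y₁ ∧
      Pair β Q u v e b x₂ y₂ ∧ t = y₁ ⊗ₜ[ℂ] y₂} := by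
  induction h with
  | one =>
    rw [map_one]
    exact Submodule.subset_span ⟨1, 1, 1, 1, 1, .one, .one, rfl⟩
  | gen a b i j =>
    let f : H →ₐ[ℂ] H ⊗[ℂ] H := Algebra.TensorProduct.includeLeft
    let g : H →ₐ[ℂ] H ⊗[ℂ] H := Algebra.TensorProduct.includeRight
    have h : v.map D.hopf.comul.toAlgHom.toLinearMap =
        v.map f.toLinearMap * v.map g.toLinearMap := by
      ext1 i j
      simp [f, g, Matrix.mul_apply, D.comul_v]
    have h1 : D.hopf.comul (Q.comp v a b i j) = ∑ e ∈ Q.supp, ∑ k,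
        Q.comp v a e i k ⊗ₜ[ℂ] Q.comp v e b k j := by
      refine (Q.map_comp D.hopf.comul.toAlgHom.toLinearMap v a b i j).trans ?_
      rw [h, Q.comp_mul, Matrix.sum_apply]
      refine Finset.sum_congr rfl fun e _ => ?_
      rw [Matrix.mul_apply]
      refine Finset.sum_congr rfl fun k _ => ?_
      rw [← Q.map_comp, ← Q.map_comp]
      simp [f, g]
    rw [h1]
    exact sum_mem fun e _ => sum_mem fun k _ =>
      Submodule.subset_span ⟨e, _, _, _, _, .gen _ _ _ _, .gen _ _ _ _, rfl⟩
  | mul h h' hx hx' =>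
    rename_i a b c d _ _ _ _
    rw [map_smul, map_mul D.hopf.comul]
    refine Submodule.smul_mem _ _ ?_
    have h2 := Submodule.mul_mem_mul hx hx'
    rw [Submodule.span_mul_span] at h2
    refine Submodule.span_le.2 ?_ h2
    rintro _ ⟨_, ⟨e, x₁, y₁, x₂, y₂, h₁, h₂, rfl⟩, _, ⟨f, x₁', y₁', x₂', y₂', h₁', h₂', rfl⟩, rfl⟩
    have h3 : ∀ (c c' : Circle) (p q : H),
        p ⊗ₜ[ℂ] q = ((c : ℂ) * c')⁻¹ • (((c : ℂ) • p) ⊗ₜ[ℂ] ((c' : ℂ) • q)) := fun c c' p q => by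
      rw [TensorProduct.smul_tmul_smul,
        inv_smul_smul₀ (mul_ne_zero (Circle.coe_ne_zero c) (Circle.coe_ne_zero c'))]
    simp only [Algebra.TensorProduct.tmul_mul_tmul]
    -- These are the deformation scalars of the two legs, inserted so that each leg is a member of a
    -- pair.
    rw [h3 (β (a⁻¹ * e) c⁻¹) (β (e⁻¹ * b) f⁻¹)]
    exact Submodule.smul_mem _ _
      (Submodule.subset_span ⟨_, _, _, _, _, h₁.mul h₁', h₂.mul h₂', rfl⟩)

theorem counit_of_pair {a b : Γ} {x : B} {y : H} (h : Pair β Q u v a b x y) :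
    D.counit x = D.hopf.counit y := by
  induction h with
  | one => rw [map_one, map_one]
  | gen a b i j =>
    have h1 : u.map D.counit.toAlgHom.toLinearMap = 1 := by
      ext1 i j
      exact D.counit_u i j
    have h2 : v.map D.hopf.counit.toAlgHom.toLinearMap = 1 := by
      ext1 i j
      exact D.counit_v i j
    refine (Q.map_comp D.counit.toAlgHom.toLinearMap u a b i j).trans ?_
    refine Eq.trans ?_ (Q.map_comp D.hopf.counit.toAlgHom.toLinearMap v a b i j).symm
    rw [h1, h2]
  | mul h h' hx hx' =>
    rename_i a b c d _ _ _ _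
    rw [map_mul D.counit, map_smul, map_mul D.hopf.counit, hx, hx']
    -- For a = b the scalar β(a⁻¹b, c⁻¹) is 1; otherwise the counit vanishes on y.
    by_cases hab : a = b
    · subst hab
      simp
    · rw [counit_eq_zero_of_mem (D.mem_bihomogeneous_of_pair h) hab]
      simp

theorem hopf_antipode_comp (a b : Γ) (i j : Fin m) :
    D.hopf.antipode (Q.comp v a b i j) = star (Q.comp v b a j i) := by
  rw [Q.comp_apply, Q.comp_apply, Finset.sum_comm]
  simp only [map_sum, map_smul, D.antipode_v, star_sum, star_smul]
  refine Finset.sum_congr rfl fun s _ => Finset.sum_congr rfl fun t _ => ?_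
  rw [star_mul', Q.proj_apply_star, Q.proj_apply_star, mul_comm]

theorem antipode_mem_of_pair {a b : Γ} {x : B} {y : H} (h : Pair β Q u v a b x y) :
    D.hopf.antipode y ∈ bihomogeneous D.hopf D.proj b⁻¹ a⁻¹ := by
  induction h with
  | one =>
    rw [D.antipode_one, inv_one]
    exact one_mem_bihomogeneous
  | gen a b i j =>
    rw [D.hopf_antipode_comp]
    exact star_mem_bihomogeneous (D.mem_bihomogeneous_of_pair (.gen b a j i))
  | mul h h' hx hx' =>
    rw [map_smul, D.antipode_mul, mul_inv_rev, mul_inv_rev]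
    exact smul_mem_bihomogeneous _ (mul_mem_bihomogeneous hx' hx)

end TransmutationData

/-- The linear map on `ℂΓ ⊗ ℂΓ` with given values on `Γ × Γ`. -/
def groupAlgLift₂ {Γ : Type*} [CommGroup Γ] {M : Type*} [AddCommGroup M] [Module ℂ M]
    (f : Γ → Γ → M) : MonoidAlgebra ℂ Γ ⊗[ℂ] MonoidAlgebra ℂ Γ →ₗ[ℂ] M :=
  TensorProduct.lift ((Finsupp.linearCombination ℂ fun a : Γ =>
    (Finsupp.linearCombination ℂ (f a)) ∘ₗ (MonoidAlgebra.coeffLinearEquiv ℂ).toLinearMap) ∘ₗ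
      (MonoidAlgebra.coeffLinearEquiv ℂ).toLinearMap)

theorem groupAlgLift₂_single {Γ : Type*} [CommGroup Γ] {M : Type*} [AddCommGroup M] [Module ℂ M]
    (f : Γ → Γ → M) (a b : Γ) : groupAlgLift₂ f
      (MonoidAlgebra.single a (1 : ℂ) ⊗ₜ[ℂ] MonoidAlgebra.single b (1 : ℂ)) = f a b := by
  simp [groupAlgLift₂]

/-! ### The linear isomorphism and the transported structure -/

namespace TransmutationData

variable {Γ : Type*} [CommGroup Γ] {m : ℕ} {β : Bichar Γ} {Q : SpectralFamily Γ m}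
variable {B H : Type*} [Ring B] [Algebra ℂ B] [StarRing B] [StarModule ℂ B]
variable [Ring H] [Algebra ℂ H] [StarRing H] [StarModule ℂ H]
variable {u : Matrix (Fin m) (Fin m) B} {v : Matrix (Fin m) (Fin m) H}
variable (D : TransmutationData β Q u v)

/-- The linear map `M ⊗ ℂ_σ → M` with `x ⊗ e_g ↦ x`. -/
def forget {G : Type*} [CommGroup G] (σ : Bichar G) (M : Type*) [AddCommGroup M] [Module ℂ M] :
    M ⊗[ℂ] TwistedGroupAlg σ →ₗ[ℂ] M :=
  (TensorProduct.rid ℂ M).toLinearMap ∘ₗ (TwistedGroupAlg.lift σ fun _ => (1 : ℂ)).lTensor M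

theorem forget_tmul {G : Type*} [CommGroup G] (σ : Bichar G) {M : Type*} [AddCommGroup M]
    [Module ℂ M] (x : M) (g : G) : forget σ M (x ⊗ₜ TwistedGroupAlg.basisVec σ g) = x := by
  simp [forget, TwistedGroupAlg.lift_basisVec]

/-- The linear isomorphism that identifies corresponding homogeneous elements. -/
def equiv : B ≃ₗ[ℂ] H :=
  LinearEquiv.ofLinearMap (forget (transBichar β) H ∘ₗ D.toTwist.toAlgHom.toLinearMap)
    (forget (transBichar β)⁻¹ B ∘ₗ D.ofTwist.toAlgHom.toLinearMap)
    (D.ext_snd fun a b x y h => by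
      have h1 : D.ofTwist.toAlgHom.toLinearMap y = _ := D.ofTwist_of_pair h
      have h2 : D.toTwist.toAlgHom.toLinearMap x = _ := D.toTwist_of_pair h
      rw [LinearMap.comp_apply, LinearMap.comp_apply, LinearMap.comp_apply, h1, forget_tmul, h2,
        forget_tmul, LinearMap.id_apply])
    (D.ext_fst fun a b x y h => by
      have h1 : D.ofTwist.toAlgHom.toLinearMap y = _ := D.ofTwist_of_pair h
      have h2 : D.toTwist.toAlgHom.toLinearMap x = _ := D.toTwist_of_pair h
      rw [LinearMap.comp_apply, LinearMap.comp_apply, LinearMap.comp_apply, h2, forget_tmul, h1,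
        forget_tmul, LinearMap.id_apply])

theorem equiv_apply (x : B) : D.equiv x = forget (transBichar β) H (D.toTwist x) := rfl

theorem equiv_of_pair {a b : Γ} {x : B} {y : H} (h : Pair β Q u v a b x y) : D.equiv x = y := by
  rw [equiv_apply, D.toTwist_of_pair h, forget_tmul]

theorem equiv_symm_of_pair {a b : Γ} {x : B} {y : H} (h : Pair β Q u v a b x y) :
    D.equiv.symm y = x := by
  rw [LinearEquiv.symm_apply_eq, D.equiv_of_pair h]

variable {a b c d : Γ} {x y : B}

/-- On pairs, `toTwist` is the map that records the two degrees, read through Φ. This is an identity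
of linear maps, so it can be evaluated at any bihomogeneous element, as the description of the
transmutation demands. -/
theorem toTwist_of_mem (hx : D.equiv x ∈ bihomogeneous D.hopf D.proj a b) :
    D.toTwist x = D.equiv x ⊗ₜ[ℂ] TwistedGroupAlg.basisVec (transBichar β) (a, b) := by
  have h : D.toTwist.toAlgHom.toLinearMap = bigradedMap D.hopf D.proj
      (groupAlgLift₂ fun a b => TwistedGroupAlg.basisVec (transBichar β) (a, b)) ∘ₗ
        D.equiv.toLinearMap :=
    D.ext_fst fun a b x y h => by
      refine (D.toTwist_of_pair h).trans ?_
      rw [LinearMap.comp_apply, LinearEquiv.coe_coe, D.equiv_of_pair h,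
        bigradedMap_of_mem _ (D.mem_bihomogeneous_of_pair h), groupAlgLift₂_single]
  refine (LinearMap.congr_fun h x).trans ?_
  rw [LinearMap.comp_apply, LinearEquiv.coe_coe, bigradedMap_of_mem _ hx, groupAlgLift₂_single]

theorem equiv_one : D.equiv 1 = 1 := D.equiv_of_pair .one

theorem equiv_mul (hx : D.equiv x ∈ bihomogeneous D.hopf D.proj a b)
    (hy : D.equiv y ∈ bihomogeneous D.hopf D.proj c d) :
    D.equiv (x * y) = (β (a⁻¹ * b) c⁻¹ : ℂ) • (D.equiv x * D.equiv y) := by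
  rw [equiv_apply, map_mul, D.toTwist_of_mem hx, D.toTwist_of_mem hy,
    Algebra.TensorProduct.tmul_mul_tmul, TwistedGroupAlg.basisVec_mul, TensorProduct.tmul_smul,
    map_smul, forget_tmul]
  rfl

theorem equiv_star (hx : D.equiv x ∈ bihomogeneous D.hopf D.proj a b) :
    D.equiv (star x) = (β (a⁻¹ * b) a⁻¹ : ℂ) • star (D.equiv x) := by
  rw [equiv_apply, map_star, D.toTwist_of_mem hx, TensorProduct.star_tmul,
    TwistedGroupAlg.star_basisVec, TensorProduct.tmul_smul, map_smul, forget_tmul]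
  rfl

theorem equiv_star_mem (hx : D.equiv x ∈ bihomogeneous D.hopf D.proj a b) :
    D.equiv (star x) ∈ bihomogeneous D.hopf D.proj a⁻¹ b⁻¹ := by
  rw [D.equiv_star hx]
  exact smul_mem_bihomogeneous _ (star_mem_bihomogeneous hx)

theorem equiv_coact (x : B) : D.equiv.toLinearMap.rTensor (MonoidAlgebra ℂ Γ) (D.coact x) =
    adCoact D.hopf D.proj (D.equiv x) := by
  have h : D.equiv.toLinearMap.rTensor (MonoidAlgebra ℂ Γ) ∘ₗ D.coact.toAlgHom.toLinearMap =
      adCoact D.hopf D.proj ∘ₗ D.equiv.toLinearMap :=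
    D.ext_fst fun a b x y h => by
      have h1 : D.coact.toAlgHom.toLinearMap x = _ := D.coact_of_pair h
      rw [LinearMap.comp_apply, LinearMap.comp_apply, h1, LinearMap.rTensor_tmul,
        LinearEquiv.coe_coe, D.equiv_of_pair h,
        adCoact_of_mem D.proj_antipode (D.mem_bihomogeneous_of_pair h)]
  exact LinearMap.congr_fun h x

theorem coact_of_mem (hx : D.equiv x ∈ bihomogeneous D.hopf D.proj a b) :
    D.coact x = x ⊗ₜ[ℂ] MonoidAlgebra.single (a⁻¹ * b) (1 : ℂ) := by
  have h := D.equiv_coact x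
  rw [adCoact_of_mem D.proj_antipode hx] at h
  have h1 := congrArg (D.equiv.symm.toLinearMap.rTensor (MonoidAlgebra ℂ Γ)) h
  rw [← LinearMap.comp_apply, ← LinearMap.rTensor_comp] at h1
  simpa using h1

/-- The degrees of S(y) are known on pairs. Written as identities of linear maps in y, with S ⊗
inversion and a flip, they extend to all bihomogeneous elements. -/
theorem hopf_antipode_mem {y : H} (hy : y ∈ bihomogeneous D.hopf D.proj a b) :
    D.hopf.antipode y ∈ bihomogeneous D.hopf D.proj b⁻¹ a⁻¹ := by
  have h1 : D.proj.toAlgHom.toLinearMap.rTensor H ∘ₗ D.hopf.comul.toAlgHom.toLinearMap ∘ₗ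
      D.hopf.antipode = (TensorProduct.comm ℂ _ _).toLinearMap ∘ₗ
        TensorProduct.map D.hopf.antipode (groupAlgInv Γ).toLinearMap ∘ₗ
        D.proj.toAlgHom.toLinearMap.lTensor H ∘ₗ D.hopf.comul.toAlgHom.toLinearMap :=
    D.ext_snd fun a b x y h => by
      refine (D.antipode_mem_of_pair h).1.trans ?_
      have h2 : D.proj.toAlgHom.toLinearMap.lTensor H (D.hopf.comul.toAlgHom.toLinearMap y) = _ :=
        (D.mem_bihomogeneous_of_pair h).2
      simp only [LinearMap.comp_apply, h2]
      simp [groupAlgInv_single]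
  have h2 : D.proj.toAlgHom.toLinearMap.lTensor H ∘ₗ D.hopf.comul.toAlgHom.toLinearMap ∘ₗ
      D.hopf.antipode = (TensorProduct.comm ℂ _ _).toLinearMap ∘ₗ
        TensorProduct.map (groupAlgInv Γ).toLinearMap D.hopf.antipode ∘ₗ
        D.proj.toAlgHom.toLinearMap.rTensor H ∘ₗ D.hopf.comul.toAlgHom.toLinearMap :=
    D.ext_snd fun a b x y h => by
      refine (D.antipode_mem_of_pair h).2.trans ?_
      have h2 : D.proj.toAlgHom.toLinearMap.rTensor H (D.hopf.comul.toAlgHom.toLinearMap y) = _ :=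
        (D.mem_bihomogeneous_of_pair h).1
      simp only [LinearMap.comp_apply, h2]
      simp [groupAlgInv_single]
  constructor
  · refine (LinearMap.congr_fun h1 y).trans ?_
    have h3 : D.proj.toAlgHom.toLinearMap.lTensor H (D.hopf.comul.toAlgHom.toLinearMap y) = _ := hy.2
    simp only [LinearMap.comp_apply, h3]
    simp [groupAlgInv_single]
  · refine (LinearMap.congr_fun h2 y).trans ?_
    have h3 : D.proj.toAlgHom.toLinearMap.rTensor H (D.hopf.comul.toAlgHom.toLinearMap y) = _ := hy.1
    simp only [LinearMap.comp_apply, h3]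
    simp [groupAlgInv_single]

/-- The antipode of the braided Hopf `*`-algebra. -/
def antipode : B →ₗ[ℂ] B :=
  D.equiv.symm.toLinearMap ∘ₗ D.hopf.antipode ∘ₗ (TensorProduct.rid ℂ H).toLinearMap ∘ₗ
    bigradedMap D.hopf D.proj (groupAlgLift₂ fun a b => (β (a⁻¹ * b) b : ℂ)) ∘ₗ D.equiv.toLinearMap

theorem equiv_antipode (hx : D.equiv x ∈ bihomogeneous D.hopf D.proj a b) :
    D.equiv (D.antipode x) = (β (a⁻¹ * b) b : ℂ) • D.hopf.antipode (D.equiv x) := by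
  simp only [antipode, LinearMap.comp_apply, LinearEquiv.coe_coe, LinearEquiv.apply_symm_apply,
    bigradedMap_of_mem _ hx, groupAlgLift₂_single, TensorProduct.rid_tmul, map_smul]

theorem equiv_antipode_mem (hx : D.equiv x ∈ bihomogeneous D.hopf D.proj a b) :
    D.equiv (D.antipode x) ∈ bihomogeneous D.hopf D.proj b⁻¹ a⁻¹ := by
  rw [D.equiv_antipode hx]
  exact smul_mem_bihomogeneous _ (D.hopf_antipode_mem hx)

/-- The comultiplication of the braided Hopf `*`-algebra. -/
def comul : B →ₗ[ℂ] B ⊗[ℂ] B :=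
  TensorProduct.map D.equiv.symm.toLinearMap D.equiv.symm.toLinearMap ∘ₗ
    D.hopf.comul.toAlgHom.toLinearMap ∘ₗ D.equiv.toLinearMap

theorem equiv_comul (x : B) :
    TensorProduct.map D.equiv.toLinearMap D.equiv.toLinearMap (D.comul x) =
      D.hopf.comul (D.equiv x) := by
  rw [comul, LinearMap.comp_apply, ← LinearMap.comp_apply, ← TensorProduct.map_comp]
  simp

theorem mem_of_pair {a b : Γ} {x : B} {y : H} (h : Pair β Q u v a b x y) :
    D.equiv x ∈ bihomogeneous D.hopf D.proj a b := by
  rw [D.equiv_of_pair h]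
  exact D.mem_bihomogeneous_of_pair h

/-- The span of the tensors `x₁ ⊗ x₂` of homogeneous elements of degrees `(a, e)` and `(e, b)`. -/
def tensors (a b : Γ) : Submodule ℂ (B ⊗[ℂ] B) :=
  Submodule.span ℂ {t | ∃ e x₁ x₂, D.equiv x₁ ∈ bihomogeneous D.hopf D.proj a e ∧
    D.equiv x₂ ∈ bihomogeneous D.hopf D.proj e b ∧ t = x₁ ⊗ₜ[ℂ] x₂}

theorem comul_mem_tensors {y : H} (h : Pair β Q u v a b x y) : D.comul x ∈ D.tensors a b := by
  have h1 := Submodule.mem_map_of_mem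
    (f := TensorProduct.map D.equiv.symm.toLinearMap D.equiv.symm.toLinearMap)
    (D.comul_mem_of_pair h)
  rw [Submodule.map_span] at h1
  rw [comul, LinearMap.comp_apply, LinearMap.comp_apply, LinearEquiv.coe_coe, D.equiv_of_pair h]
  refine Submodule.span_mono ?_ h1
  rintro _ ⟨_, ⟨e, x₁, y₁, x₂, y₂, h₁, h₂, rfl⟩, rfl⟩
  refine ⟨e, x₁, x₂, D.mem_of_pair h₁, D.mem_of_pair h₂, ?_⟩
  rw [TensorProduct.map_tmul, LinearEquiv.coe_coe, D.equiv_symm_of_pair h₁,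
    D.equiv_symm_of_pair h₂]

end TransmutationData

/-! ### Bilinearity of the braided product and homogeneous tensors -/

section Linearity

variable {Γ : Type*} [CommGroup Γ] (β : Bichar Γ)
variable {A B : Type*} [Ring A] [Algebra ℂ A] [Ring B] [Algebra ℂ B]
variable (δA : A →ₗ[ℂ] A ⊗[ℂ] MonoidAlgebra ℂ Γ) (δB : B →ₗ[ℂ] B ⊗[ℂ] MonoidAlgebra ℂ Γ)

theorem braidedMul_add (x y z : A ⊗[ℂ] B) :
    braidedMul β δA δB x (y + z) = braidedMul β δA δB x y + braidedMul β δA δB x z := by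
  simp only [braidedMul, TensorProduct.tmul_add, map_add]

theorem add_braidedMul (x y z : A ⊗[ℂ] B) :
    braidedMul β δA δB (x + y) z = braidedMul β δA δB x z + braidedMul β δA δB y z := by
  simp only [braidedMul, TensorProduct.add_tmul, map_add]

theorem braidedMul_smul (c : ℂ) (x y : A ⊗[ℂ] B) :
    braidedMul β δA δB x (c • y) = c • braidedMul β δA δB x y := by
  simp only [braidedMul, TensorProduct.tmul_smul, map_smul]

theorem smul_braidedMul (c : ℂ) (x y : A ⊗[ℂ] B) :
    braidedMul β δA δB (c • x) y = c • braidedMul β δA δB x y := by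
  simp only [braidedMul, ← TensorProduct.smul_tmul', map_smul]

theorem braidedMul_zero (x : A ⊗[ℂ] B) : braidedMul β δA δB x 0 = 0 := by
  rw [← zero_smul ℂ (0 : A ⊗[ℂ] B), braidedMul_smul, zero_smul, zero_smul]

theorem zero_braidedMul (x : A ⊗[ℂ] B) : braidedMul β δA δB 0 x = 0 := by
  rw [← zero_smul ℂ (0 : A ⊗[ℂ] B), smul_braidedMul, zero_smul, zero_smul]

variable [StarRing A] [StarModule ℂ A] [StarRing B] [StarModule ℂ B]

theorem braidedStar_add (x y : A ⊗[ℂ] B) :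
    braidedStar β δA δB (x + y) = braidedStar β δA δB x + braidedStar β δA δB y := by
  simp only [braidedStar, star_add, map_add]

theorem braidedStar_smul (c : ℂ) (x : A ⊗[ℂ] B) :
    braidedStar β δA δB (c • x) = star c • braidedStar β δA δB x := by
  simp only [braidedStar, star_smul, map_smul]

theorem braidedStar_tmul_of_homogeneous {a : A} {b : B} {g h : Γ}
    (ha : δA (star a) = star a ⊗ₜ MonoidAlgebra.single g 1)
    (hb : δB (star b) = star b ⊗ₜ MonoidAlgebra.single h 1) :
    braidedStar β δA δB (a ⊗ₜ b) = (β h g : ℂ) • (star a ⊗ₜ[ℂ] star b) := by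
  rw [braidedStar, TensorProduct.star_tmul, TensorProduct.comm_tmul,
    braiding_tmul_of_homogeneous β hb ha]

end Linearity

theorem tensorCoact_tmul_of_homogeneous {Γ : Type*} [CommGroup Γ] {M N : Type*} [AddCommGroup M]
    [Module ℂ M] [AddCommGroup N] [Module ℂ N] {δM : M →ₗ[ℂ] M ⊗[ℂ] MonoidAlgebra ℂ Γ}
    {δN : N →ₗ[ℂ] N ⊗[ℂ] MonoidAlgebra ℂ Γ} {x : M} {y : N} {g h : Γ}
    (hx : δM x = x ⊗ₜ MonoidAlgebra.single g 1) (hy : δN y = y ⊗ₜ MonoidAlgebra.single h 1) :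
    tensorCoact δM δN (x ⊗ₜ y) = (x ⊗ₜ[ℂ] y) ⊗ₜ[ℂ] MonoidAlgebra.single (g * h) (1 : ℂ) := by
  simp [tensorCoact, hx, hy, MonoidAlgebra.single_mul_single]

/-! ### The braided Hopf *-algebra axioms -/

namespace TransmutationData

variable {Γ : Type*} [CommGroup Γ] {m : ℕ} {β : Bichar Γ} {Q : SpectralFamily Γ m}
variable {B H : Type*} [Ring B] [Algebra ℂ B] [StarRing B] [StarModule ℂ B]
variable [Ring H] [Algebra ℂ H] [StarRing H] [StarModule ℂ H]
variable {u : Matrix (Fin m) (Fin m) B} {v : Matrix (Fin m) (Fin m) H}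
variable (D : TransmutationData β Q u v) {a b c d : Γ} {x y : B}

include D in
theorem induction {p : B → Prop} (x : B)
    (h : ∀ a b x y, Pair β Q u v a b x y → p x) (hadd : ∀ x y, p x → p y → p (x + y))
    (hsmul : ∀ (c : ℂ) x, p x → p (c • x)) : p x := by
  have hx : x ∈ Submodule.span ℂ {x : B | ∃ a b y, Pair β Q u v a b x y} := by
    rw [D.span_fst]
    trivial
  induction hx using Submodule.span_induction with
  | mem x hx =>
    obtain ⟨a, b, y, hx⟩ := hx
    exact h a b x y hx
  | zero =>
    have := hsmul 0 1 (h 1 1 1 1 .one)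
    rwa [zero_smul] at this
  | add x y _ _ hx hy => exact hadd x y hx hy
  | smul c x _ hx => exact hsmul c x hx

theorem map_equiv_injective :
    Function.Injective (TensorProduct.map D.equiv.toLinearMap D.equiv.toLinearMap) :=
  (TensorProduct.congr D.equiv D.equiv).injective

/-- For legs of degrees (a,e), (e,b) and (c,f), (f,d), the braiding contributes β(e⁻¹b, c⁻¹f) and
the two products contribute β(a⁻¹e, c⁻¹) and β(e⁻¹b, f⁻¹). Their product is β(a⁻¹b, c⁻¹), the scalar
of the product in B, with e and f gone. -/
theorem map_equiv_braidedMul {s t : B ⊗[ℂ] B} (hs : s ∈ D.tensors a b) (ht : t ∈ D.tensors c d) :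
    TensorProduct.map D.equiv.toLinearMap D.equiv.toLinearMap
      (braidedMul β D.coact.toAlgHom.toLinearMap D.coact.toAlgHom.toLinearMap s t) =
    (β (a⁻¹ * b) c⁻¹ : ℂ) • (TensorProduct.map D.equiv.toLinearMap D.equiv.toLinearMap s *
      TensorProduct.map D.equiv.toLinearMap D.equiv.toLinearMap t) := by
  induction hs, ht using Submodule.span_induction₂ with
  | mem_mem s t hs ht =>
    obtain ⟨e, x₁, x₂, h₁, h₂, rfl⟩ := hs
    obtain ⟨f, y₁, y₂, k₁, k₂, rfl⟩ := ht
    rw [braidedMul_tmul_of_homogeneous β (D.coact_of_mem h₂) (D.coact_of_mem k₁), map_smul]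
    simp only [TensorProduct.map_tmul, LinearEquiv.coe_coe, D.equiv_mul h₁ k₁, D.equiv_mul h₂ k₂,
      TensorProduct.smul_tmul_smul, smul_smul, Algebra.TensorProduct.tmul_mul_tmul,
      ← Circle.coe_mul]
    refine congrArg (fun c : Circle => (c : ℂ) • _) ?_
    simp only [map_mul, map_inv, MonoidHom.mul_apply, MonoidHom.inv_apply]
    refine Additive.ofMul.injective ?_
    simp only [ofMul_mul, ofMul_inv]
    abel
  | zero_left t ht => simp [zero_braidedMul]
  | zero_right s hs => simp [braidedMul_zero]
  | add_left s s' t _ _ _ hs hs' => simp only [add_braidedMul, map_add, hs, hs', add_mul, smul_add]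
  | add_right s t t' _ _ _ ht ht' => simp only [braidedMul_add, map_add, ht, ht', mul_add, smul_add]
  | smul_left c s t _ _ hs =>
    simp only [smul_braidedMul, map_smul, hs, smul_mul_assoc]
    rw [smul_comm]
  | smul_right c s t _ _ hs =>
    simp only [braidedMul_smul, map_smul, hs, mul_smul_comm]
    rw [smul_comm]

theorem comul_mul (x y : B) : D.comul (x * y) =
    braidedMul β D.coact.toAlgHom.toLinearMap D.coact.toAlgHom.toLinearMap (D.comul x)
      (D.comul y) := by
  refine D.induction (p := fun x => D.comul (x * y) = braidedMul β D.coact.toAlgHom.toLinearMap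
    D.coact.toAlgHom.toLinearMap (D.comul x) (D.comul y)) x (fun a b x x' hx => ?_)
    (fun x y hx hy => by rw [add_mul, map_add, map_add, hx, hy, add_braidedMul])
    (fun c x hx => by rw [smul_mul_assoc, map_smul, map_smul, hx, smul_braidedMul])
  refine D.induction (p := fun y => D.comul (x * y) = braidedMul β D.coact.toAlgHom.toLinearMap
    D.coact.toAlgHom.toLinearMap (D.comul x) (D.comul y)) y (fun c d y y' hy => ?_)
    (fun x y hx hy => by rw [mul_add, map_add, map_add, hx, hy, braidedMul_add])
    (fun c x hx => by rw [mul_smul_comm, map_smul, map_smul, hx, braidedMul_smul])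
  refine D.map_equiv_injective ?_
  rw [D.map_equiv_braidedMul (D.comul_mem_tensors hx) (D.comul_mem_tensors hy), equiv_comul,
    equiv_comul, equiv_comul, D.equiv_mul (D.mem_of_pair hx) (D.mem_of_pair hy), map_smul,
    map_mul D.hopf.comul]

/-- The braiding contributes β(eb⁻¹, ae⁻¹), the involutions β(a⁻¹e, a⁻¹) and β(e⁻¹b, e⁻¹); the
product is β(a⁻¹b, a⁻¹). -/
theorem map_equiv_braidedStar {s : B ⊗[ℂ] B} (hs : s ∈ D.tensors a b) :
    TensorProduct.map D.equiv.toLinearMap D.equiv.toLinearMap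
      (braidedStar β D.coact.toAlgHom.toLinearMap D.coact.toAlgHom.toLinearMap s) =
    (β (a⁻¹ * b) a⁻¹ : ℂ) • star (TensorProduct.map D.equiv.toLinearMap D.equiv.toLinearMap s) := by
  induction hs using Submodule.span_induction with
  | mem s hs =>
    obtain ⟨e, x₁, x₂, h₁, h₂, rfl⟩ := hs
    rw [braidedStar_tmul_of_homogeneous β _ _ (D.coact_of_mem (D.equiv_star_mem h₁))
      (D.coact_of_mem (D.equiv_star_mem h₂)), map_smul]
    simp only [TensorProduct.map_tmul, LinearEquiv.coe_coe, D.equiv_star h₁, D.equiv_star h₂,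
      TensorProduct.smul_tmul_smul, smul_smul, TensorProduct.star_tmul, ← Circle.coe_mul]
    refine congrArg (fun c : Circle => (c : ℂ) • _) ?_
    simp only [map_mul, map_inv, MonoidHom.mul_apply, MonoidHom.inv_apply]
    refine Additive.ofMul.injective ?_
    simp only [ofMul_mul, ofMul_inv]
    abel
  | zero => simp [braidedStar]
  | add s t _ _ hs ht => simp only [braidedStar_add, map_add, hs, ht, star_add, smul_add]
  | smul c s _ hs =>
    simp only [braidedStar_smul, map_smul, hs, star_smul]
    rw [smul_comm]

theorem comul_star (x : B) : D.comul (star x) =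
    braidedStar β D.coact.toAlgHom.toLinearMap D.coact.toAlgHom.toLinearMap (D.comul x) := by
  refine D.induction (p := fun x => D.comul (star x) = braidedStar β D.coact.toAlgHom.toLinearMap
    D.coact.toAlgHom.toLinearMap (D.comul x)) x (fun a b x x' hx => ?_)
    (fun x y hx hy => by rw [star_add, map_add, map_add, hx, hy, braidedStar_add])
    (fun c x hx => by rw [star_smul, map_smul, map_smul, hx, braidedStar_smul])
  refine D.map_equiv_injective ?_
  rw [D.map_equiv_braidedStar (D.comul_mem_tensors hx), equiv_comul, equiv_comul,
    D.equiv_star (D.mem_of_pair hx), map_smul, map_star]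

theorem counit_eq (x : B) : D.counit x = D.hopf.counit (D.equiv x) := by
  have h : D.counit.toAlgHom.toLinearMap = D.hopf.counit.toAlgHom.toLinearMap ∘ₗ
      D.equiv.toLinearMap :=
    D.ext_fst fun a b x y h => by
      refine (D.counit_of_pair h).trans ?_
      rw [LinearMap.comp_apply, LinearEquiv.coe_coe, D.equiv_of_pair h]
      rfl
  exact LinearMap.congr_fun h x

/-- The scalar β(a⁻¹e, e) of the antipode is cancelled by β(ea⁻¹, e⁻¹) from the product. -/
theorem map_equiv_antipode_left {s : B ⊗[ℂ] B} (hs : s ∈ D.tensors a b) :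
    D.equiv (LinearMap.mul' ℂ B (D.antipode.rTensor B s)) =
      LinearMap.mul' ℂ H (D.hopf.antipode.rTensor H
        (TensorProduct.map D.equiv.toLinearMap D.equiv.toLinearMap s)) := by
  induction hs using Submodule.span_induction with
  | mem s hs =>
    obtain ⟨e, x₁, x₂, h₁, h₂, rfl⟩ := hs
    simp only [LinearMap.rTensor_tmul, LinearMap.mul'_apply, TensorProduct.map_tmul,
      LinearEquiv.coe_coe, D.equiv_mul (D.equiv_antipode_mem h₁) h₂, D.equiv_antipode h₁,
      smul_mul_assoc, smul_smul, ← Circle.coe_mul]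
    have h : β (e⁻¹⁻¹ * a⁻¹) e⁻¹ * β (a⁻¹ * e) e = 1 := by
      simp only [map_mul, map_inv, MonoidHom.mul_apply, MonoidHom.inv_apply]
      refine Additive.ofMul.injective ?_
      simp only [ofMul_mul, ofMul_inv, ofMul_one]
      abel
    rw [h, Circle.coe_one, one_smul]
  | zero => simp
  | add s t _ _ hs ht => simp only [map_add, hs, ht]
  | smul c s _ hs => simp only [map_smul, hs]

/-- Here β(a⁻¹e, b) β(e⁻¹b, b) = β(a⁻¹b, b) remains. It is harmless in `antipode_right`: it is 1 for
a = b, and the counit vanishes otherwise. -/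
theorem map_equiv_antipode_right {s : B ⊗[ℂ] B} (hs : s ∈ D.tensors a b) :
    D.equiv (LinearMap.mul' ℂ B (D.antipode.lTensor B s)) =
      (β (a⁻¹ * b) b : ℂ) • LinearMap.mul' ℂ H (D.hopf.antipode.lTensor H
        (TensorProduct.map D.equiv.toLinearMap D.equiv.toLinearMap s)) := by
  induction hs using Submodule.span_induction with
  | mem s hs =>
    obtain ⟨e, x₁, x₂, h₁, h₂, rfl⟩ := hs
    simp only [LinearMap.lTensor_tmul, LinearMap.mul'_apply, TensorProduct.map_tmul,
      LinearEquiv.coe_coe, D.equiv_mul h₁ (D.equiv_antipode_mem h₂), D.equiv_antipode h₂,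
      mul_smul_comm, smul_smul, ← Circle.coe_mul]
    refine congrArg (fun c : Circle => (c : ℂ) • _) ?_
    simp only [map_mul, map_inv, MonoidHom.mul_apply, MonoidHom.inv_apply]
    refine Additive.ofMul.injective ?_
    simp only [ofMul_mul, ofMul_inv]
    abel
  | zero => simp
  | add s t _ _ hs ht => simp only [map_add, hs, ht, smul_add]
  | smul c s _ hs =>
    simp only [map_smul, hs]
    rw [smul_comm]

theorem equiv_algebraMap (c : ℂ) : D.equiv (algebraMap ℂ B c) = algebraMap ℂ H c := by
  rw [Algebra.algebraMap_eq_smul_one, Algebra.algebraMap_eq_smul_one, map_smul, equiv_one]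

theorem antipode_left (x : B) :
    LinearMap.mul' ℂ B (D.antipode.rTensor B (D.comul x)) = algebraMap ℂ B (D.counit x) := by
  refine D.induction (p := fun x => LinearMap.mul' ℂ B (D.antipode.rTensor B (D.comul x)) =
    algebraMap ℂ B (D.counit x)) x (fun a b x y hx => ?_)
    (fun x y hx hy => by simp only [map_add, hx, hy])
    (fun c x hx => by rw [map_smul, map_smul, map_smul, hx, map_smul, smul_eq_mul, map_mul,
      Algebra.smul_def])
  refine D.equiv.injective ?_
  rw [D.map_equiv_antipode_left (D.comul_mem_tensors hx), equiv_comul, equiv_algebraMap, counit_eq]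
  exact LinearMap.congr_fun D.hopf.antipode_left _

theorem antipode_right (x : B) :
    LinearMap.mul' ℂ B (D.antipode.lTensor B (D.comul x)) = algebraMap ℂ B (D.counit x) := by
  refine D.induction (p := fun x => LinearMap.mul' ℂ B (D.antipode.lTensor B (D.comul x)) =
    algebraMap ℂ B (D.counit x)) x (fun a b x y hx => ?_)
    (fun x y hx hy => by simp only [map_add, hx, hy])
    (fun c x hx => by rw [map_smul, map_smul, map_smul, hx, map_smul, smul_eq_mul, map_mul,
      Algebra.smul_def])
  refine D.equiv.injective ?_
  rw [D.map_equiv_antipode_right (D.comul_mem_tensors hx), equiv_comul, equiv_algebraMap, counit_eq]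
  have h : LinearMap.mul' ℂ H (D.hopf.antipode.lTensor H (D.hopf.comul (D.equiv x))) =
      algebraMap ℂ H (D.hopf.counit (D.equiv x)) := LinearMap.congr_fun D.hopf.antipode_right _
  rw [h]
  by_cases hab : a = b
  · subst hab
    simp
  · rw [counit_eq_zero_of_mem (D.mem_of_pair hx) hab, map_zero, smul_zero]

/-- The scalars of the two antipodes and the two involutions cancel, two of them entering conjugated
or not according to the remaining involution; what is left is the identity in H. -/
theorem antipode_star (x : B) : D.antipode (star (D.antipode (star x))) = x := by
  refine D.induction (p := fun x => D.antipode (star (D.antipode (star x))) = x) x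
    (fun a b x y hx => ?_) (fun x y hx hy => by simp only [star_add, map_add, hx, hy])
    (fun c x hx => by simp only [star_smul, map_smul, hx, star_star])
  refine D.equiv.injective ?_
  have h₁ := D.mem_of_pair hx
  have h₂ := D.equiv_star_mem h₁
  have h₃ := D.equiv_antipode_mem h₂
  have h₄ := D.equiv_star_mem h₃
  rw [D.equiv_antipode h₄, D.equiv_star h₃, D.equiv_antipode h₂, D.equiv_star h₁]
  simp only [map_smul, star_smul, smul_smul, D.hopf.antipode_star]
  have hs : ∀ c : Circle, star (c : ℂ) = ((c⁻¹ : Circle) : ℂ) := fun c =>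
    (Circle.coe_inv_eq_conj c).symm
  simp only [hs, ← Circle.coe_mul]
  conv_rhs => rw [← one_smul ℂ (D.equiv x), ← Circle.coe_one]
  refine congrArg (fun c : Circle => (c : ℂ) • D.equiv x) ?_
  simp only [map_mul, map_inv, MonoidHom.mul_apply, MonoidHom.inv_apply]
  refine Additive.ofMul.injective ?_
  simp only [ofMul_mul, ofMul_inv, ofMul_one]
  abel

theorem comul_coassoc : (TensorProduct.assoc ℂ B B B).toLinearMap ∘ₗ D.comul.rTensor B ∘ₗ
    D.comul = D.comul.lTensor B ∘ₗ D.comul := by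
  have hinj : Function.Injective (TensorProduct.map D.equiv.toLinearMap
      (TensorProduct.map D.equiv.toLinearMap D.equiv.toLinearMap)) :=
    (TensorProduct.congr D.equiv (TensorProduct.congr D.equiv D.equiv)).injective
  have h1 : ∀ (t : B ⊗[ℂ] B) (y : B), TensorProduct.map D.equiv.toLinearMap
      (TensorProduct.map D.equiv.toLinearMap D.equiv.toLinearMap)
        (TensorProduct.assoc ℂ B B B (t ⊗ₜ[ℂ] y)) = TensorProduct.assoc ℂ H H H
          (TensorProduct.map D.equiv.toLinearMap D.equiv.toLinearMap t ⊗ₜ[ℂ] D.equiv y) :=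
    fun t y => by
      induction t using TensorProduct.induction_on with
      | zero => simp
      | add s t hs ht => simp only [TensorProduct.add_tmul, map_add, hs, ht]
      | tmul s t => simp
  have h2 : ∀ t : B ⊗[ℂ] B, TensorProduct.map D.equiv.toLinearMap
      (TensorProduct.map D.equiv.toLinearMap D.equiv.toLinearMap)
        (TensorProduct.assoc ℂ B B B (D.comul.rTensor B t)) =
      TensorProduct.assoc ℂ H H H (D.hopf.comul.toAlgHom.toLinearMap.rTensor H
        (TensorProduct.map D.equiv.toLinearMap D.equiv.toLinearMap t)) := fun t => by
    induction t using TensorProduct.induction_on with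
    | zero => simp
    | add s t hs ht => simp only [map_add, hs, ht]
    | tmul s t =>
      rw [LinearMap.rTensor_tmul, h1, equiv_comul]
      rfl
  have h3 : ∀ t : B ⊗[ℂ] B, TensorProduct.map D.equiv.toLinearMap
      (TensorProduct.map D.equiv.toLinearMap D.equiv.toLinearMap) (D.comul.lTensor B t) =
      D.hopf.comul.toAlgHom.toLinearMap.lTensor H
        (TensorProduct.map D.equiv.toLinearMap D.equiv.toLinearMap t) := fun t => by
    induction t using TensorProduct.induction_on with
    | zero => simp
    | add s t hs ht => simp only [map_add, hs, ht]
    | tmul s t =>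
      rw [LinearMap.lTensor_tmul, TensorProduct.map_tmul, equiv_comul]
      rfl
  refine LinearMap.ext fun x => hinj ?_
  refine (h2 _).trans (Eq.trans ?_ (h3 _).symm)
  rw [equiv_comul]
  exact LinearMap.congr_fun D.hopf.coassoc _

/-- The braided Hopf `*`-algebra `B`. -/
def braidedHopfStar : BraidedHopfStar β B where
  coact := D.coact
  comul := D.comul
  counit := D.counit
  antipode := D.antipode
  coact_coassoc := D.ext_fst fun a b x y h => by
    have h1 : D.coact.toAlgHom.toLinearMap x = _ := D.coact_of_pair h
    simp only [LinearMap.comp_apply, h1, LinearMap.rTensor_tmul, LinearMap.lTensor_tmul,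
      comul_single_one, LinearEquiv.coe_coe, TensorProduct.assoc_tmul]
  coact_counit := D.ext_fst fun a b x y h => by
    have h1 : D.coact.toAlgHom.toLinearMap x = _ := D.coact_of_pair h
    simp only [LinearMap.comp_apply, h1, LinearMap.lTensor_tmul, LinearEquiv.coe_coe]
    simp
  comul_equivariant := D.ext_fst fun a b x y h => by
    have h1 : D.coact.toAlgHom.toLinearMap x = _ := D.coact_of_pair h
    have h2 : ∀ t ∈ D.tensors a b,
        tensorCoact D.coact.toAlgHom.toLinearMap D.coact.toAlgHom.toLinearMap t =
          t ⊗ₜ[ℂ] MonoidAlgebra.single (a⁻¹ * b) (1 : ℂ) := fun t ht => by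
      induction ht using Submodule.span_induction with
      | mem t ht =>
        obtain ⟨e, x₁, x₂, h₁, h₂, rfl⟩ := ht
        rw [tensorCoact_tmul_of_homogeneous (D.coact_of_mem h₁) (D.coact_of_mem h₂)]
        congr 2
        group
      | zero => simp
      | add s t _ _ hs ht => rw [map_add, hs, ht, TensorProduct.add_tmul]
      | smul c t _ ht => rw [map_smul, ht, TensorProduct.smul_tmul']
    simp only [LinearMap.comp_apply, h1, LinearMap.rTensor_tmul]
    exact h2 _ (D.comul_mem_tensors h)
  counit_equivariant x := by
    have h : D.counit.toAlgHom.toLinearMap.rTensor (MonoidAlgebra ℂ Γ) ∘ₗ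
        D.coact.toAlgHom.toLinearMap =
        (TensorProduct.mk ℂ ℂ (MonoidAlgebra ℂ Γ)).flip 1 ∘ₗ D.counit.toAlgHom.toLinearMap :=
      D.ext_fst fun a b x y h => by
        have h1 : D.coact.toAlgHom.toLinearMap x = _ := D.coact_of_pair h
        have h2 : D.counit.toAlgHom.toLinearMap x = _ := D.counit_of_pair h
        simp only [LinearMap.comp_apply, h1, LinearMap.rTensor_tmul, h2, LinearMap.flip_apply,
          TensorProduct.mk_apply]
        by_cases hab : a = b
        · subst hab
          rw [inv_mul_cancel]
          rfl
        · rw [counit_eq_zero_of_mem (D.mem_bihomogeneous_of_pair h) hab, TensorProduct.zero_tmul,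
            TensorProduct.zero_tmul]
    exact LinearMap.congr_fun h x
  antipode_equivariant := D.ext_fst fun a b x y h => by
    have h1 : D.coact.toAlgHom.toLinearMap x = _ := D.coact_of_pair h
    have h2 : D.coact.toAlgHom.toLinearMap (D.antipode x) = _ :=
      D.coact_of_mem (D.equiv_antipode_mem (D.mem_of_pair h))
    rw [LinearMap.comp_apply, LinearMap.comp_apply, h1, h2, LinearMap.rTensor_tmul, inv_inv,
      mul_comm]
  comul_one := by
    refine D.map_equiv_injective ?_
    rw [equiv_comul, equiv_one, map_one, TensorProduct.map_tmul, LinearEquiv.coe_coe, equiv_one]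
    rfl
  comul_mul := D.comul_mul
  comul_star := D.comul_star
  coassoc := D.comul_coassoc
  counit_left := LinearMap.ext fun x => D.equiv.injective (by
    have h : ∀ t : B ⊗[ℂ] B, D.equiv (TensorProduct.lid ℂ B
        (D.counit.toAlgHom.toLinearMap.rTensor B t)) = TensorProduct.lid ℂ H
          (D.hopf.counit.toAlgHom.toLinearMap.rTensor H
            (TensorProduct.map D.equiv.toLinearMap D.equiv.toLinearMap t)) := fun t => by
      induction t using TensorProduct.induction_on with
      | zero => simp
      | add s t hs ht => simp only [map_add, hs, ht]
      | tmul s t => simp [counit_eq]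
    refine (h _).trans ?_
    rw [equiv_comul]
    exact LinearMap.congr_fun D.hopf.counit_left _)
  counit_right := LinearMap.ext fun x => D.equiv.injective (by
    have h : ∀ t : B ⊗[ℂ] B, D.equiv (TensorProduct.rid ℂ B
        (D.counit.toAlgHom.toLinearMap.lTensor B t)) = TensorProduct.rid ℂ H
          (D.hopf.counit.toAlgHom.toLinearMap.lTensor H
            (TensorProduct.map D.equiv.toLinearMap D.equiv.toLinearMap t)) := fun t => by
      induction t using TensorProduct.induction_on with
      | zero => simp
      | add s t hs ht => simp only [map_add, hs, ht]
      | tmul s t => simp [counit_eq]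
    refine (h _).trans ?_
    rw [equiv_comul]
    exact LinearMap.congr_fun D.hopf.counit_right _)
  antipode_left := LinearMap.ext D.antipode_left
  antipode_right := LinearMap.ext D.antipode_right
  antipode_star := D.antipode_star

theorem isTransmutation : IsTransmutation D.hopf D.proj D.braidedHopfStar D.equiv where
  coact := D.equiv_coact
  comul := D.equiv_comul
  counit := D.counit_eq
  map_one := D.equiv_one
  map_mul _ _ _ _ _ _ hx hy := D.equiv_mul hx hy
  map_antipode _ _ _ hx := D.equiv_antipode hx
  map_star _ _ _ hx := D.equiv_star hx

end TransmutationData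

/-! ### Equivariance in matrix form -/

section ComodulePair

variable {Γ : Type*} [CommGroup Γ] {β : Bichar Γ} {m : ℕ}
variable {R : Type*} [Ring R] [Algebra ℂ R]

theorem comul_conjBy {F : Matrix (Fin m) (Fin m) ℂ} (hF : IsUnit F.det) (Δ : R →ₗ[ℂ] R ⊗[ℂ] R)
    {u : Matrix (Fin m) (Fin m) R} (h : ∀ i j, Δ (u i j) = ∑ k, u i k ⊗ₜ[ℂ] u k j) (i j : Fin m) :
    Δ (conjBy F u i j) = ∑ k, conjBy F u i k ⊗ₜ[ℂ] conjBy F u k j := by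
  let f : R →ₐ[ℂ] R ⊗[ℂ] R := Algebra.TensorProduct.includeLeft
  let g : R →ₐ[ℂ] R ⊗[ℂ] R := Algebra.TensorProduct.includeRight
  have h1 : u.map Δ = u.map f * u.map g := by
    ext1 i j
    simp [f, g, Matrix.mul_apply, h]
  have h2 : (conjBy F u).map Δ = (conjBy F u).map f * (conjBy F u).map g := by
    rw [conjBy_map, h1, conjBy_mul hF, conjBy_map, conjBy_map]
  have h3 := congrArg (fun M : Matrix (Fin m) (Fin m) _ => M i j) h2
  simpa [f, g, Matrix.mul_apply] using h3

theorem counit_conjBy {F : Matrix (Fin m) (Fin m) ℂ} (hF : IsUnit F.det) (ε : R →ₗ[ℂ] ℂ)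
    {u : Matrix (Fin m) (Fin m) R} (h : ∀ i j, ε (u i j) = (1 : Matrix (Fin m) (Fin m) ℂ) i j)
    (i j : Fin m) : ε (conjBy F u i j) = (1 : Matrix (Fin m) (Fin m) ℂ) i j := by
  have h1 : u.map ε = 1 := by
    ext1 i j
    exact h i j
  have h2 : (conjBy F u).map ε = 1 := by rw [conjBy_map, h1, conjBy_one hF]
  exact congrArg (fun M : Matrix (Fin m) (Fin m) ℂ => M i j) h2

theorem IsCorepMatrix.conjBy {F : Matrix (Fin m) (Fin m) ℂ} (hF : IsUnit F.det)
    {Z : Matrix (Fin m) (Fin m) (MonoidAlgebra ℂ Γ)} (hZ : IsCorepMatrix Z) :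
    IsCorepMatrix (conjBy F Z) :=
  ⟨comul_conjBy hF _ hZ.1, counit_conjBy hF _ hZ.2⟩

variable {A : Type*} [Ring A] [Algebra ℂ A] [StarRing A] [StarModule ℂ A]
variable {𝒜 : BraidedHopfStar β A} {Z : Matrix (Fin m) (Fin m) (MonoidAlgebra ℂ Γ)}
variable {U : Matrix (Fin m) (Fin m) A}

/-- The matrix form of the equivariance of the coaction defined by `U`. -/
def IsEquivariant (𝒜 : BraidedHopfStar β A) (Z : Matrix (Fin m) (Fin m) (MonoidAlgebra ℂ Γ))
    (U : Matrix (Fin m) (Fin m) A) : Prop :=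
  U.map (Algebra.TensorProduct.includeLeft : A →ₐ[ℂ] A ⊗[ℂ] MonoidAlgebra ℂ Γ) *
      Z.map (Algebra.TensorProduct.includeRight : MonoidAlgebra ℂ Γ →ₐ[ℂ] A ⊗[ℂ] MonoidAlgebra ℂ Γ) =
    Z.map (Algebra.TensorProduct.includeRight : MonoidAlgebra ℂ Γ →ₐ[ℂ] A ⊗[ℂ] MonoidAlgebra ℂ Γ) *
      U.map 𝒜.coact

theorem IsEquivariant.conjBy {F : Matrix (Fin m) (Fin m) ℂ} (hF : IsUnit F.det)
    (h : IsEquivariant 𝒜 Z U) : IsEquivariant 𝒜 (conjBy F Z) (conjBy F U) := by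
  rw [IsEquivariant, conjBy_map, conjBy_map, conjBy_map, ← conjBy_mul hF, ← conjBy_mul hF, h]

theorem coactOfMatrix_single {V : Type*} [AddCommGroup V] [Module ℂ V]
    (v : Matrix (Fin m) (Fin m) V) (j : Fin m) : coactOfMatrix v (Pi.single j 1) =
      ∑ i, (Pi.single i 1 : Fin m → ℂ) ⊗ₜ[ℂ] v i j := by
  have h := (Pi.basisFun ℂ (Fin m)).constr_basis ℂ
    (fun j => ∑ i, Pi.basisFun ℂ (Fin m) i ⊗ₜ[ℂ] v i j) j
  simp only [coactOfMatrix, Pi.basisFun_apply] at h ⊢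
  exact h

theorem lTensor_mul'_tensorTensorTensorComm {V E : Type*} [AddCommGroup V] [Module ℂ V] [Ring E]
    [Algebra ℂ E] (e : V) (z : E) (t : R ⊗[ℂ] E) :
    (LinearMap.mul' ℂ E).lTensor (V ⊗[ℂ] R) (TensorProduct.tensorTensorTensorComm ℂ V E R E
      ((e ⊗ₜ[ℂ] z) ⊗ₜ[ℂ] t)) =
    (TensorProduct.assoc ℂ V R E).symm (e ⊗ₜ[ℂ] ((1 ⊗ₜ[ℂ] z) * t)) := by
  induction t using TensorProduct.induction_on with
  | zero => simp
  | add s t hs ht => simp only [TensorProduct.tmul_add, map_add, hs, ht, mul_add]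
  | tmul s t => simp

/-- Evaluated at e_j, the coefficients of e_k in the two composites are the (k, j) entries of U₁Z₂
and Z₂δ(U). The matrix form is compatible with changes of basis. -/
theorem isComodulePair_of_isEquivariant (hZ : IsCorepMatrix Z)
    (hΔ : ∀ i j, 𝒜.comul (U i j) = ∑ k, U i k ⊗ₜ[ℂ] U k j)
    (hε : ∀ i j, 𝒜.counit (U i j) = (1 : Matrix (Fin m) (Fin m) ℂ) i j)
    (h : IsEquivariant 𝒜 Z U) : IsComodulePair 𝒜 Z U := by
  refine ⟨hZ, hΔ, hε, (Pi.basisFun ℂ (Fin m)).ext fun j => ?_⟩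
  have h1 : ∀ k, ∑ i, U k i ⊗ₜ[ℂ] Z i j = ∑ i, (1 ⊗ₜ[ℂ] Z k i) * 𝒜.coact (U i j) := fun k => by
    have := congrArg (fun M : Matrix (Fin m) (Fin m) _ => M k j) h
    simpa [Matrix.mul_apply] using this
  rw [Pi.basisFun_apply, LinearMap.comp_apply, LinearMap.comp_apply, coactOfMatrix_single,
    coactOfMatrix_single, map_sum, map_sum]
  simp only [LinearMap.rTensor_tmul, coactOfMatrix_single, TensorProduct.sum_tmul, tensorCoact,
    LinearMap.comp_apply, TensorProduct.map_tmul, LinearEquiv.coe_coe, map_sum, lTensor_mul'_tensorTensorTensorComm]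
  rw [Finset.sum_comm]
  conv_rhs => rw [Finset.sum_comm]
  refine Finset.sum_congr rfl fun k _ => ?_
  have h3 := congrArg (fun t => (TensorProduct.assoc ℂ (Fin m → ℂ) A (MonoidAlgebra ℂ Γ)).symm
    ((Pi.single k 1 : Fin m → ℂ) ⊗ₜ[ℂ] t)) (h1 k)
  simp only [TensorProduct.tmul_sum, map_sum, TensorProduct.assoc_symm_tmul] at h3
  exact h3

end ComodulePair

/-! ### Unitarity over the bosonization -/

section SmashUnitary

variable {Γ : Type*} [CommGroup Γ] {β : Bichar Γ} {m : ℕ} {Q : SpectralFamily Γ m}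
variable {R : Type*} [Ring R] [Algebra ℂ R] [StarRing R] [StarModule ℂ R]

/-- Components with b ≠ d multiply to zero. If the weight does not depend on b = d, the sum over b
restores P_a(pq)P_c, and pq = 1 leaves a = c. -/
theorem SpectralFamily.sum_apply_comp_mul {M : Type*} [AddCommGroup M] [Module ℂ M]
    {p q : Matrix (Fin m) (Fin m) R} (hpq : p * q = 1) (f : Γ → Γ → Γ → Γ → R →ₗ[ℂ] M)
    (f' : Γ → Γ → R →ₗ[ℂ] M) (hf : ∀ a b c, f a b c b = f' a c) (i j : Fin m) :
    ∑ a ∈ Q.supp, ∑ b ∈ Q.supp, ∑ c ∈ Q.supp, ∑ d ∈ Q.supp,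
      f a b c d ((Q.comp p a b * Q.comp q d c) i j) =
    ∑ a ∈ Q.supp, f' a a (algebraMap ℂ R (Q.proj a i j)) := by
  have h1 : ∀ a b c d, b ≠ d → Q.comp p a b * Q.comp q d c = 0 := fun a b c d h => by
    have h2 : Q.comp p a b * Q.comp q d c = scalarMatrix R (Q.proj a) * p *
        scalarMatrix R (Q.proj b * Q.proj d) * q * scalarMatrix R (Q.proj c) := by
      simp only [SpectralFamily.comp, map_mul, mul_assoc]
    rw [h2, Q.proj_mul_of_ne b d h, map_zero, mul_zero, zero_mul, zero_mul]
  have h2 : ∀ a, ∀ b ∈ Q.supp, ∀ c, ∑ d ∈ Q.supp,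
      f a b c d ((Q.comp p a b * Q.comp q d c) i j) =
      f' a c ((Q.comp p a b * Q.comp q b c) i j) := fun a b hb c => by
    rw [Finset.sum_eq_single_of_mem b hb, hf]
    intro d _ hd
    rw [h1 a b c d hd.symm, Matrix.zero_apply, map_zero]
  refine Finset.sum_congr rfl fun a ha => ?_
  rw [Finset.sum_congr rfl fun b hb => Finset.sum_congr rfl fun c _ => h2 a b hb c,
    Finset.sum_comm, Finset.sum_eq_single_of_mem a ha]
  · rw [← map_sum, ← Matrix.sum_apply, ← Q.comp_mul, hpq, SpectralFamily.comp, mul_one, ← map_mul,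
      Q.proj_mul_self, scalarMatrix_apply]
  · intro c _ hc
    rw [← map_sum, ← Matrix.sum_apply, ← Q.comp_mul, hpq, SpectralFamily.comp, mul_one, ← map_mul,
      Q.proj_mul_of_ne a c hc.symm, map_zero, Matrix.zero_apply, map_zero]

theorem SpectralFamily.star_comp (u : Matrix (Fin m) (Fin m) R) (a b : Γ) :
    star (Q.comp u a b) = Q.comp (star u) b a := by
  simp only [SpectralFamily.comp, star_mul, star_scalarMatrix, Q.star_proj, mul_assoc]

variable (β) in
/-- The product of the braided tensor product as a bilinear map. -/
def braidedMulLin {A B : Type*} [Ring A] [Algebra ℂ A] [Ring B] [Algebra ℂ B]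
    (δA : A →ₗ[ℂ] A ⊗[ℂ] MonoidAlgebra ℂ Γ) (δB : B →ₗ[ℂ] B ⊗[ℂ] MonoidAlgebra ℂ Γ) :
    A ⊗[ℂ] B →ₗ[ℂ] A ⊗[ℂ] B →ₗ[ℂ] A ⊗[ℂ] B :=
  LinearMap.mk₂ ℂ (braidedMul β δA δB) (add_braidedMul β δA δB) (smul_braidedMul β δA δB)
    (braidedMul_add β δA δB) (braidedMul_smul β δA δB)

theorem map₂_sum_sum {ι M N P : Type*} [AddCommGroup M] [Module ℂ M] [AddCommGroup N] [Module ℂ N]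
    [AddCommGroup P] [Module ℂ P] (L : M →ₗ[ℂ] N →ₗ[ℂ] P) (s : Finset ι) (p : ι → ι → M)
    (q : ι → ι → N) : L (∑ a ∈ s, ∑ b ∈ s, p a b) (∑ c ∈ s, ∑ d ∈ s, q c d) =
      ∑ a ∈ s, ∑ b ∈ s, ∑ c ∈ s, ∑ d ∈ s, L (p a b) (q c d) := by
  rw [LinearMap.map_sum₂]
  refine Finset.sum_congr rfl fun a _ => ?_
  rw [LinearMap.map_sum₂]
  refine Finset.sum_congr rfl fun b _ => ?_
  rw [map_sum]
  exact Finset.sum_congr rfl fun c _ => map_sum _ _ _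

theorem smashMatrix_shift (g : Γ) (u : Matrix (Fin m) (Fin m) R) (i j : Fin m) :
    smashMatrix (Q.shift g) u i j = ∑ a ∈ Q.supp, ∑ b ∈ Q.supp,
      MonoidAlgebra.single (g * a) (1 : ℂ) ⊗ₜ[ℂ] Q.comp u a b i j := by
  have h : ∀ a, ∑ b ∈ Q.supp, Q.comp u a b = scalarMatrix R (Q.proj a) * u := fun a => by
    simp only [SpectralFamily.comp]
    rw [← Finset.mul_sum, ← map_sum, Q.sum_proj, map_one, mul_one]
  simp only [← TensorProduct.tmul_sum, ← Matrix.sum_apply, h]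
  simp only [smashMatrix, Matrix.of_apply, SpectralFamily.shift_eq, SpectralFamily.expand_apply,
    TensorProduct.sum_tmul]
  rw [Finset.sum_comm]
  refine Finset.sum_congr rfl fun a _ => ?_
  simp only [Matrix.mul_apply, scalarMatrix_apply, TensorProduct.tmul_sum, ← Algebra.smul_def,
    TensorProduct.tmul_smul, TensorProduct.smul_tmul']

/-- The entries of the smash matrix are ∑ ga ⊗ (P_a u P_b)_ij. The scalars from braided product and
involution lose their dependence on the inner degree, so that unitarity reduces to that of u, for
every g. -/
theorem isSmashUnitary_shift (𝒜 : BraidedHopfStar β R) {u : Matrix (Fin m) (Fin m) R}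
    (hu : u ∈ unitary (Matrix (Fin m) (Fin m) R))
    (hδ : ∀ a b i j, 𝒜.coact (Q.comp u a b i j) =
      Q.comp u a b i j ⊗ₜ[ℂ] MonoidAlgebra.single (a⁻¹ * b) (1 : ℂ)) (g : Γ) :
    IsSmashUnitary 𝒜 (smashMatrix (Q.shift g) u) := by
  set δ := 𝒜.coact.toAlgHom.toLinearMap
  set Δ := Coalgebra.comul (R := ℂ) (A := MonoidAlgebra ℂ Γ)
  have hδ' : ∀ a b i j, δ (star (Q.comp u a b i j)) =
      star (Q.comp u a b i j) ⊗ₜ[ℂ] MonoidAlgebra.single (a⁻¹ * b)⁻¹ (1 : ℂ) := fun a b i j => by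
    refine (map_star 𝒜.coact _).trans ?_
    rw [hδ, TensorProduct.star_tmul, star_single, star_one]
  have hΔ : ∀ a : Γ, Δ (star (MonoidAlgebra.single a (1 : ℂ))) =
      star (MonoidAlgebra.single a (1 : ℂ)) ⊗ₜ[ℂ] MonoidAlgebra.single a⁻¹ (1 : ℂ) := fun a => by
    rw [star_single, star_one, comul_single_one]
  have hstar : ∀ i j, braidedStar β Δ δ (smashMatrix (Q.shift g) u i j) =
      ∑ a ∈ Q.supp, ∑ b ∈ Q.supp, (β (a⁻¹ * b)⁻¹ (g * a)⁻¹ : ℂ) •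
        (MonoidAlgebra.single (g * a)⁻¹ (1 : ℂ) ⊗ₜ[ℂ] star (Q.comp u a b i j)) := fun i j => by
    rw [smashMatrix_shift]
    let f : MonoidAlgebra ℂ Γ ⊗[ℂ] R →+ MonoidAlgebra ℂ Γ ⊗[ℂ] R :=
      AddMonoidHom.mk' (braidedStar β Δ δ) (braidedStar_add β Δ δ)
    change f _ = _
    rw [map_sum]
    refine Finset.sum_congr rfl fun a _ => ?_
    rw [map_sum]
    refine Finset.sum_congr rfl fun b _ => ?_
    refine (braidedStar_tmul_of_homogeneous β Δ δ (hΔ _) (hδ' a b i j)).trans ?_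
    rw [star_single, star_one]
  have hmul : ∀ x y, braidedMul β Δ δ x y = braidedMulLin β Δ δ x y := fun x y => rfl
  have hone : ∀ i j : Fin m, ∑ a ∈ Q.supp,
      TensorProduct.mk ℂ (MonoidAlgebra ℂ Γ) R 1 (algebraMap ℂ R (Q.proj a i j)) =
      if i = j then 1 ⊗ₜ[ℂ] 1 else 0 := fun i j => by
    rw [← map_sum, ← map_sum, ← Matrix.sum_apply, Q.sum_proj, Matrix.one_apply]
    split_ifs <;> simp
  constructor
  · intro i j
    -- The first value of β comes from the involution, the second from the product. For d = b they
    -- combine to β(a⁻¹c, (gc)⁻¹), which is free of b.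
    let f : Γ → Γ → Γ → Γ → R →ₗ[ℂ] MonoidAlgebra ℂ Γ ⊗[ℂ] R := fun a b c d =>
      ((β (c⁻¹ * d)⁻¹ (g * c)⁻¹ * β (a⁻¹ * b) (g * c)⁻¹ : Circle) : ℂ) •
        TensorProduct.mk ℂ (MonoidAlgebra ℂ Γ) R (MonoidAlgebra.single (g * a * (g * c)⁻¹) (1 : ℂ))
    let f' : Γ → Γ → R →ₗ[ℂ] MonoidAlgebra ℂ Γ ⊗[ℂ] R := fun a c =>
      ((β (c⁻¹ * a)⁻¹ (g * c)⁻¹ : Circle) : ℂ) •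
        TensorProduct.mk ℂ (MonoidAlgebra ℂ Γ) R (MonoidAlgebra.single (g * a * (g * c)⁻¹) (1 : ℂ))
    have hf : ∀ a b c, f a b c b = f' a c := fun a b c => by
      refine congrArg (fun c : Circle => (c : ℂ) • _) ?_
      rw [← MonoidHom.mul_apply, ← map_mul]
      congr 2
      rw [mul_inv_rev, mul_inv_rev, inv_inv, mul_comm (b⁻¹ * c), mul_assoc, mul_inv_cancel_left]
    have hf' : ∀ a, f' a a = TensorProduct.mk ℂ (MonoidAlgebra ℂ Γ) R 1 := fun a => by
      simp only [f', inv_mul_cancel, inv_one, map_one, MonoidHom.one_apply, Circle.coe_one,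
        one_smul, mul_inv_cancel]
      rfl
    have h1 : ∀ k, braidedMul β Δ δ (smashMatrix (Q.shift g) u i k)
        (braidedStar β Δ δ (smashMatrix (Q.shift g) u j k)) =
        ∑ a ∈ Q.supp, ∑ b ∈ Q.supp, ∑ c ∈ Q.supp, ∑ d ∈ Q.supp,
          f a b c d (Q.comp u a b i k * star (Q.comp u c d j k)) := fun k => by
      rw [hstar, smashMatrix_shift, hmul, map₂_sum_sum]
      refine Finset.sum_congr rfl fun a _ => Finset.sum_congr rfl fun b _ =>
        Finset.sum_congr rfl fun c _ => Finset.sum_congr rfl fun d _ => ?_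
      rw [map_smul, ← hmul, braidedMul_tmul_of_homogeneous β (hδ a b i k) (comul_single_one _),
        smul_smul, single_mul_single_one, ← Circle.coe_mul]
      rfl
    rw [Finset.sum_congr rfl fun k _ => h1 k]
    refine Eq.trans ?_ ((Q.sum_apply_comp_mul (Unitary.mul_star_self_of_mem hu) f f' hf i j).trans
      ?_)
    · simp only [Matrix.mul_apply, map_sum, ← Q.star_comp, Matrix.star_apply]
      rw [Finset.sum_comm]
      refine Finset.sum_congr rfl fun a _ => ?_
      rw [Finset.sum_comm]
      refine Finset.sum_congr rfl fun b _ => ?_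
      rw [Finset.sum_comm]
      refine Finset.sum_congr rfl fun c _ => ?_
      rw [Finset.sum_comm]
    · simp only [hf']
      exact hone i j
  · intro i j
    -- The star swaps row and column degrees, hence the order b, a. For c = a the two scalars are
    -- inverse to each other.
    let f : Γ → Γ → Γ → Γ → R →ₗ[ℂ] MonoidAlgebra ℂ Γ ⊗[ℂ] R := fun b a _ c =>
      ((β (a⁻¹ * b)⁻¹ (g * a)⁻¹ * β (a⁻¹ * b)⁻¹ (g * c) : Circle) : ℂ) •
        TensorProduct.mk ℂ (MonoidAlgebra ℂ Γ) R (MonoidAlgebra.single ((g * a)⁻¹ * (g * c)) (1 : ℂ))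
    have hf : ∀ b a d, f b a d a = TensorProduct.mk ℂ (MonoidAlgebra ℂ Γ) R 1 := fun b a d => by
      change ((β (a⁻¹ * b)⁻¹ (g * a)⁻¹ * β (a⁻¹ * b)⁻¹ (g * a) : Circle) : ℂ) • _ = _
      rw [← map_mul, inv_mul_cancel, map_one, Circle.coe_one, one_smul]
      rfl
    have h1 : ∀ k, braidedMul β Δ δ (braidedStar β Δ δ (smashMatrix (Q.shift g) u k i))
        (smashMatrix (Q.shift g) u k j) =
        ∑ b ∈ Q.supp, ∑ a ∈ Q.supp, ∑ d ∈ Q.supp, ∑ c ∈ Q.supp,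
          f b a d c (star (Q.comp u a b k i) * Q.comp u c d k j) := fun k => by
      rw [hstar, smashMatrix_shift, hmul, Finset.sum_comm]
      rw [Finset.sum_comm (f := fun a b => MonoidAlgebra.single (g * a) (1 : ℂ) ⊗ₜ[ℂ]
        Q.comp u a b k j), map₂_sum_sum]
      refine Finset.sum_congr rfl fun b _ => Finset.sum_congr rfl fun a _ =>
        Finset.sum_congr rfl fun d _ => Finset.sum_congr rfl fun c _ => ?_
      rw [map_smul, LinearMap.smul_apply, ← hmul,
        braidedMul_tmul_of_homogeneous β (hδ' a b k i) (comul_single_one _),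
        smul_smul, single_mul_single_one, ← Circle.coe_mul]
      rfl
    rw [Finset.sum_congr rfl fun k _ => h1 k]
    refine Eq.trans ?_ ((Q.sum_apply_comp_mul (Unitary.star_mul_self_of_mem hu) f
      (fun _ _ => TensorProduct.mk ℂ (MonoidAlgebra ℂ Γ) R 1) hf i j).trans (hone i j))
    simp only [Matrix.mul_apply, map_sum, ← Q.star_comp, Matrix.star_apply]
    rw [Finset.sum_comm]
    refine Finset.sum_congr rfl fun a _ => ?_
    rw [Finset.sum_comm]
    refine Finset.sum_congr rfl fun b _ => ?_
    rw [Finset.sum_comm]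
    refine Finset.sum_congr rfl fun c _ => ?_
    rw [Finset.sum_comm]

end SmashUnitary

/-! ### The fundamental comodule and its conjugate -/

namespace TransmutationData

variable {Γ : Type*} [CommGroup Γ] {m : ℕ} {β : Bichar Γ} {Q : SpectralFamily Γ m}
variable {B H : Type*} [Ring B] [Algebra ℂ B] [StarRing B] [StarModule ℂ B]
variable [Ring H] [Algebra ℂ H] [StarRing H] [StarModule ℂ H]
variable {u : Matrix (Fin m) (Fin m) B} {v : Matrix (Fin m) (Fin m) H}
variable (D : TransmutationData β Q u v)

theorem equiv_u (i j : Fin m) : D.equiv (u i j) = v i j := by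
  have hu : u i j = ∑ a ∈ Q.supp, ∑ b ∈ Q.supp, Q.comp u a b i j := by
    conv_lhs => rw [← Q.sum_comp u]
    simp only [Matrix.sum_apply]
  have hv : v i j = ∑ a ∈ Q.supp, ∑ b ∈ Q.supp, Q.comp v a b i j := by
    conv_lhs => rw [← Q.sum_comp v]
    simp only [Matrix.sum_apply]
  rw [hu, hv]
  simp only [map_sum, D.equiv_of_pair (.gen _ _ _ _)]

theorem comul_u (i j : Fin m) : D.comul (u i j) = ∑ k, u i k ⊗ₜ[ℂ] u k j := by
  refine D.map_equiv_injective ?_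
  rw [equiv_comul, equiv_u, D.comul_v, map_sum]
  simp only [TensorProduct.map_tmul, LinearEquiv.coe_coe, equiv_u]

theorem antipode_u (i j : Fin m) : D.antipode (u i j) = star (u j i) := by
  have h : ∀ a b, D.antipode (Q.comp u a b i j) = star (Q.comp u b a j i) := fun a b => by
    have h₁ : Pair β Q u v a b _ _ := .gen a b i j
    have h₂ : Pair β Q u v b a _ _ := .gen b a j i
    refine D.equiv.injective ?_
    rw [D.equiv_antipode (D.mem_of_pair h₁), D.equiv_star (D.mem_of_pair h₂), D.equiv_of_pair h₁,
      D.equiv_of_pair h₂, hopf_antipode_comp]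
    refine congrArg (fun c : Circle => (c : ℂ) • _) ?_
    simp only [map_mul, map_inv, MonoidHom.mul_apply, MonoidHom.inv_apply]
    refine Additive.ofMul.injective ?_
    simp only [ofMul_mul, ofMul_inv]
    abel
  have hu : ∀ i j, u i j = ∑ a ∈ Q.supp, ∑ b ∈ Q.supp, Q.comp u a b i j := fun i j => by
    conv_lhs => rw [← Q.sum_comp u]
    simp only [Matrix.sum_apply]
  rw [hu i j, hu j i, Finset.sum_comm]
  simp only [map_sum, star_sum, h]

theorem coact_u_apply (w : Γ) (i j : Fin m) : D.coact (u i j) =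
    ∑ s, ∑ t, u s t ⊗ₜ[ℂ] (star (Q.shift w s i) * Q.shift w t j) := by
  have h1 : ∀ s t, star (Q.shift w s i) * Q.shift w t j =
      Q.expand (fun a => MonoidAlgebra.single a⁻¹ (1 : ℂ)) i s * Q.toMatrix t j := fun s t => by
    have h2 : star (Q.toMatrix s i) = Q.expand (fun a => MonoidAlgebra.single a⁻¹ (1 : ℂ)) i s := by
      simp only [SpectralFamily.toMatrix, SpectralFamily.expand_apply, star_sum, star_smul,
        Q.proj_apply_star, star_single, star_one]
    simp only [SpectralFamily.shift, Matrix.smul_apply, smul_eq_mul, star_mul', star_single, star_one,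
      h2]
    rw [mul_mul_mul_comm, single_mul_single_one, inv_mul_cancel]
    exact one_mul _
  have h3 := congrArg (fun M : Matrix (Fin m) (Fin m) _ => M i j) D.coact_u
  simp only [Matrix.map_apply, SpectralFamily.twist, Matrix.mul_apply,
    Algebra.TensorProduct.includeLeft_apply, Algebra.TensorProduct.includeRight_apply,
    Algebra.TensorProduct.tmul_mul_tmul, Finset.sum_mul, one_mul, mul_one] at h3
  rw [h3, Finset.sum_comm]
  simp only [h1, SpectralFamily.toMatrix]

theorem coact_comp (a b : Γ) (i j : Fin m) : D.coact (Q.comp u a b i j) =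
    Q.comp u a b i j ⊗ₜ[ℂ] MonoidAlgebra.single (a⁻¹ * b) (1 : ℂ) :=
  D.coact_of_pair (.gen a b i j)

/-- The coaction is conjugation of u by ∑ P_a a in the second leg; the factor 1 ⊗ g commutes with
the entries of u and drops out. -/
theorem isEquivariant_shift (g : Γ) : IsEquivariant D.braidedHopfStar (Q.shift g) u := by
  have h : u.map D.braidedHopfStar.coact = Q.twist (fun a => MonoidAlgebra.single a⁻¹ (1 : ℂ))
    (fun b => MonoidAlgebra.single b (1 : ℂ)) u := D.coact_u
  let s : B ⊗[ℂ] MonoidAlgebra ℂ Γ := 1 ⊗ₜ[ℂ] MonoidAlgebra.single g (1 : ℂ)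
  have hs : (Q.shift g).map (Algebra.TensorProduct.includeRight : _ →ₐ[ℂ] B ⊗[ℂ] MonoidAlgebra ℂ Γ) =
      Matrix.diagonal (fun _ => s) * Q.expand fun a => 1 ⊗ₜ[ℂ] MonoidAlgebra.single a (1 : ℂ) := by
    rw [SpectralFamily.shift_eq, Q.map_expand]
    ext1 i j
    rw [Matrix.diagonal_mul, SpectralFamily.expand_apply, SpectralFamily.expand_apply,
      Finset.mul_sum]
    refine Finset.sum_congr rfl fun a _ => ?_
    rw [mul_smul_comm, Algebra.TensorProduct.tmul_mul_tmul, one_mul, single_mul_single_one]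
    rfl
  have hc : Matrix.diagonal (fun _ => s) *
      u.map (Algebra.TensorProduct.includeLeft : B →ₐ[ℂ] B ⊗[ℂ] MonoidAlgebra ℂ Γ) =
      u.map (Algebra.TensorProduct.includeLeft : B →ₐ[ℂ] B ⊗[ℂ] MonoidAlgebra ℂ Γ) *
        Matrix.diagonal fun _ => s := by
    ext1 i j
    simp [s, Matrix.diagonal_mul, Matrix.mul_diagonal]
  have h1 : Q.expand (fun a => (1 : B) ⊗ₜ[ℂ] MonoidAlgebra.single a (1 : ℂ)) *
      Q.expand (fun a => (1 : B) ⊗ₜ[ℂ] MonoidAlgebra.single a⁻¹ (1 : ℂ)) = 1 := by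
    rw [Q.expand_mul, ← Q.expand_one]
    refine congrArg Q.expand (funext fun a => ?_)
    rw [Pi.mul_apply, Algebra.TensorProduct.tmul_mul_tmul, single_mul_single_one, mul_inv_cancel,
      one_mul]
    rfl
  have h2 : ∀ l : Γ → MonoidAlgebra ℂ Γ, (Q.expand l).map
      (Algebra.TensorProduct.includeRight : _ →ₐ[ℂ] B ⊗[ℂ] MonoidAlgebra ℂ Γ) =
      Q.expand fun a => 1 ⊗ₜ[ℂ] l a := fun l => Q.map_expand _ l
  rw [IsEquivariant, h, SpectralFamily.twist, hs, ← mul_assoc, ← hc, h2, h2, mul_assoc, mul_assoc,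
    mul_assoc, ← mul_assoc (Q.expand _), h1, one_mul]

theorem isCorepMatrix_shift (g : Γ) : IsCorepMatrix (Q.shift g) :=
  IsCorepMatrix.single_smul ⟨Q.toMatrix_comul, Q.toMatrix_counit⟩ g

theorem isUnitaryComodulePair_shift (hu : u ∈ unitary (Matrix (Fin m) (Fin m) B)) (g : Γ) :
    IsUnitaryComodulePair D.braidedHopfStar (Q.shift g) u :=
  ⟨isComodulePair_of_isEquivariant (isCorepMatrix_shift g) D.comul_u D.counit_u
    (D.isEquivariant_shift g), isSmashUnitary_shift D.braidedHopfStar hu D.coact_comp g⟩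

/-- The relations give Ū_X = A⁻¹uA and X̄ = A⁻¹(w⁻²X)A with w⁻²X = w⁻¹ ∑ P_a a. Conjugation by A
thus turns the conjugate comodule into the pair of the shift by w⁻¹ and u, which is unitary like
every such shift. -/
theorem isBraidedCMQG {A : Matrix (Fin m) (Fin m) ℂ} (hA : IsUnit A.det) (hQ : Q.IsSymm A) {w : Γ}
    (hX : Q.shift w ∈ unitary (Matrix (Fin m) (Fin m) (MonoidAlgebra ℂ Γ)))
    (hconj : conjBy A (MonoidAlgebra.single (w ^ 2) (1 : ℂ) • (Q.shift w).map star) = Q.shift w)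
    (hu : IsTwistedOrth Q A (braidedTwist β w) u) :
    IsBraidedCMQG D.braidedHopfStar (Q.shift w) u := by
  have hA' : IsUnit A⁻¹.det := Matrix.isUnit_nonsing_inv_det _ hA
  have hu' := ((isTwistedOrth_iff_braided hA hQ).1 hu).2
  have hZ : conjBy A ((Q.shift w).map star) = Q.shift w⁻¹ := by
    have h : MonoidAlgebra.single (w ^ 2) (1 : ℂ) • conjBy A ((Q.shift w).map star) =
        Q.shift w := by
      conv_rhs => rw [← hconj]
      rw [conjBy, conjBy, Matrix.mul_smul, Matrix.smul_mul]
    have h1 := congrArg (fun M => MonoidAlgebra.single (w ^ 2)⁻¹ (1 : ℂ) • M) h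
    simp only [SpectralFamily.shift, smul_smul, single_mul_single_one, inv_mul_cancel] at h1
    rw [sq, mul_inv_rev, inv_mul_cancel_right] at h1
    exact (one_smul _ _).symm.trans h1
  have hZ' : (Q.shift w).map star = conjBy A⁻¹ (Q.shift w⁻¹) := by
    rw [← hZ, conjBy_inv_conjBy hA]
  have hU' : conjMatrix β (Q.shift w) u = conjBy A⁻¹ u := by
    conv_rhs => rw [hu', conjBy_inv_conjBy hA]
  refine ⟨⟨isCorepMatrix_shift w, hX⟩, ?_, D.isUnitaryComodulePair_shift hu.unitary w, ?_, A, hA,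
    ?_⟩
  · rw [eq_top_iff]
    rintro x -
    have hx : x ∈ Algebra.adjoin ℂ {x | ∃ i j, u i j = x} := D.adjoin_u ▸ Algebra.mem_top
    exact (Algebra.adjoin_le (S := (StarAlgebra.adjoin ℂ {x : B | ∃ i j, u i j = x}).toSubalgebra)
      (StarAlgebra.subset_adjoin ℂ _)) hx
  · rw [hZ', hU']
    exact isComodulePair_of_isEquivariant ((isCorepMatrix_shift _).conjBy hA')
      (comul_conjBy hA' D.comul D.comul_u)
      (counit_conjBy hA' D.counit.toAlgHom.toLinearMap D.counit_u)
      ((D.isEquivariant_shift _).conjBy hA')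
  · rw [hZ, ← hu']
    exact D.isUnitaryComodulePair_shift hu.unitary _

end TransmutationData

/-! ### The comparison homomorphisms -/

section Main

variable {Γ : Type*} [CommGroup Γ] {m : ℕ} {β : Bichar Γ} {Q : SpectralFamily Γ m}
variable {A : Matrix (Fin m) (Fin m) ℂ} {w : Γ}

/-- Every map in the data comes from a universal property, by exhibiting a matrix that satisfies the
relations with the appropriate θ. -/
theorem exists_transmutationData (hA : IsUnit A.det) (hQ : Q.IsSymm A) {c : ℂ} (hc : c ≠ 0)
    (hF : (A * charMatrix (Q.shift w) w β) * (A * charMatrix (Q.shift w) w β).map star = c • 1) :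
    Nonempty (TransmutationData β Q (BraidedFreeOrth.fund A (Q.shift w) β)
      (FreeOrth.fund (A * charMatrix (Q.shift w) w β))) := by
  have hF' : IsUnit (A * charMatrix (Q.shift w) w β).det := by
    refine Matrix.isUnit_det_of_right_inverse
      (B := c⁻¹ • (A * charMatrix (Q.shift w) w β).map star) ?_
    rw [Matrix.mul_smul, hF, smul_smul, inv_mul_cancel₀ hc, one_smul]
  obtain ⟨ℋ, hΔ, hε, hS, hS1, hSm⟩ := FreeOrth.exists_hopfStar hF' hc hF
  obtain ⟨π, hπ, hπv, hπS⟩ := FreeOrth.exists_hopfMap hA hQ hF' ℋ hΔ hε hS hS1 hSm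
  -- If σ is trivial on ((a,1),(1,b)), then e_{(a,1)} e_{(1,b)} = e_{(a,b)}, so its adjoint has the
  -- form that `IsTwistedOrth.twist` requires with s(a,b) = σ((a,b),(a,b)).
  have hstar : ∀ (σ : Bichar (Γ × Γ)) (hσ : ∀ a b, σ (a, 1) (1, b) = 1) (a b : Γ),
      star (TwistedGroupAlg.basisVec σ (a, 1) * TwistedGroupAlg.basisVec σ (1, b)) =
        (σ (a, b) (a, b) : ℂ) • (TwistedGroupAlg.basisVec σ (a⁻¹, 1) *
          TwistedGroupAlg.basisVec σ (1, b⁻¹)) := fun σ hσ a b => by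
    simp only [TwistedGroupAlg.basisVec_mul, hσ, Circle.coe_one, one_smul, Prod.mk_mul_mk, mul_one,
      one_mul, TwistedGroupAlg.star_basisVec, Prod.inv_mk]
  obtain ⟨f, hf⟩ := BraidedFreeOrth.exists_hom hA hQ
    ((FreeOrth.isTwistedOrth_fund (β := β) (w := w) hA hQ).twist (θ' := braidedTwist β w)
      (l := fun a => TwistedGroupAlg.basisVec (transBichar β) (a, 1))
      (r := fun b => TwistedGroupAlg.basisVec (transBichar β) (1, b))
      (fun a => TwistedGroupAlg.basisVec_mem_unitary _)
      (fun a => TwistedGroupAlg.basisVec_mem_unitary _)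
      (hstar _ fun a b => by simp [transBichar_apply])
      -- β(a⁻¹b, aw) β(a⁻¹b, a⁻¹) = β(a⁻¹b, w): the twist turns the orthogonal relation into the
      -- braided one.
      fun a b => by
        rw [transBichar_apply, braidedTwist, orthTwist, ← Circle.coe_mul, ← map_mul,
          mul_comm a w, mul_inv_cancel_right])
  obtain ⟨g, hg⟩ := FreeOrth.exists_hom hA hQ
    ((BraidedFreeOrth.isTwistedOrth_fund (β := β) (w := w) hA hQ).twist (θ' := orthTwist β w)
      (l := fun a => TwistedGroupAlg.basisVec (transBichar β)⁻¹ (a, 1))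
      (r := fun b => TwistedGroupAlg.basisVec (transBichar β)⁻¹ (1, b))
      (fun a => TwistedGroupAlg.basisVec_mem_unitary _)
      (fun a => TwistedGroupAlg.basisVec_mem_unitary _)
      (hstar _ fun a b => by
        change (transBichar β (a, 1) (1, b))⁻¹ = 1
        simp [transBichar_apply])
      fun a b => by
        have h : (transBichar β)⁻¹ (a, b) (a, b) = (β (a⁻¹ * b) a⁻¹)⁻¹ := rfl
        rw [h, braidedTwist, orthTwist, ← Circle.coe_mul, ← map_inv, inv_inv, ← map_mul,
          mul_comm w a])
  obtain ⟨δ, hδ⟩ := BraidedFreeOrth.exists_hom hA hQ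
    ((BraidedFreeOrth.isTwistedOrth_fund (β := β) (w := w) hA hQ).twist (θ' := braidedTwist β w)
      (s := fun _ _ => 1) (l := fun a => MonoidAlgebra.single a⁻¹ (1 : ℂ))
      (r := fun b => MonoidAlgebra.single b (1 : ℂ)) (fun a => single_mem_unitary _)
      (fun a => single_mem_unitary _)
      (fun a b => by
        rw [single_mul_single_one, single_mul_single_one, star_single, star_one, one_smul, mul_inv])
      fun a b => mul_one _)
  -- For l = 1 the matrix ∑ P_a ⊗ l_a is the identity matrix, as the counit requires.
  obtain ⟨ε, hε'⟩ := BraidedFreeOrth.exists_hom (β := β) (w := w) hA hQ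
    (isTwistedOrth_expand (E := ℂ) (l := 1) hA hQ (fun a => by simp [braidedTwist])
      (fun a => one_mem _) fun a => star_one _)
  rw [Q.expand_one] at hε'
  exact ⟨{
    hopf := ℋ
    proj := π
    toTwist := f
    ofTwist := g
    coact := δ
    counit := ε
    adjoin_u := BraidedFreeOrth.adjoin_eq_top hA hQ
    adjoin_v := FreeOrth.adjoin_eq_top hF'
    comul_v := hΔ
    counit_v := hε
    antipode_v := hS
    antipode_one := hS1
    antipode_mul := hSm
    hopfMap := hπ
    proj_v := hπv
    proj_antipode := hπS
    toTwist_u := by ext1 i j; exact hf i j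
    ofTwist_v := by ext1 i j; exact hg i j
    coact_u := by ext1 i j; exact hδ i j
    counit_u := hε' }⟩

end Main

end BraidedQG

end

theorem mainTheorem7 (m : ℕ) (hm : 2 ≤ m)
    (A : Matrix (Fin m) (Fin m) ℂ) (hA : IsUnit A.det)
    (hAA : A * A.map star ∈ unitary (Matrix (Fin m) (Fin m) ℂ))
    (τ : ℂ) (hτ : τ = 1 ∨ τ = -1) (hodd : Odd m → τ = 1) :
    (∃ (T : Type) (_ : CommGroup T) (_ : TopologicalSpace T) (_ : IsTopologicalGroup T)
        (_ : CompactSpace T) (_ : T2Space T)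
        (X : Matrix (Fin m) (Fin m) (MonoidAlgebra ℂ (PontryaginDual T)))
        (w : PontryaginDual T) (β : BraidedQG.Bichar (PontryaginDual T)),
        BraidedQG.IsAdmissible A τ X w β) ∧
    ∀ (T : Type*) [CommGroup T] [TopologicalSpace T] [IsTopologicalGroup T]
      [CompactSpace T] [T2Space T]
      (X : Matrix (Fin m) (Fin m) (MonoidAlgebra ℂ (PontryaginDual T)))
      (w : PontryaginDual T) (β : BraidedQG.Bichar (PontryaginDual T)),
      BraidedQG.IsAdmissible A τ X w β →
      ∃ 𝒜 : BraidedQG.BraidedHopfStar β (BraidedQG.BraidedFreeOrth A X β),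
        -- a braided compact matrix quantum group over `(T, X, β)` with fundamental unitary `U`
        BraidedQG.IsBraidedCMQG 𝒜 X (BraidedQG.BraidedFreeOrth.fund A X β) ∧
        (∀ i j, 𝒜.coact (BraidedQG.BraidedFreeOrth.fund A X β i j) =
          ∑ s, ∑ t, BraidedQG.BraidedFreeOrth.fund A X β s t ⊗ₜ[ℂ] (star (X s i) * X t j)) ∧
        (∀ i j, 𝒜.antipode (BraidedQG.BraidedFreeOrth.fund A X β i j) =
          star (BraidedQG.BraidedFreeOrth.fund A X β j i)) ∧
        -- it is the transmutation of `O_F^+`, `F = AC`, along `π : V ↦ w⁻¹X`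
        ∃ (ℋ : BraidedQG.HopfStar (BraidedQG.FreeOrth (A * BraidedQG.charMatrix X w β)))
          (π : BraidedQG.FreeOrth (A * BraidedQG.charMatrix X w β) →⋆ₐ[ℂ]
            MonoidAlgebra ℂ (PontryaginDual T))
          (Φ : BraidedQG.BraidedFreeOrth A X β ≃ₗ[ℂ]
            BraidedQG.FreeOrth (A * BraidedQG.charMatrix X w β)),
          (∀ i j, ℋ.comul (BraidedQG.FreeOrth.fund (A * BraidedQG.charMatrix X w β) i j) =
            ∑ k, BraidedQG.FreeOrth.fund (A * BraidedQG.charMatrix X w β) i k ⊗ₜ[ℂ]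
              BraidedQG.FreeOrth.fund (A * BraidedQG.charMatrix X w β) k j) ∧
          (∀ i j, ℋ.counit (BraidedQG.FreeOrth.fund (A * BraidedQG.charMatrix X w β) i j) =
            (1 : Matrix (Fin m) (Fin m) ℂ) i j) ∧
          (∀ i j, ℋ.antipode (BraidedQG.FreeOrth.fund (A * BraidedQG.charMatrix X w β) i j) =
            star (BraidedQG.FreeOrth.fund (A * BraidedQG.charMatrix X w β) j i)) ∧
          BraidedQG.IsHopfMap ℋ π ∧
          (∀ i j, π (BraidedQG.FreeOrth.fund (A * BraidedQG.charMatrix X w β) i j) =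
            MonoidAlgebra.single w⁻¹ (1 : ℂ) * X i j) ∧
          BraidedQG.IsTransmutation ℋ π 𝒜 Φ ∧
          ∀ i j, Φ (BraidedQG.BraidedFreeOrth.fund A X β i j) =
            BraidedQG.FreeOrth.fund (A * BraidedQG.charMatrix X w β) i j := by
  have hτ0 : τ ≠ 0 := by rcases hτ with rfl | rfl <;> simp
  refine ⟨?_, ?_⟩
  · obtain ⟨X, w, β, h⟩ := BraidedQG.exists_isAdmissible hA hAA hτ hodd
    exact ⟨BraidedQG.BohrCircle, inferInstance, inferInstance, inferInstance, inferInstance,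
      inferInstance, X, w, β, h⟩
  · intro T _ _ _ _ _ X w β h
    -- From here on X is w ∑ P_a a, so that π(v) = ∑ P_a a is w⁻¹X.
    obtain ⟨Q, rfl, hQ⟩ := h.exists_spectralFamily hA
    obtain ⟨D⟩ := BraidedQG.exists_transmutationData hA hQ hτ0 h.sign_eq
    refine ⟨D.braidedHopfStar, D.isBraidedCMQG hA hQ h.unitary h.conj_eq
      (BraidedQG.BraidedFreeOrth.isTwistedOrth_fund hA hQ), D.coact_u_apply w, D.antipode_u, D.hopf,
      D.proj, D.equiv, D.comul_v, D.counit_v, D.antipode_v, D.hopfMap, fun i j => ?_,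
      D.isTransmutation, D.equiv_u⟩
    rw [D.proj_v, BraidedQG.SpectralFamily.shift, Matrix.smul_apply, smul_eq_mul, ← mul_assoc,
      BraidedQG.single_mul_single_one, inv_mul_cancel]
    exact (one_mul _).symm
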